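/- Let $\Omega,\Omega'\subset\mathbb R^3$ be smooth bounded domains, let $g:\overline\Omega\to\overline{\Omega'}$ be a $C^1$-diffeomorphism, let $M>0$, and let $H:(0,\infty)\to[0,\infty)$ be convex with $\lim_{t\to\infty}H(t)/t=\lim_{s\to0^+}H(s)=+\infty$. Let $\mathcal A$ be the set of all $u\in W^{1,2}(\Omega,\mathbb R^3)$ such that $u|_{\partial\Omega}=g|_{\partial\Omega}$ (in the sense of traces), $\|u\|_{L^\infty}\le M$, $\det Du>0$ a.e., and $u$ is one-to-one outside a null set. For $u\in\mathcal A$ put $$E(u)=\int_\Omega |Du|^2+H(\det Du)\,dx,$$ $$\mathcal E(u)=\sup\Big\{\int_\Omega\langle\operatorname{cof}Du(x),D_xf(x,u(x))\rangle+\det Du(x)\,\operatorname{div}_yf(x,u(x))\,dx\;:\;f\in C_c^\infty(\Omega\times\mathbb R^3,\mathbb R^3),\ \|f\|_\infty\le1\Big\},$$ and let $\mathcal A_{nc}=\{u\in\mathcal A:\mathcal E(u)=0\}$. For $w\in W^{1,2}(\Omega,\mathbb R^3)$ with $\det Dw\in L^1(\Omega)$ let $G_w$ be the current of integration over the graph of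 $w$, $$\langle G_w,\omega\rangle=\int_\Omega\big\langle\omega(x,w(x)),(e_1,Dw\,e_1)\wedge(e_2,Dw\,e_2)\wedge(e_3,Dw\,e_3)\big\rangle\,dx$$ for smooth $3$-forms $\omega$ with compact support in $\Omega\times\mathbb R^3$. Let $(u_n)$ be a minimizing sequence for $E$ in $\mathcal A_{nc}$, or a minimizing sequence for $E$ in $\mathcal A$ with $\sup_n\mathcal E(u_n)<\infty$; in either case the infimum of $E$ over the class is assumed finite. Suppose that $u_n\rightharpoonup u$ weakly in $W^{1,2}(\Omega,\mathbb R^3)$ and that $\operatorname{cof}Du_n\rightharpoonup\operatorname{cof}Du$ weakly in $L^1(\Omega)$. Then $\det Du\in L^1(\Omega)$, $\det Du_n\in L^1(\Omega)$ for all large $n$, and $G_{u_n}\rightharpoonup G_u$ in the sense of currents, that is, $\langle G_{u_n},\omega\rangle\to\langle G_u,\omega\rangle$ for every smooth $3$-form $\omega$ with compact support in $\Omega\times\mathbb R^3$. -/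

import Mathlib

open MeasureTheory Filter Topology TopologicalSpace
open scoped ENNReal Distributions

noncomputable section

namespace NeoHookean

/-- Three-dimensional Euclidean space. -/
abbrev E3 : Type := EuclideanSpace ℝ (Fin 3)

/-- The canonical basis vectors of `ℝ³`. -/
def e (j : Fin 3) : E3 := EuclideanSpace.single j 1

/-- A smooth bounded domain: open, connected (hence non-empty), bounded, and near every boundary
point equal to the sublevel set of a smooth function with non-vanishing differential. -/
structure IsSmoothBoundedDomain (Ω : Set E3) : Prop where
  isOpen : IsOpen Ω
  isConnected : IsConnected Ω
  isBounded : Bornology.IsBounded Ω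
  smooth_boundary : ∀ p ∈ frontier Ω, ∃ U : Set E3, IsOpen U ∧ p ∈ U ∧
    ∃ ρ : E3 → ℝ, ContDiff ℝ ((⊤ : ℕ∞) : WithTop ℕ∞) ρ ∧ fderiv ℝ ρ p ≠ 0 ∧ Ω ∩ U = {x | ρ x < 0} ∩ U

/-- `g` restricts to a `C¹`-diffeomorphism from `K` onto `K'` (used for closures of smooth
domains). -/
def IsC1Diffeo (g : E3 → E3) (K K' : Set E3) : Prop :=
  ContDiffOn ℝ 1 g K ∧ Set.MapsTo g K K' ∧
    ∃ h : E3 → E3, ContDiffOn ℝ 1 h K' ∧ Set.MapsTo h K' K ∧ Set.InvOn h g K K'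

/-- The assumptions on the volumetric energy `H`, a function on `(0, ∞)` (its values elsewhere
play no role). -/
structure IsVolumetricEnergy (H : ℝ → ℝ) : Prop where
  nonneg : ∀ t, 0 < t → 0 ≤ H t
  convexOn : ConvexOn ℝ (Set.Ioi 0) H
  superlinear : Tendsto (fun t => H t / t) atTop atTop
  blowup : Tendsto H (𝓝[>] 0) atTop

/-- An element of `W^{1,2}(Ω, ℝ³)`: a representative `val` together with (a representative of)
its weak gradient, `grad x i j = ∂_j u^i (x)`. Only the values a.e. in `Ω` matter. -/
structure W12 (Ω : Opens E3) where
  val : E3 → E3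
  grad : E3 → Matrix (Fin 3) (Fin 3) ℝ
  memLp_val : MemLp val 2 (volume.restrict (Ω : Set E3))
  memLp_grad : ∀ i j, MemLp (fun x => grad x i j) 2 (volume.restrict (Ω : Set E3))
  weak_grad : ∀ (φ : 𝓓(Ω, ℝ)) (i j : Fin 3),
    ∫ x in (Ω : Set E3), val x i * fderiv ℝ φ x (e j)
      = - ∫ x in (Ω : Set E3), grad x i j * φ x

/-- The cofactor matrix, characterised by `Aᵀ * cof A = det A • 1`. -/
def cof (A : Matrix (Fin 3) (Fin 3) ℝ) : Matrix (Fin 3) (Fin 3) ℝ := A.adjugate.transpose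

variable {Ω : Opens E3}

/-- The traces of `w` and of `g ∈ C¹(Ω̄)` on `∂Ω` coincide: `w - g` lies in `W^{1,2}_0(Ω, ℝ³)`,
the `W^{1,2}`-closure of the test functions. -/
def W12.HasTrace (w : W12 Ω) (g : E3 → E3) : Prop :=
  ∃ φ : ℕ → 𝓓(Ω, E3),
    Tendsto (fun k => eLpNorm (fun x => w.val x - g x - φ k x) 2
      (volume.restrict (Ω : Set E3))) atTop (𝓝 0) ∧
    ∀ i j, Tendsto (fun k => eLpNorm
      (fun x => w.grad x i j - (fderiv ℝ g x (e j)) i - (fderiv ℝ (φ k) x (e j)) i) 2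
      (volume.restrict (Ω : Set E3))) atTop (𝓝 0)

/-- The class `𝒜` of admissible deformations. -/
def admissible (Ω : Opens E3) (g : E3 → E3) (M : ℝ) : Set (W12 Ω) :=
  {w | w.HasTrace g ∧
    (∀ᵐ x ∂(volume.restrict (Ω : Set E3)), ‖w.val x‖ ≤ M) ∧
    (∀ᵐ x ∂(volume.restrict (Ω : Set E3)), 0 < (w.grad x).det) ∧
    ∃ N : Set E3, volume N = 0 ∧ Set.InjOn w.val ((Ω : Set E3) \ N)}

/-- The neo-Hookean energy `∫_Ω |Dw|² + H(det Dw)`, with values in `[0, ∞]`. -/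
def energy (H : ℝ → ℝ) (w : W12 Ω) : ℝ≥0∞ :=
  ∫⁻ x in (Ω : Set E3),
    ENNReal.ofReal ((∑ i, ∑ j, (w.grad x i j) ^ 2) + H (w.grad x).det)

/-- The open set `Ω × ℝ³`. -/
def cyl (Ω : Opens E3) : Opens (E3 × E3) :=
  ⟨(Ω : Set E3) ×ˢ Set.univ, Ω.isOpen.prod isOpen_univ⟩

/-- `∫_Ω ⟨cof Dw(x), D_x f(x, w(x))⟩ + det Dw(x) div_y f(x, w(x)) dx`. -/
def surfacePairing (w : W12 Ω) (f : 𝓓(cyl Ω, E3)) : ℝ :=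
  ∫ x in (Ω : Set E3),
    ((∑ i, ∑ j, cof (w.grad x) i j * (fderiv ℝ f (x, w.val x) (e j, 0)) i)
      + (w.grad x).det * ∑ i, (fderiv ℝ f (x, w.val x) (0, e i)) i)

/-- The surface energy: the supremum of `surfacePairing w f` over test fields with `‖f‖_∞ ≤ 1`.
The supremum is non-negative (take `f = 0`), so it is taken in `[0, ∞]`. -/
def surfaceEnergy (w : W12 Ω) : ℝ≥0∞ :=
  ⨆ (f : 𝓓(cyl Ω, E3)) (_ : ∀ z, ‖f z‖ ≤ 1), ENNReal.ofReal (surfacePairing w f)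

/-- The class `𝒜_nc` of admissible deformations without surface energy (no cavitation). -/
def admissibleNC (Ω : Opens E3) (g : E3 → E3) (M : ℝ) : Set (W12 Ω) :=
  {w | w ∈ admissible Ω g M ∧ surfaceEnergy w = 0}

/-- `u` is a minimizing sequence of `F` in the class `C` (with finite infimum). -/
def IsMinimizingSeq {X : Type*} (F : X → ℝ≥0∞) (C : Set X) (u : ℕ → X) : Prop :=
  (∀ n, u n ∈ C) ∧ (⨅ w ∈ C, F w) < ⊤ ∧ Tendsto (fun n => F (u n)) atTop (𝓝 (⨅ w ∈ C, F w))

/-- Weak convergence of scalar functions on `Ω` tested with `L^q(Ω)`; with `q` the exponent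
conjugate to `p < ∞`, weak convergence in `L^p(Ω)`. -/
def WeakConv (Ω : Opens E3) (q : ℝ≥0∞) (f : ℕ → E3 → ℝ) (f₀ : E3 → ℝ) : Prop :=
  ∀ ψ : E3 → ℝ, MemLp ψ q (volume.restrict (Ω : Set E3)) →
    Tendsto (fun n => ∫ x in (Ω : Set E3), f n x * ψ x) atTop
      (𝓝 (∫ x in (Ω : Set E3), f₀ x * ψ x))

/-- Weak convergence in `W^{1,2}(Ω, ℝ³)`: the components of the maps and of their gradients
converge weakly in `L²(Ω)`. -/
def WeakConvW12 (u : ℕ → W12 Ω) (u₀ : W12 Ω) : Prop :=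
  (∀ i, WeakConv Ω 2 (fun n x => (u n).val x i) (fun x => u₀.val x i)) ∧
    ∀ i j, WeakConv Ω 2 (fun n x => (u n).grad x i j) (fun x => u₀.grad x i j)

/-- Weak convergence `cof Du_n ⇀ cof Du₀` in `L¹(Ω)`. -/
def WeakConvCofL1 (u : ℕ → W12 Ω) (u₀ : W12 Ω) : Prop :=
  ∀ i j, WeakConv Ω ⊤ (fun n x => cof ((u n).grad x) i j) (fun x => cof (u₀.grad x) i j)

/-- The space of smooth `3`-forms with compact support in `Ω × ℝ³`. -/
abbrev TestForm (Ω : Opens E3) : Type := 𝓓(cyl Ω, (E3 × E3) [⋀^Fin 3]→L[ℝ] ℝ)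

/-- All minors of `Dw` are integrable on `Ω`, so that the graph of `w` carries a current. On a
bounded domain the minors of order at most two of a `W^{1,2}` map are always integrable, so only
the determinant is mentioned. -/
def W12.HasGraphCurrent (w : W12 Ω) : Prop :=
  IntegrableOn (fun x => (w.grad x).det) (Ω : Set E3)

/-- The current `G_w` of integration over the graph of `w`:
`⟨G_w, ω⟩ = ∫_Ω ⟨ω(x, w(x)), (e₁, Dw e₁) ∧ (e₂, Dw e₂) ∧ (e₃, Dw e₃)⟩ dx`. -/
def graphCurrent (w : W12 Ω) (ω : TestForm Ω) : ℝ :=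
  ∫ x in (Ω : Set E3),
    ω (x, w.val x) (fun k => (e k, WithLp.toLp 2 (fun i => w.grad x i k)))

end NeoHookean

end

/-! ### Weak convergence in L¹: equi-integrability and compactness. -/

section WeakL1

variable {α : Type*} [MeasurableSpace α] {μ : Measure α}

/-! Among the minors of Du_n, only the determinant has no prescribed weak limit, so the heart of the
matter is that every weak L¹ limit θ of det Du_n equals det Du.

Such limits exist along subsequences: bounded energy and superlinear growth of H make the
determinants uniformly integrable (`exists_subseq_weak_L1`). The gradient bound and the bound by M
give strong L¹ convergence of u_n by a Rellich argument (`tendsto_eLpNorm_one_sub`), hence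
convergence a.e. along a further subsequence. A weakly convergent L¹ sequence is equi-integrable, so
it may be multiplied by a bounded a.e. convergent one (`tendsto_integral_mul_of_weakL1`). The
surface pairings therefore converge, and the limit functional Λ(f) = ∫ ⟨cof Du, D_x f⟩ + θ div_y f
inherits |Λ(f)| ≤ C ‖f‖_∞.

The identification of θ is a blow-up (`integral_integral_pairing_eq_zero`,
`ae_eq_det_of_bounded_pairing`). Λ involves first derivatives of f but is controlled by its
supremum. Convolve r⁻² k(·/r) with the measure η dx carried by the graph of u: the resulting field
has size O(r), while its differential at (x, u(x)) tends to η(x) ∫ Dk(z, Du(x) z) dz, because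
difference quotients of u converge to Du in L². As r → 0 the pairing of Dk with (cof Du(x), θ(x))
along the tangent plane integrates to zero for a.e. x. For a linear map A, integration by parts and
the cofactor identity reduce that integral to (θ − det A) ∫ div_y k(z, Az) dz
(`integral_pairing_linear`). A kernel equal to φ(z) y near the relevant part of the plane turns the
last factor into 3 ∫ φ > 0, so θ = det Du.

Finally, a 3-form evaluated on the graph is a sum of minors of Du with bounded continuous
coefficients (`form_apply_graph`), and all minors now converge weakly in L¹. The limit does not
depend on the subsequence, so the whole sequence of currents converges. -/

theorem MeasureTheory.Integrable.mul_memLp_top {f ψ : α → ℝ} (hf : Integrable f μ)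
    (hψ : MemLp ψ ⊤ μ) : Integrable (fun x => f x * ψ x) μ :=
  hf.mul_of_top_left hψ

/-- The set of integrable functions with values in `[-1, 1]`. -/
noncomputable def unitBallLp (μ : Measure α) [IsFiniteMeasure μ] : Set (Lp ℝ 1 μ) :=
  Set.Icc (-(Lp.const 1 μ (1 : ℝ))) (Lp.const 1 μ (1 : ℝ))

theorem mem_unitBallLp_iff [IsFiniteMeasure μ] (ψ : Lp ℝ 1 μ) :
    ψ ∈ unitBallLp μ ↔ ∀ᵐ x ∂μ, |ψ x| ≤ 1 := by
  have hc := Lp.coeFn_const (p := 1) (μ := μ) (1 : ℝ)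
  have hn := Lp.coeFn_neg (Lp.const 1 μ (1 : ℝ))
  rw [unitBallLp, Set.mem_Icc, ← Lp.coeFn_le, ← Lp.coeFn_le]
  constructor
  · rintro ⟨h1, h2⟩
    filter_upwards [hc, hn, h1, h2] with x a b c d
    rw [b, Pi.neg_apply, a] at c
    rw [a] at d
    exact abs_le.2 ⟨c, d⟩
  · intro h
    constructor
    · filter_upwards [hc, hn, h] with x a b c
      rw [b, Pi.neg_apply, a]
      exact (abs_le.1 c).1
    · filter_upwards [hc, hn, h] with x a b c
      rw [a]
      exact (abs_le.1 c).2

/-- The ball of L^∞ carries the L¹ metric here. L¹ convergence gives a.e. convergence of a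
subsequence, and the common bound 1 makes |h| a dominating function; without that bound an h that is
merely integrable would not do. -/
theorem continuous_integral_mul_unitBallLp [IsFiniteMeasure μ] {h : α → ℝ} (hh : Integrable h μ) :
    Continuous fun ψ : unitBallLp μ => ∫ x, h x * (ψ : Lp ℝ 1 μ) x ∂μ := by
  apply continuous_iff_seqContinuous.2
  intro ψ ψ₀ hψ
  apply tendsto_of_subseq_tendsto
  intro ns hns
  have h1 : Tendsto (fun n => ((ψ (ns n) : unitBallLp μ) : Lp ℝ 1 μ)) atTop (𝓝 ψ₀) :=
    (continuous_subtype_val.tendsto _).comp (hψ.comp hns)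
  obtain ⟨ms, -, hms⟩ := (tendstoInMeasure_of_tendsto_Lp h1).exists_seq_tendsto_ae
  refine ⟨ms, tendsto_integral_of_dominated_convergence (fun x => |h x|) ?_ hh.abs ?_ ?_⟩
  · intro n
    exact hh.aestronglyMeasurable.mul (Lp.aestronglyMeasurable _)
  · intro n
    filter_upwards [(mem_unitBallLp_iff _).1 (ψ (ns (ms n))).2] with x hx
    rw [norm_mul, Real.norm_eq_abs, Real.norm_eq_abs]
    exact mul_le_of_le_one_right (abs_nonneg _) hx
  · filter_upwards [hms] with x hx
    exact hx.const_mul _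

/-- A sequence converging to `0` weakly in `L¹` is equi-integrable: it converges to `0` against
bounded sequences that converge to `0` almost everywhere. -/
theorem tendsto_integral_mul_zero_of_weakL1 [IsFiniteMeasure μ] {h : ℕ → α → ℝ}
    (hh : ∀ n, Integrable (h n) μ)
    (hw : ∀ ψ : α → ℝ, MemLp ψ ⊤ μ → Tendsto (fun n => ∫ x, h n x * ψ x ∂μ) atTop (𝓝 0))
    {c : ℕ → α → ℝ} (hcm : ∀ n, AEStronglyMeasurable (c n) μ)
    (hcb : ∀ n, ∀ᵐ x ∂μ, |c n x| ≤ 1)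
    (hc0 : ∀ᵐ x ∂μ, Tendsto (fun n => c n x) atTop (𝓝 0)) :
    Tendsto (fun n => ∫ x, h n x * c n x ∂μ) atTop (𝓝 0) := by
  rw [Metric.tendsto_atTop]
  intro ε hε
  have : CompleteSpace (unitBallLp μ) :=
    (isClosed_Icc (a := -(Lp.const 1 μ (1 : ℝ)))).completeSpace_coe
  have : Nonempty (unitBallLp μ) :=
    ⟨⟨0, (mem_unitBallLp_iff _).2 (by
      filter_upwards [Lp.coeFn_zero ℝ 1 μ] with x hx
      rw [hx]
      simp)⟩⟩
  -- Baire category: these closed sets cover the complete space of test functions, so one of them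
  -- contains a ball around some ψ₀. This makes the smallness uniform near ψ₀.
  let F : ℕ → Set (unitBallLp μ) := fun N =>
    {ψ | ∀ n ≥ N, |∫ x, h n x * (ψ : Lp ℝ 1 μ) x ∂μ| ≤ ε / 3}
  have hF : ∀ N, IsClosed (F N) := by
    intro N
    simp only [F, Set.ofPred_forall]
    refine isClosed_iInter fun n => isClosed_iInter fun _ => ?_
    exact isClosed_le (continuous_integral_mul_unitBallLp (hh n)).abs continuous_const
  have hU : ⋃ N, F N = Set.univ := by
    rw [Set.eq_univ_iff_forall]
    rintro ⟨ψ, hψ⟩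
    have hm : MemLp (ψ : α → ℝ) ⊤ μ :=
      memLp_top_of_bound (Lp.aestronglyMeasurable _) 1 ((mem_unitBallLp_iff _).1 hψ)
    obtain ⟨N, hN⟩ := Metric.tendsto_atTop.1 (hw ψ hm) (ε / 3) (by positivity)
    refine Set.mem_iUnion.2 ⟨N, fun n hn => ?_⟩
    have := hN n hn
    rw [Real.dist_eq, sub_zero] at this
    exact this.le
  obtain ⟨N, ψ₀, hψ₀⟩ := nonempty_interior_of_iUnion_of_closed hF hU
  obtain ⟨ρ, hρ, hball⟩ := Metric.isOpen_iff.1 isOpen_interior ψ₀ hψ₀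
  have hb0 := (mem_unitBallLp_iff _).1 ψ₀.2
  -- test functions close to `ψ₀`
  have key : ∀ f : α → ℝ, AEStronglyMeasurable f μ → (∀ᵐ x ∂μ, |f x| ≤ 1) →
      ∫ x, |f x - (ψ₀ : Lp ℝ 1 μ) x| ∂μ < ρ → ∀ n ≥ N, |∫ x, h n x * f x ∂μ| ≤ ε / 3 := by
    intro f hf hf1 hfρ n hn
    have hfL : MemLp f 1 μ := (memLp_top_of_bound hf 1 hf1).mono_exponent le_top
    have hco := hfL.coeFn_toLp
    have hmem : hfL.toLp f ∈ unitBallLp μ := by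
      rw [mem_unitBallLp_iff]
      filter_upwards [hco, hf1] with x h1 h2
      rwa [h1]
    have hd : (⟨hfL.toLp f, hmem⟩ : unitBallLp μ) ∈ Metric.ball ψ₀ ρ := by
      rw [Metric.mem_ball, Subtype.dist_eq, dist_eq_norm, L1.norm_eq_integral_norm]
      refine lt_of_eq_of_lt (integral_congr_ae ?_) hfρ
      filter_upwards [hco, Lp.coeFn_sub (hfL.toLp f) (ψ₀ : Lp ℝ 1 μ)] with x h1 h2
      rw [h2, Pi.sub_apply, h1, Real.norm_eq_abs]
    have := interior_subset (hball hd) n hn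
    refine le_of_eq_of_le (congrArg _ (integral_congr_ae ?_)) this
    filter_upwards [hco] with x h1
    simp [h1]
  have hcL : Tendsto (fun n => ∫ x, 2 * |c n x| ∂μ) atTop (𝓝 0) := by
    rw [show (0 : ℝ) = ∫ x, (0 : ℝ) ∂μ by simp]
    refine tendsto_integral_of_dominated_convergence (fun _ => 2) ?_ (integrable_const _) ?_ ?_
    · exact fun n => (hcm n).norm.const_mul 2
    · intro n
      filter_upwards [hcb n] with x hx
      rw [Real.norm_eq_abs, abs_of_nonneg (by positivity)]
      linarith
    · filter_upwards [hc0] with x hx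
      simpa using (hx.abs.const_mul 2)
  obtain ⟨N', hN'⟩ := Metric.tendsto_atTop.1 hcL ρ hρ
  refine ⟨max N N', fun n hn => ?_⟩
  have hnN : n ≥ N := le_trans (le_max_left _ _) hn
  have hsmall := hN' n (le_trans (le_max_right _ _) hn)
  rw [Real.dist_eq, sub_zero] at hsmall
  have hsmall' := lt_of_le_of_lt (le_abs_self _) hsmall
  set p : α → ℝ := ⇑(ψ₀ : Lp ℝ 1 μ) with hp
  have hpm : AEStronglyMeasurable p μ := Lp.aestronglyMeasurable _
  have hci : Integrable (fun x => 2 * |c n x|) μ :=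
    (Integrable.of_bound (hcm n) 1 (hcb n)).abs.const_mul 2
  -- To move from ψ₀ = p to the origin, c is written as (p(1 − |c|) + c) − p(1 − |c|). Both terms
  -- stay in [−1, 1], and both differ from p by at most 2|c|, hence lie in the Baire ball once ∫
  -- 2|c| < ρ.
  have hm2 : AEStronglyMeasurable (fun x => p x * (1 - |c n x|)) μ :=
    hpm.mul (aestronglyMeasurable_const.sub (hcm n).norm)
  have hm1 : AEStronglyMeasurable (fun x => p x * (1 - |c n x|) + c n x) μ := hm2.add (hcm n)
  have hb2 : ∀ᵐ x ∂μ, |p x * (1 - |c n x|)| ≤ 1 := by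
    filter_upwards [hcb n, hb0] with x h1 h2
    rw [abs_mul, abs_of_nonneg (sub_nonneg.2 h1)]
    have := abs_nonneg (c n x)
    have := mul_le_mul h2 (show 1 - |c n x| ≤ 1 by linarith) (sub_nonneg.2 h1) zero_le_one
    linarith
  have hb1 : ∀ᵐ x ∂μ, |p x * (1 - |c n x|) + c n x| ≤ 1 := by
    filter_upwards [hcb n, hb0] with x h1 h2
    refine (abs_add_le _ _).trans ?_
    rw [abs_mul, abs_of_nonneg (sub_nonneg.2 h1)]
    have := mul_le_mul_of_nonneg_right h2 (sub_nonneg.2 h1)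
    linarith
  have e1 := key _ hm1 hb1 (by
    refine lt_of_le_of_lt (integral_mono_of_nonneg (ae_of_all _ fun x => abs_nonneg _) hci ?_)
      hsmall'
    filter_upwards [hb0] with x h2
    have : p x * (1 - |c n x|) + c n x - p x = c n x - p x * |c n x| := by ring
    rw [this]
    refine (abs_sub _ _).trans ?_
    rw [abs_mul, abs_abs]
    have := mul_le_mul_of_nonneg_right h2 (abs_nonneg (c n x))
    linarith) n hnN
  have e2 := key _ hm2 hb2 (by
    refine lt_of_le_of_lt (integral_mono_of_nonneg (ae_of_all _ fun x => abs_nonneg _) hci ?_)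
      hsmall'
    filter_upwards [hb0] with x h2
    have : p x * (1 - |c n x|) - p x = - (p x * |c n x|) := by ring
    rw [this, abs_neg, abs_mul, abs_abs]
    have := mul_le_mul_of_nonneg_right h2 (abs_nonneg (c n x))
    have := abs_nonneg (c n x)
    linarith) n hnN
  have i1 : Integrable (fun x => h n x * (p x * (1 - |c n x|) + c n x)) μ :=
    (hh n).mul_memLp_top (memLp_top_of_bound hm1 1 hb1)
  have i2 : Integrable (fun x => h n x * (p x * (1 - |c n x|))) μ :=
    (hh n).mul_memLp_top (memLp_top_of_bound hm2 1 hb2)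
  have hsplit : ∫ x, h n x * c n x ∂μ = ∫ x, h n x * (p x * (1 - |c n x|) + c n x) ∂μ
      - ∫ x, h n x * (p x * (1 - |c n x|)) ∂μ := by
    rw [← integral_sub i1 i2]
    congr 1
    ext x
    ring
  rw [Real.dist_eq, sub_zero, hsplit]
  have := abs_sub (∫ x, h n x * (p x * (1 - |c n x|) + c n x) ∂μ)
    (∫ x, h n x * (p x * (1 - |c n x|)) ∂μ)
  linarith

/-- Products of a weakly convergent sequence in `L¹` with a bounded, almost everywhere convergent
sequence. -/
theorem tendsto_integral_mul_of_weakL1 [IsFiniteMeasure μ] {f : ℕ → α → ℝ} {f₀ : α → ℝ}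
    (hf : ∀ n, Integrable (f n) μ) (hf₀ : Integrable f₀ μ)
    (hw : ∀ ψ : α → ℝ, MemLp ψ ⊤ μ →
      Tendsto (fun n => ∫ x, f n x * ψ x ∂μ) atTop (𝓝 (∫ x, f₀ x * ψ x ∂μ)))
    {b : ℕ → α → ℝ} {b₀ : α → ℝ} (hbm : ∀ n, AEStronglyMeasurable (b n) μ) {B : ℝ}
    (hbb : ∀ n, ∀ᵐ x ∂μ, |b n x| ≤ B)
    (hb : ∀ᵐ x ∂μ, Tendsto (fun n => b n x) atTop (𝓝 (b₀ x))) :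
    Tendsto (fun n => ∫ x, f n x * b n x ∂μ) atTop (𝓝 (∫ x, f₀ x * b₀ x ∂μ)) := by
  have hb₀m : AEStronglyMeasurable b₀ μ := aestronglyMeasurable_of_tendsto_ae atTop hbm hb
  have hb₀b : ∀ᵐ x ∂μ, |b₀ x| ≤ B := by
    filter_upwards [hb, ae_all_iff.2 hbb] with x h1 h2
    exact le_of_tendsto h1.abs (Eventually.of_forall h2)
  have hb₀L : MemLp b₀ ⊤ μ := memLp_top_of_bound hb₀m B hb₀b
  -- Normalises b n − b₀, which is at most 2|B|, to values in [−1, 1]; the summand 1 keeps K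
  -- positive.
  set K : ℝ := 2 * |B| + 1 with hK
  have hKpos : 0 < K := by positivity
  have hz := tendsto_integral_mul_zero_of_weakL1 (μ := μ) (h := fun n x => f n x - f₀ x)
    (fun n => (hf n).sub hf₀) (fun ψ hψ => by
      have h1 := (hw ψ hψ).sub_const (∫ x, f₀ x * ψ x ∂μ)
      rw [sub_self] at h1
      refine h1.congr fun n => ?_
      rw [← integral_sub ((hf n).mul_memLp_top hψ) (hf₀.mul_memLp_top hψ)]
      simp only [sub_mul])
    (c := fun n x => K⁻¹ * (b n x - b₀ x)) (fun n => ((hbm n).sub hb₀m).const_mul _)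
    (fun n => by
      filter_upwards [hbb n, hb₀b] with x h1 h2
      rw [abs_mul, abs_inv, abs_of_pos hKpos, inv_mul_le_iff₀ hKpos, mul_one]
      have := abs_sub (b n x) (b₀ x)
      have := le_abs_self B
      linarith)
    (by
      filter_upwards [hb] with x hx
      have := (hx.sub_const (b₀ x)).const_mul K⁻¹
      simpa using this)
  have h2 : Tendsto (fun n => ∫ x, f₀ x * b n x ∂μ) atTop (𝓝 (∫ x, f₀ x * b₀ x ∂μ)) := by
    refine tendsto_integral_of_dominated_convergence (fun x => |f₀ x| * B) ?_
      (hf₀.abs.mul_const _) ?_ ?_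
    · exact fun n => hf₀.aestronglyMeasurable.mul (hbm n)
    · intro n
      filter_upwards [hbb n] with x hx
      rw [norm_mul, Real.norm_eq_abs, Real.norm_eq_abs]
      exact mul_le_mul_of_nonneg_left hx (abs_nonneg _)
    · filter_upwards [hb] with x hx
      exact hx.const_mul _
  -- f_n b_n = (f_n − f₀)(b_n − b₀) + (f_n − f₀) b₀ + f₀ b_n: equi-integrability, weak convergence
  -- and dominated convergence treat the three terms.
  have h3 := ((hz.const_mul K).add ((hw b₀ hb₀L).sub_const (∫ x, f₀ x * b₀ x ∂μ))).add h2
  rw [mul_zero, sub_self, zero_add, zero_add] at h3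
  refine h3.congr fun n => ?_
  have hbL : MemLp (b n) ⊤ μ := memLp_top_of_bound (hbm n) B (hbb n)
  have a1 := (hf n).mul_memLp_top hbL
  have a2 := (hf n).mul_memLp_top hb₀L
  have a3 := hf₀.mul_memLp_top hbL
  have a4 := hf₀.mul_memLp_top hb₀L
  have : K * ∫ x, (f n x - f₀ x) * (K⁻¹ * (b n x - b₀ x)) ∂μ
      = (∫ x, f n x * b n x ∂μ - ∫ x, f n x * b₀ x ∂μ)
        - (∫ x, f₀ x * b n x ∂μ - ∫ x, f₀ x * b₀ x ∂μ) := by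
    have a12 : Integrable (fun x => f n x * b n x - f n x * b₀ x) μ := a1.sub a2
    have a34 : Integrable (fun x => f₀ x * b n x - f₀ x * b₀ x) μ := a3.sub a4
    rw [← integral_const_mul, ← integral_sub a1 a2, ← integral_sub a3 a4, ← integral_sub a12 a34]
    congr 1
    ext x
    field_simp
  rw [this]
  ring

theorem memLp_top_ae_abs_le {ψ : α → ℝ} (hψ : MemLp ψ ⊤ μ) :
    ∃ B : ℝ, 0 ≤ B ∧ ∀ᵐ x ∂μ, |ψ x| ≤ B := by
  refine ⟨(eLpNorm ψ ⊤ μ).toReal, ENNReal.toReal_nonneg, ?_⟩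
  filter_upwards [ae_le_eLpNormEssSup (f := ψ) (μ := μ)] with x hx
  rw [← eLpNorm_exponent_top] at hx
  rw [← Real.norm_eq_abs, ← toReal_enorm]
  exact ENNReal.toReal_mono hψ.eLpNorm_ne_top hx

theorem abs_integral_mul_le {f ψ : α → ℝ} (hf : Integrable f μ) {B : ℝ}
    (hψ : ∀ᵐ x ∂μ, |ψ x| ≤ B) : |∫ x, f x * ψ x ∂μ| ≤ B * ∫ x, |f x| ∂μ := by
  rw [← integral_const_mul]
  refine (norm_integral_le_integral_norm (fun x => f x * ψ x)).trans ?_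
  refine integral_mono_of_nonneg (ae_of_all _ fun x => norm_nonneg _) (hf.abs.const_mul B) ?_
  filter_upwards [hψ] with x hx
  rw [norm_mul, Real.norm_eq_abs, Real.norm_eq_abs, mul_comm]
  exact mul_le_mul_of_nonneg_right hx (abs_nonneg _)

/-- Simultaneous weak sequential compactness of countably many bounded sequences in `L²`. -/
theorem exists_subseq_weak_L2 [SeparableSpace (Lp ℝ 2 μ)] (t : ℕ → ℕ → Lp ℝ 2 μ) (R : ℕ → ℝ)
    (ht : ∀ n k, ‖t n k‖ ≤ R k) :
    ∃ φ : ℕ → ℕ, StrictMono φ ∧ ∃ τ : ℕ → Lp ℝ 2 μ, ∀ k, ∀ v : Lp ℝ 2 μ,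
      Tendsto (fun n => inner ℝ (t (φ n) k) v) atTop (𝓝 (inner ℝ (τ k) v)) := by
  -- A countable product of weak-* compact metrizable balls is sequentially compact, which replaces
  -- a diagonal extraction.
  let s : ℕ → Set (WeakDual ℝ (Lp ℝ 2 μ)) := fun k =>
    WeakDual.toStrongDual ⁻¹' Metric.closedBall 0 (R k)
  have hs : ∀ k, IsCompact (s k) := fun k => WeakDual.isCompact_closedBall 0 (R k)
  have : ∀ k, CompactSpace (s k) := fun k => isCompact_iff_compactSpace.1 (hs k)
  have : ∀ k, MetrizableSpace (s k) := fun k => WeakDual.metrizable_of_isCompact ℝ _ _ (hs k)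
  let x : ℕ → ∀ k, s k := fun n k =>
    ⟨StrongDual.toWeakDual (innerSL ℝ (t n k)), by
      simp only [s, Set.mem_preimage, mem_closedBall_zero_iff]
      exact (innerSL_apply_norm ℝ (t n k)).trans_le (ht n k)⟩
  obtain ⟨a, φ, hφ, ha⟩ := CompactSpace.tendsto_subseq x
  refine ⟨φ, hφ, fun k => (InnerProductSpace.toDual ℝ (Lp ℝ 2 μ)).symm
    (WeakDual.toStrongDual (a k : WeakDual ℝ (Lp ℝ 2 μ))), fun k v => ?_⟩
  rw [InnerProductSpace.toDual_symm_apply]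
  have h1 := (continuous_subtype_val.tendsto _).comp ((tendsto_pi_nhds.1 ha) k)
  have h2 := ((WeakDual.eval_continuous v).tendsto _).comp h1
  exact h2

/-- Weak sequential compactness in `L¹` of non-negative uniformly integrable sequences. -/
theorem exists_subseq_weak_L1 [IsFiniteMeasure μ] [SeparableSpace (Lp ℝ 2 μ)] {f : ℕ → α → ℝ}
    (hf : ∀ n, Integrable (f n) μ) (hnn : ∀ n, ∀ᵐ x ∂μ, 0 ≤ f n x)
    (hui : ∀ ε : ℝ, 0 < ε → ∃ K : ℕ, ∀ n, ∫ x, (f n x - min (f n x) K) ∂μ ≤ ε) :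
    ∃ φ : ℕ → ℕ, StrictMono φ ∧ ∃ θ : α → ℝ, Integrable θ μ ∧
      ∀ ψ : α → ℝ, MemLp ψ ⊤ μ →
        Tendsto (fun n => ∫ x, f (φ n) x * ψ x ∂μ) atTop (𝓝 (∫ x, θ x * ψ x ∂μ)) := by
  have hTm : ∀ n (k : ℕ), AEStronglyMeasurable (fun x => min (f n x) (k : ℝ)) μ := fun n k =>
    (hf n).aestronglyMeasurable.inf aestronglyMeasurable_const
  have hTb : ∀ n (k : ℕ), ∀ᵐ x ∂μ, ‖min (f n x) (k : ℝ)‖ ≤ k := by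
    intro n k
    filter_upwards [hnn n] with x hx
    rw [Real.norm_eq_abs, abs_of_nonneg (le_min hx (Nat.cast_nonneg k))]
    exact min_le_right _ _
  have hTtop : ∀ n (k : ℕ), MemLp (fun x => min (f n x) (k : ℝ)) ⊤ μ := fun n k =>
    memLp_top_of_bound (hTm n k) k (hTb n k)
  have hT2 : ∀ n (k : ℕ), MemLp (fun x => min (f n x) (k : ℝ)) 2 μ := fun n k =>
    (hTtop n k).mono_exponent le_top
  have hT1 : ∀ n (k : ℕ), Integrable (fun x => min (f n x) (k : ℝ)) μ := fun n k =>
    memLp_one_iff_integrable.1 ((hTtop n k).mono_exponent le_top)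
  -- The truncations at height k are bounded in L² for each k, so one subsequence makes all of them
  -- converge weakly. Their limits τ k will be shown to be Cauchy in L¹.
  obtain ⟨φ, hφ, τ, hτ⟩ := exists_subseq_weak_L2 (fun n k => (hT2 n k).toLp _)
    (fun k => measureUnivNNReal μ ^ (2 : ℝ≥0∞).toReal⁻¹ * (k : ℝ)) (fun n k => by
      refine Lp.norm_le_of_ae_bound (Nat.cast_nonneg k) ?_
      filter_upwards [(hT2 n k).coeFn_toLp, hTb n k] with x h1 h2
      rwa [h1])
  have hτ1 : ∀ k, Integrable (τ k) μ := fun k =>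
    memLp_one_iff_integrable.1 ((Lp.memLp (τ k)).mono_exponent (by norm_num))
  have hτw : ∀ k : ℕ, ∀ ψ : α → ℝ, MemLp ψ ⊤ μ →
      Tendsto (fun n => ∫ x, min (f (φ n) x) (k : ℝ) * ψ x ∂μ) atTop
        (𝓝 (∫ x, τ k x * ψ x ∂μ)) := by
    intro k ψ hψ
    have hψ2 : MemLp ψ 2 μ := hψ.mono_exponent le_top
    have h1 := hτ k (hψ2.toLp ψ)
    simp only [L2.inner_def] at h1
    have e2 : ∫ x, inner ℝ (τ k x) (hψ2.toLp ψ x) ∂μ = ∫ x, τ k x * ψ x ∂μ := by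
      refine integral_congr_ae ?_
      filter_upwards [hψ2.coeFn_toLp] with x h1
      rw [h1]
      simp [mul_comm]
    rw [e2] at h1
    refine h1.congr fun n => integral_congr_ae ?_
    filter_upwards [hψ2.coeFn_toLp, (hT2 (φ n) k).coeFn_toLp] with x h1 h2
    rw [h1, h2]
    simp [mul_comm]
  have htail : ∀ n (k l : ℕ), k ≤ l →
      ∫ x, |min (f n x) (l : ℝ) - min (f n x) (k : ℝ)| ∂μ
        ≤ ∫ x, (f n x - min (f n x) k) ∂μ := by
    intro n k l hkl
    refine integral_mono ((hT1 n l).sub (hT1 n k)).abs ((hf n).sub (hT1 n k)) fun x => ?_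
    have hkl' : (k : ℝ) ≤ l := Nat.cast_le.2 hkl
    have := min_le_min_left (f n x) hkl'
    simp only
    rw [abs_of_nonneg (sub_nonneg.2 this)]
    have := min_le_left (f n x) (l : ℝ)
    linarith
  have hcauchy : ∀ ε : ℝ, 0 < ε → ∃ K : ℕ, (∀ n, ∫ x, (f n x - min (f n x) K) ∂μ ≤ ε) ∧
      ∀ l ≥ K, ∫ x, |τ l x - τ K x| ∂μ ≤ ε := by
    intro ε hε
    obtain ⟨K, hK⟩ := hui ε hε
    refine ⟨K, hK, fun l hl => ?_⟩
    -- Testing with the sign of τ l − τ K turns weak convergence into lower semicontinuity of the L¹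
    -- norm.
    let ψ : α → ℝ := fun x => if 0 ≤ τ l x - τ K x then 1 else -1
    have hψm : Measurable ψ := Measurable.ite
      (measurableSet_le measurable_const
        ((Lp.stronglyMeasurable (τ l)).measurable.sub (Lp.stronglyMeasurable (τ K)).measurable))
      measurable_const measurable_const
    have hψ1 : ∀ x, |ψ x| ≤ 1 := by
      intro x
      simp only [ψ]
      split_ifs <;> simp
    have hψ : MemLp ψ ⊤ μ := memLp_top_of_bound hψm.aestronglyMeasurable 1 (ae_of_all _ hψ1)
    have h1 := (hτw l ψ hψ).sub (hτw K ψ hψ)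
    have e : ∫ x, |τ l x - τ K x| ∂μ = ∫ x, τ l x * ψ x ∂μ - ∫ x, τ K x * ψ x ∂μ := by
      rw [← integral_sub ((hτ1 l).mul_memLp_top hψ) ((hτ1 K).mul_memLp_top hψ)]
      congr 1
      ext x
      simp only [ψ]
      split_ifs with h
      · rw [abs_of_nonneg h]
        ring
      · rw [abs_of_neg (not_le.1 h)]
        ring
    rw [e]
    refine le_of_tendsto h1 (Eventually.of_forall fun n => ?_)
    rw [← integral_sub ((hT1 _ l).mul_memLp_top hψ) ((hT1 _ K).mul_memLp_top hψ)]
    have h2 := abs_integral_mul_le ((hT1 (φ n) l).sub (hT1 (φ n) K)) (ae_of_all μ hψ1)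
    simp only [Pi.sub_apply, sub_mul, one_mul] at h2
    exact (le_abs_self _).trans (h2.trans ((htail _ _ _ hl).trans (hK _)))
  have hLp : ∀ k, MemLp (τ k) 1 μ := fun k => memLp_one_iff_integrable.2 (hτ1 k)
  have hdist : ∀ (g : Lp ℝ 1 μ) k, dist ((hLp k).toLp _) g = ∫ x, |τ k x - g x| ∂μ := by
    intro g k
    rw [dist_eq_norm, L1.norm_eq_integral_norm]
    refine integral_congr_ae ?_
    filter_upwards [Lp.coeFn_sub ((hLp k).toLp _) g, (hLp k).coeFn_toLp] with x h1 h2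
    rw [h1, Pi.sub_apply, h2, Real.norm_eq_abs]
  have hC : CauchySeq fun k => (hLp k).toLp (τ k) := by
    rw [Metric.cauchySeq_iff']
    intro ε hε
    obtain ⟨K, -, hK⟩ := hcauchy (ε / 2) (by positivity)
    refine ⟨K, fun l hl => ?_⟩
    rw [hdist]
    refine lt_of_le_of_lt (le_of_eq_of_le (integral_congr_ae ?_) (hK l hl)) (by linarith)
    filter_upwards [(hLp K).coeFn_toLp] with x h2
    rw [h2]
  obtain ⟨Θ, hΘ⟩ := cauchySeq_tendsto_of_complete hC
  have hΘ1 : Integrable Θ μ := L1.integrable_coeFn Θ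
  refine ⟨φ, hφ, Θ, hΘ1, fun ψ hψ => ?_⟩
  obtain ⟨B, hB0, hB⟩ := memLp_top_ae_abs_le hψ
  rw [Metric.tendsto_atTop]
  intro ε hε
  -- Three errors are at most ε/4 each: truncating f, truncating θ, and weak convergence at level K.
  -- B + 1 avoids division by zero.
  have hδ : 0 < ε / (4 * (B + 1)) := by positivity
  obtain ⟨K, hK1, hK2⟩ := hcauchy _ hδ
  have hK3 : ∫ x, |τ K x - Θ x| ∂μ ≤ ε / (4 * (B + 1)) := by
    rw [← hdist, dist_comm]
    have hd := hΘ.dist (tendsto_const_nhds (x := (hLp K).toLp (τ K)))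
    refine le_of_tendsto hd ?_
    filter_upwards [eventually_ge_atTop K] with l hl
    rw [hdist]
    refine le_of_eq_of_le (integral_congr_ae ?_) (hK2 l hl)
    filter_upwards [(hLp K).coeFn_toLp] with x h2
    rw [h2]
  obtain ⟨N, hN⟩ := Metric.tendsto_atTop.1 (hτw K ψ hψ) (ε / 4) (by positivity)
  refine ⟨N, fun n hn => ?_⟩
  have h1 := hN n hn
  rw [Real.dist_eq] at h1 ⊢
  have h2 := abs_integral_mul_le ((hf (φ n)).sub (hT1 (φ n) K)) hB
  have h3 := abs_integral_mul_le ((hτ1 K).sub hΘ1) hB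
  simp only [Pi.sub_apply, sub_mul] at h2 h3
  rw [integral_sub ((hf _).mul_memLp_top hψ) ((hT1 _ K).mul_memLp_top hψ)] at h2
  rw [integral_sub ((hτ1 K).mul_memLp_top hψ) (hΘ1.mul_memLp_top hψ)] at h3
  have h4 : ∫ x, |f (φ n) x - min (f (φ n) x) (K : ℝ)| ∂μ ≤ ε / (4 * (B + 1)) := by
    refine le_of_eq_of_le (integral_congr_ae (ae_of_all _ fun x => ?_)) (hK1 (φ n))
    exact abs_of_nonneg (sub_nonneg.2 (min_le_left _ _))
  have h5 : B * (ε / (4 * (B + 1))) ≤ ε / 4 := by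
    rw [mul_div_assoc', div_le_div_iff₀ (by positivity) (by norm_num)]
    nlinarith
  have h6 := h2.trans ((mul_le_mul_of_nonneg_left h4 hB0).trans h5)
  have h7 := h3.trans ((mul_le_mul_of_nonneg_left hK3 hB0).trans h5)
  rw [abs_le] at h6 h7
  rw [abs_lt] at h1 ⊢
  constructor <;> linarith

end WeakL1

/-! ### Translations, difference quotients and weak derivatives in L². -/

section TranslateGroup

variable {G : Type*} [AddGroup G] [MeasurableSpace G] [MeasurableAdd G] {μ : Measure G}
  [μ.IsAddRightInvariant]

theorem MeasureTheory.MemLp.comp_sub_right {F : Type*} [NormedAddCommGroup F] {p : ℝ≥0∞}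
    {w : G → F} (hw : MemLp w p μ) (h : G) : MemLp (fun x => w (x - h)) p μ :=
  hw.comp_measurePreserving (measurePreserving_sub_right μ h)

theorem eLpNorm_comp_sub_right {F : Type*} [NormedAddCommGroup F] {p : ℝ≥0∞}
    {w : G → F} (hw : AEStronglyMeasurable w μ) (h : G) :
    eLpNorm (fun x => w (x - h)) p μ = eLpNorm w p μ :=
  eLpNorm_comp_measurePreserving hw (measurePreserving_sub_right μ h)

end TranslateGroup

section Translation

variable {E : Type*} [NormedAddCommGroup E] [NormedSpace ℝ E] [FiniteDimensional ℝ E]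
  [MeasurableSpace E] [BorelSpace E] {μ : Measure E}

theorem MeasureTheory.MemLp.integrable_fun_mul {α : Type*} [MeasurableSpace α] {ν : Measure α}
    {f g : α → ℝ} (hf : MemLp f 2 ν) (hg : MemLp g 2 ν) : Integrable (fun x => f x * g x) ν :=
  hf.integrable_mul hg

theorem abs_integral_mul_le_eLpNorm {α : Type*} [MeasurableSpace α] {ν : Measure α}
    {f g : α → ℝ} (hf : MemLp f 2 ν) (hg : MemLp g 2 ν) :
    |∫ x, f x * g x ∂ν| ≤ (eLpNorm f 2 ν).toReal * (eLpNorm g 2 ν).toReal := by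
  have h := abs_real_inner_le_norm (hf.toLp f) (hg.toLp g)
  rw [L2.inner_def, Lp.norm_toLp, Lp.norm_toLp] at h
  refine le_of_eq_of_le (congrArg _ (integral_congr_ae ?_)) h
  filter_upwards [hf.coeFn_toLp, hg.coeFn_toLp] with x h1 h2
  rw [h1, h2]
  simp [mul_comm]

/-- Converse of the Cauchy-Schwarz inequality, tested with smooth functions. -/
theorem eLpNorm_two_le_of_forall_smooth [IsFiniteMeasureOnCompacts μ] {R : E → ℝ}
    (hR : MemLp R 2 μ) {κ : ℝ} (hκ : 0 ≤ κ)
    (h : ∀ φ : E → ℝ, ContDiff ℝ (⊤ : ℕ∞) φ → HasCompactSupport φ →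
      |∫ x, R x * φ x ∂μ| ≤ κ * (eLpNorm φ 2 μ).toReal) :
    eLpNorm R 2 μ ≤ ENNReal.ofReal κ := by
  set ρ : ℝ := (eLpNorm R 2 μ).toReal with hρ
  have hρ0 : 0 ≤ ρ := ENNReal.toReal_nonneg
  -- The ideal test function is R itself; a smooth ε-approximation φ gives ρ² = ∫ Rφ + ∫ R(R − φ) ≤
  -- κ(ρ + ε) + ρε.
  have key : ∀ ε : ℝ, 0 < ε → ρ * ρ ≤ κ * ρ + ε * (κ + ρ) := by
    intro ε hε
    obtain ⟨φ, hφc, hφs, hφ⟩ := hR.exist_eLpNorm_sub_le (by norm_num) (by norm_num) hε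
    have hφ2 : MemLp φ 2 μ := hφs.continuous.memLp_of_hasCompactSupport hφc
    have hs : MemLp (R - φ) 2 μ := hR.sub hφ2
    have hsε : (eLpNorm (R - φ) 2 μ).toReal ≤ ε := ENNReal.toReal_le_of_le_ofReal hε.le hφ
    have h1 := h φ hφs hφc
    have h2 := abs_integral_mul_le_eLpNorm hR hs
    have hφn : (eLpNorm φ 2 μ).toReal ≤ ρ + ε := by
      have h3 : eLpNorm φ 2 μ ≤ eLpNorm R 2 μ + eLpNorm (R - φ) 2 μ := by
        have := eLpNorm_sub_le (p := 2) (μ := μ) hR.1 hs.1 (by norm_num)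
        simpa using this
      have h4 := ENNReal.toReal_mono (ENNReal.add_ne_top.2 ⟨hR.2.ne, hs.2.ne⟩) h3
      rw [ENNReal.toReal_add hR.2.ne hs.2.ne] at h4
      linarith
    have h5 : ρ * ρ = ∫ x, R x * φ x ∂μ + ∫ x, R x * (R - φ) x ∂μ := by
      rw [← integral_add (hR.integrable_fun_mul hφ2) (hR.integrable_fun_mul hs)]
      have h6 : ρ * ρ = inner ℝ (hR.toLp R) (hR.toLp R) := by
        rw [real_inner_self_eq_norm_mul_norm, Lp.norm_toLp]
      rw [h6, L2.inner_def]
      refine integral_congr_ae ?_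
      filter_upwards [hR.coeFn_toLp] with x hx
      rw [hx]
      simp
      ring
    rw [← hρ] at h2
    have := mul_le_mul_of_nonneg_left hφn hκ
    have := mul_le_mul_of_nonneg_left hsε hρ0
    have := le_abs_self (∫ x, R x * φ x ∂μ)
    have := le_abs_self (∫ x, R x * (R - φ) x ∂μ)
    nlinarith
  have hfin : ρ * ρ ≤ κ * ρ := by
    refine le_of_forall_pos_le_add fun ε hε => ?_
    have hp : 0 < κ + ρ + 1 := by positivity
    refine (key (ε / (κ + ρ + 1)) (by positivity)).trans ?_
    have : ε / (κ + ρ + 1) * (κ + ρ) ≤ ε := by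
      rw [div_mul_eq_mul_div, div_le_iff₀ hp]
      nlinarith
    linarith
  rw [← ENNReal.ofReal_toReal hR.2.ne, ← hρ]
  refine ENNReal.ofReal_le_ofReal ?_
  rcases hρ0.eq_or_lt with h0 | h0
  · rwa [← h0]
  · exact le_of_mul_le_mul_right hfin h0

variable [μ.IsAddHaarMeasure]

/-- The integral is the convolution of w with the reflection of φ, evaluated at −t h, so smoothness
of convolutions allows differentiation under the integral. -/
theorem hasDerivAt_integral_mul_translate {w φ : E → ℝ} (hw : MemLp w 2 μ)
    (hφ : ContDiff ℝ (⊤ : ℕ∞) φ) (hφc : HasCompactSupport φ) (h : E) (t : ℝ) :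
    HasDerivAt (fun t : ℝ => ∫ x, w x * φ (x + t • h) ∂μ)
      (∫ x, w x * fderiv ℝ φ (x + t • h) h ∂μ) t := by
  have hwl : LocallyIntegrable w μ := hw.locallyIntegrable (by norm_num)
  set ψ : E → ℝ := fun y => φ (-y) with hψ
  have hψs : ContDiff ℝ (⊤ : ℕ∞) ψ := hφ.comp contDiff_neg
  have hψ1 : ContDiff ℝ 1 ψ := hψs.of_le (by exact_mod_cast le_top)
  have hψc : HasCompactSupport ψ := hφc.comp_homeomorph (Homeomorph.neg E)
  have h1 := hψc.hasFDerivAt_convolution_right (ContinuousLinearMap.mul ℝ ℝ) hwl hψ1 (-(t • h))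
  have h2 : HasDerivAt (fun t : ℝ => -(t • h)) (-h) t := by
    have := ((hasDerivAt_id t).smul_const h).fun_neg
    simpa using this
  have h3 := h1.comp_hasDerivAt t h2
  rw [convolution_precompR_apply _ hwl (hψc.fderiv ℝ) (hψ1.continuous_fderiv one_ne_zero)] at h3
  have e1 : (fun t : ℝ => ∫ x, w x * φ (x + t • h) ∂μ)
      = convolution w ψ (ContinuousLinearMap.mul ℝ ℝ) μ ∘ fun t => -(t • h) := by
    ext s
    simp only [Function.comp, convolution_def, ContinuousLinearMap.mul_apply', hψ]
    refine integral_congr_ae (ae_of_all _ fun x => ?_)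
    have : x + s • h = -(-(s • h) - x) := by abel
    simp only [this]
  have e2 : ∫ x, w x * fderiv ℝ φ (x + t • h) h ∂μ
      = convolution w (fun a => fderiv ℝ ψ a (-h)) (ContinuousLinearMap.mul ℝ ℝ) μ (-(t • h)) := by
    simp only [convolution_def, ContinuousLinearMap.mul_apply']
    refine integral_congr_ae (ae_of_all _ fun x => ?_)
    have hd : DifferentiableAt ℝ φ (-(-(t • h) - x)) := (hφ.differentiable (by simp)) _
    have h4 : HasFDerivAt ψ ((fderiv ℝ φ (-(-(t • h) - x))).comp (-ContinuousLinearMap.id ℝ E))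
        (-(t • h) - x) := hd.hasFDerivAt.comp _ (hasFDerivAt_id _).neg
    simp only [h4.fderiv]
    simp
  rw [e1, e2]
  exact h3

/-- Quantitative first-order expansion in `L²` of a function with a weak derivative `d` in the
direction `h`. -/
theorem eLpNorm_sub_translate_sub_le {w d : E → ℝ} {h : E} (hw : MemLp w 2 μ) (hd : MemLp d 2 μ)
    (hwd : ∀ φ : E → ℝ, ContDiff ℝ (⊤ : ℕ∞) φ → HasCompactSupport φ →
      ∫ x, w x * fderiv ℝ φ x h ∂μ = - ∫ x, d x * φ x ∂μ)
    {κ : ℝ} (hκ : 0 ≤ κ)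
    (ht : ∀ t ∈ Set.Icc (0 : ℝ) 1,
      eLpNorm (fun x => d (x - t • h) - d x) 2 μ ≤ ENNReal.ofReal κ) :
    eLpNorm (fun x => w x - w (x - h) - d x) 2 μ ≤ ENNReal.ofReal κ := by
  have hwh := hw.comp_sub_right h
  refine eLpNorm_two_le_of_forall_smooth ((hw.sub hwh).sub hd) hκ fun φ hφ hφc => ?_
  have hφ2 : MemLp φ 2 μ := hφ.continuous.memLp_of_hasCompactSupport hφc
  have hφt : ∀ a : E, MemLp (fun x => φ (x + a)) 2 μ := fun a => by
    simpa using hφ2.comp_sub_right (-a)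
  have htr : ∀ (v : E → ℝ) (a : E), ∫ x, v x * φ (x + a) ∂μ = ∫ x, v (x - a) * φ x ∂μ := by
    intro v a
    rw [← integral_add_right_eq_self (fun x => v (x - a) * φ x) a]
    simp
  -- Chosen so that Φ 1 − Φ 0 is minus the remainder tested with φ, while Φ' t is minus d(· − t h) −
  -- d tested with φ. The mean value inequality then carries the bound κ from the derivative to the
  -- remainder.
  set Φ : ℝ → ℝ := fun t => ∫ x, w x * φ (x + t • h) ∂μ + t * ∫ x, d x * φ x ∂μ with hΦ
  set Φ' : ℝ → ℝ := fun t => ∫ x, w x * fderiv ℝ φ (x + t • h) h ∂μ + ∫ x, d x * φ x ∂μ with hΦ'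
  have hder : ∀ t ∈ Set.Icc (0 : ℝ) 1, HasDerivWithinAt Φ (Φ' t) (Set.Icc 0 1) t := by
    intro t _
    have h1 := (hasDerivAt_integral_mul_translate hw hφ hφc h t).add
      ((hasDerivAt_id t).mul_const (∫ x, d x * φ x ∂μ))
    rw [one_mul] at h1
    exact h1.hasDerivWithinAt
  have hbound : ∀ t ∈ Set.Ico (0 : ℝ) 1, ‖Φ' t‖ ≤ κ * (eLpNorm φ 2 μ).toReal := by
    intro t hmem
    have hdt := hd.comp_sub_right (t • h)
    have h1 : Φ' t = - ∫ x, (d (x - t • h) - d x) * φ x ∂μ := by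
      have h2 := hwd (fun x => φ (x + t • h)) (hφ.comp (contDiff_id.add contDiff_const))
        (hφc.comp_homeomorph (Homeomorph.addRight (t • h)))
      simp only [fderiv_comp_add_right] at h2
      rw [htr d] at h2
      simp only [sub_mul]
      rw [integral_sub (hdt.integrable_fun_mul hφ2) (hd.integrable_fun_mul hφ2)]
      simp only [Φ']
      rw [h2]
      ring
    rw [h1, norm_neg, Real.norm_eq_abs]
    refine (abs_integral_mul_le_eLpNorm (hdt.sub hd) hφ2).trans ?_
    exact mul_le_mul_of_nonneg_right
      (ENNReal.toReal_le_of_le_ofReal hκ (ht t ⟨hmem.1, hmem.2.le⟩)) ENNReal.toReal_nonneg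
  have h5 := norm_image_sub_le_of_norm_deriv_le_segment_01' hder hbound
  have h6 : ∫ x, (w x - w (x - h) - d x) * φ x ∂μ = -(Φ 1 - Φ 0) := by
    have a1 := hw.integrable_fun_mul hφ2
    have a2 := hwh.integrable_fun_mul hφ2
    have a3 := hd.integrable_fun_mul hφ2
    have : ∫ x, (w x - w (x - h) - d x) * φ x ∂μ
        = ∫ x, w x * φ x ∂μ - ∫ x, w (x - h) * φ x ∂μ - ∫ x, d x * φ x ∂μ := by
      rw [← integral_sub a1 a2]
      have a12 : Integrable (fun x => w x * φ x - w (x - h) * φ x) μ := a1.sub a2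
      have := integral_sub a12 a3
      rw [← this]
      congr 1
      ext x
      ring
    rw [this]
    simp only [Φ, one_smul, zero_smul, htr, sub_zero]
    ring
  have h7 : |∫ x, (w x - w (x - h) - d x) * φ x ∂μ| ≤ κ * (eLpNorm φ 2 μ).toReal := by
    rw [h6, abs_neg]
    exact h5
  exact h7

/-- Continuity of translations in `L²`. -/
theorem tendsto_eLpNorm_translate_sub {d : E → ℝ} (hd : MemLp d 2 μ) :
    Tendsto (fun h : E => eLpNorm (fun x => d (x - h) - d x) 2 μ) (𝓝 0) (𝓝 0) := by
  let g : E → C(E, E) := fun h => ⟨fun x => x - h, by fun_prop⟩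
  have hg : Continuous g := ContinuousMap.continuous_of_continuous_uncurry _ (by
    simp only [g, Function.uncurry_def, ContinuousMap.coe_mk]
    fun_prop)
  have hgm : ∀ h, MeasurePreserving (g h) μ μ := fun h => measurePreserving_sub_right μ h
  have h1 := (tendsto_const_nhds (x := hd.toLp d) (f := 𝓝 (0 : E))).compMeasurePreservingLp
    (hg.tendsto 0) hgm (hgm 0) (by norm_num)
  have h2 := (tendsto_iff_edist_tendsto_0.1 h1)
  refine h2.congr fun h => ?_
  rw [Lp.edist_def]
  refine eLpNorm_congr_ae ?_
  have hc := hd.coeFn_toLp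
  filter_upwards [Lp.coeFn_compMeasurePreserving (hd.toLp d) (hgm h),
    Lp.coeFn_compMeasurePreserving (hd.toLp d) (hgm 0), hc,
    (hgm h).quasiMeasurePreserving.ae hc] with x a b c e
  rw [Pi.sub_apply, a, b]
  simp only [Function.comp, g, ContinuousMap.coe_mk, sub_zero] at e ⊢
  rw [c, e]

/-- Convergence in `L²` of difference quotients to the weak derivative. -/
theorem tendsto_eLpNorm_difference_quotient {w d : E → ℝ} {z : E} (hw : MemLp w 2 μ)
    (hd : MemLp d 2 μ)
    (hwd : ∀ φ : E → ℝ, ContDiff ℝ (⊤ : ℕ∞) φ → HasCompactSupport φ →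
      ∫ x, w x * fderiv ℝ φ x z ∂μ = - ∫ x, d x * φ x ∂μ) :
    Tendsto (fun r : ℝ => eLpNorm (fun x => r⁻¹ * (w x - w (x - r • z)) - d x) 2 μ)
      (𝓝[≠] 0) (𝓝 0) := by
  rw [ENNReal.tendsto_nhds_zero]
  intro ε hε
  rcases eq_or_ne ε ⊤ with rfl | hεt
  · exact Eventually.of_forall fun _ => le_top
  have h1 := (ENNReal.tendsto_nhds_zero.1 (tendsto_eLpNorm_translate_sub hd)) ε hε
  obtain ⟨δ, hδ, hball⟩ := Metric.eventually_nhds_iff_ball.1 h1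
  have h2 : Tendsto (fun r : ℝ => r • z) (𝓝 0) (𝓝 0) := by
    have : Continuous fun r : ℝ => r • z := by fun_prop
    simpa using this.tendsto 0
  have h3 := h2.eventually (Metric.ball_mem_nhds 0 hδ)
  filter_upwards [h3.filter_mono nhdsWithin_le_nhds, self_mem_nhdsWithin] with r hr hr0
  have hr0' : r ≠ 0 := hr0
  have hrd : MemLp (fun x => r * d x) 2 μ := hd.const_mul r
  -- The expansion is used for the step r z, whose weak derivative is r d. Continuity of
  -- translations bounds the remainder by |r| ε, and dividing by r leaves ε.
  have hb := eLpNorm_sub_translate_sub_le (h := r • z) (κ := |r| * ε.toReal) hw hrd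
    (fun φ hφ hφc => by
      have := hwd φ hφ hφc
      simp only [map_smul, smul_eq_mul]
      have e1 : ∀ x, w x * (r * fderiv ℝ φ x z) = r * (w x * fderiv ℝ φ x z) := fun x => by ring
      have e2 : ∀ x, r * d x * φ x = r * (d x * φ x) := fun x => by ring
      simp only [e1, e2, integral_const_mul, this]
      ring)
    (by positivity)
    (fun t ht => by
      have e1 : (fun x => r * d (x - t • r • z) - r * d x)
          = r • fun x => d (x - t • r • z) - d x := by
        ext x
        simp only [Pi.smul_apply, smul_eq_mul]
        ring
      rw [e1, eLpNorm_const_smul, ENNReal.ofReal_mul (abs_nonneg r),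
        ENNReal.ofReal_toReal hεt, ← Real.norm_eq_abs, ofReal_norm]
      gcongr
      refine hball _ ?_
      rw [dist_zero_right] at hr
      rw [mem_ball_zero_iff, norm_smul, Real.norm_eq_abs, abs_of_nonneg ht.1]
      exact lt_of_le_of_lt (mul_le_of_le_one_left (norm_nonneg _) ht.2) hr)
  have e3 : (fun x => r⁻¹ * (w x - w (x - r • z)) - d x)
      = r⁻¹ • fun x => w x - w (x - r • z) - r * d x := by
    ext x
    simp only [Pi.smul_apply, smul_eq_mul]
    field_simp
  rw [e3, eLpNorm_const_smul]
  calc ‖r⁻¹‖ₑ * eLpNorm (fun x => w x - w (x - r • z) - r * d x) 2 μ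
      ≤ ‖r⁻¹‖ₑ * ENNReal.ofReal (|r| * ε.toReal) := by gcongr
    _ = ε := by
      rw [← ofReal_norm, ← ENNReal.ofReal_mul (norm_nonneg _), norm_inv, Real.norm_eq_abs,
        ← mul_assoc, inv_mul_cancel₀ (abs_ne_zero.2 hr0'), one_mul, ENNReal.ofReal_toReal hεt]

/-- Translation estimate in `L²` for a function with a weak derivative `d` in the direction `h`. -/
theorem eLpNorm_sub_translate_le {w d : E → ℝ} {h : E} (hw : MemLp w 2 μ) (hd : MemLp d 2 μ)
    (hwd : ∀ φ : E → ℝ, ContDiff ℝ (⊤ : ℕ∞) φ → HasCompactSupport φ →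
      ∫ x, w x * fderiv ℝ φ x h ∂μ = - ∫ x, d x * φ x ∂μ) :
    eLpNorm (fun x => w x - w (x - h)) 2 μ ≤ 3 * eLpNorm d 2 μ := by
  -- No smallness is available, so d(· − t h) − d is bounded crudely by 2‖d‖; adding d back produces
  -- the factor 3.
  have hb := eLpNorm_sub_translate_sub_le (κ := (2 * eLpNorm d 2 μ).toReal) hw hd hwd
    ENNReal.toReal_nonneg (fun t _ => by
      rw [ENNReal.ofReal_toReal (ENNReal.mul_ne_top (by norm_num) hd.2.ne), two_mul]
      have := eLpNorm_sub_le (p := 2) (hd.comp_sub_right (t • h)).1 hd.1 (by norm_num)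
      rwa [eLpNorm_comp_sub_right hd.1] at this)
  rw [ENNReal.ofReal_toReal (ENNReal.mul_ne_top (by norm_num) hd.2.ne)] at hb
  have e : (fun x => w x - w (x - h)) = (fun x => w x - w (x - h) - d x) + d := by
    ext x
    simp
  rw [e]
  refine (eLpNorm_add_le ((hw.sub (hw.comp_sub_right h)).sub hd).1 hd.1 (by norm_num)).trans ?_
  calc _ ≤ 2 * eLpNorm d 2 μ + eLpNorm d 2 μ := add_le_add hb le_rfl
    _ = 3 * eLpNorm d 2 μ := by ring

end Translation

/-! ### Cutoffs and mollification: from weak L² to strong L¹ convergence. -/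

section Cutoff

variable {E : Type*} [NormedAddCommGroup E] [NormedSpace ℝ E] [FiniteDimensional ℝ E]

/-- Smooth cutoff functions. -/
theorem exists_smooth_cutoff {K U : Set E} (hK : IsCompact K) (hU : IsOpen U) (hKU : K ⊆ U) :
    ∃ ζ : E → ℝ, ContDiff ℝ (⊤ : ℕ∞) ζ ∧ HasCompactSupport ζ ∧ tsupport ζ ⊆ U ∧
      (∀ x ∈ K, ζ x = 1) ∧ ∀ x, ζ x ∈ Set.Icc (0 : ℝ) 1 := by
  obtain ⟨L, hL, hKL, hLU⟩ := exists_compact_between hK hU hKU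
  obtain ⟨f, h0, h1, h01⟩ := exists_contMDiffMap_zero_one_of_isClosed (n := ⊤)
    (modelWithCornersSelf ℝ E) (isOpen_interior (s := L)).isClosed_compl hK.isClosed
    (Set.disjoint_left.2 fun x hx hxK => hx (hKL hxK))
  have hsupp : tsupport f ⊆ L := by
    refine closure_minimal (fun x hx => ?_) hL.isClosed
    by_contra hxL
    exact hx (h0 fun h => hxL (interior_subset h))
  exact ⟨f, f.contMDiff.contDiff, HasCompactSupport.of_support_subset_isCompact hL
    (subset_closure.trans hsupp), hsupp.trans hLU, fun x hx => h1 hx, h01⟩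

end Cutoff

section Mollify

variable {E : Type*} [NormedAddCommGroup E] [NormedSpace ℝ E] [FiniteDimensional ℝ E]
  [MeasurableSpace E] [BorelSpace E] {μ : Measure E} [μ.IsAddHaarMeasure]

/-- The `L¹`-distance between a function and its mollification is controlled by translations. -/
theorem eLpNorm_sub_mollify_le {d : E → ℝ} (hd : MemLp d 2 μ) {B : Set E}
    (ρ : ContDiffBump (0 : E)) {C : ℝ≥0∞}
    (hC : ∀ h : E, ‖h‖ ≤ ρ.rOut → eLpNorm (fun x => d x - d (x - h)) 1 (μ.restrict B) ≤ C) :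
    eLpNorm (fun x => d x - convolution d (ρ.normed μ) (ContinuousLinearMap.mul ℝ ℝ) μ x) 1
      (μ.restrict B) ≤ C := by
  have hdl : LocallyIntegrable d μ := hd.locallyIntegrable (by norm_num)
  have hρi : Integrable (ρ.normed μ) μ := ρ.integrable_normed
  have hlin : ∫⁻ h, ‖ρ.normed μ h‖ₑ ∂μ = 1 := by
    have h1 := ofReal_integral_norm_eq_lintegral_enorm hρi
    rw [← h1]
    have : ∀ h, ‖ρ.normed μ h‖ = ρ.normed μ h := fun h =>
      Real.norm_of_nonneg (ρ.nonneg_normed h)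
    simp [this, ρ.integral_normed]
  -- The kernel has mass one, so the mollification error is an average of translation differences
  -- over ‖h‖ < ρ.rOut.
  have hrepr : ∀ x, d x - convolution d (ρ.normed μ) (ContinuousLinearMap.mul ℝ ℝ) μ x
      = ∫ h, ρ.normed μ h * (d x - d (x - h)) ∂μ := by
    intro x
    have hex := ρ.hasCompactSupport_normed (μ := μ) |>.convolutionExists_right
      (ContinuousLinearMap.mul ℝ ℝ) hdl ρ.continuous_normed x
    have hex' := hex.integrable_swap
    simp only [ContinuousLinearMap.mul_apply'] at hex'
    rw [convolution_eq_swap]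
    simp only [ContinuousLinearMap.mul_apply', mul_sub]
    rw [integral_sub (hρi.mul_const _) (by simpa only [mul_comm] using hex'),
      integral_mul_const, ρ.integral_normed, one_mul]
    simp only [mul_comm]
  rw [eLpNorm_one_eq_lintegral_enorm]
  calc ∫⁻ x in B, ‖d x - convolution d (ρ.normed μ) (ContinuousLinearMap.mul ℝ ℝ) μ x‖ₑ ∂μ
      ≤ ∫⁻ x in B, ∫⁻ h, ‖ρ.normed μ h‖ₑ * ‖d x - d (x - h)‖ₑ ∂μ ∂μ := by
        refine lintegral_mono fun x => ?_
        rw [hrepr]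
        refine (enorm_integral_le_lintegral_enorm _).trans_eq ?_
        simp only [enorm_mul]
    _ = ∫⁻ h, ∫⁻ x in B, ‖ρ.normed μ h‖ₑ * ‖d x - d (x - h)‖ₑ ∂μ ∂μ := by
        refine lintegral_lintegral_swap ?_
        have hm : AEStronglyMeasurable (fun p : E × E => d p.1 - d (p.1 - p.2)) (μ.prod μ) :=
          hd.1.comp_fst.sub (hd.1.comp_quasiMeasurePreserving
            (quasiMeasurePreserving_sub μ μ))
        have hm' : AEStronglyMeasurable (fun p : E × E => d p.1 - d (p.1 - p.2))
            ((μ.restrict B).prod μ) := hm.mono_ac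
              (Measure.AbsolutelyContinuous.prod Measure.restrict_le_self.absolutelyContinuous
                Measure.AbsolutelyContinuous.rfl)
        exact (hρi.1.comp_snd.enorm).mul hm'.enorm
    _ ≤ ∫⁻ h, ‖ρ.normed μ h‖ₑ * C ∂μ := by
        refine lintegral_mono fun h => ?_
        by_cases hh : ‖h‖ ≤ ρ.rOut
        · rw [lintegral_const_mul' _ _ enorm_ne_top]
          gcongr
          have := hC h hh
          rwa [eLpNorm_one_eq_lintegral_enorm] at this
        · have : ρ.normed μ h = 0 := by
            rw [← Function.notMem_support, ρ.support_normed_eq, mem_ball_zero_iff]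
            linarith
          simp [this]
    _ = C := by rw [lintegral_mul_const'' _ hρi.1.enorm, hlin, one_mul]

/-- A sequence converging weakly to `0` in `L²` with uniformly Lipschitz translations converges
to `0` in `L¹` on sets of finite measure. -/
theorem tendsto_eLpNorm_one_of_weak_of_translate {d : ℕ → E → ℝ} (hd : ∀ n, MemLp (d n) 2 μ)
    {A : ℝ≥0∞} (hA : A ≠ ⊤) (hdA : ∀ n, eLpNorm (d n) 2 μ ≤ A)
    (hT : ∀ n h, eLpNorm (fun x => d n x - d n (x - h)) 2 μ ≤ ‖h‖ₑ * A)
    (hw : ∀ ψ : E → ℝ, MemLp ψ 2 μ → Tendsto (fun n => ∫ x, d n x * ψ x ∂μ) atTop (𝓝 0))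
    {B : Set E} (hB : μ B ≠ ⊤) :
    Tendsto (fun n => eLpNorm (d n) 1 (μ.restrict B)) atTop (𝓝 0) := by
  have : IsFiniteMeasure (μ.restrict B) := ⟨by simpa using hB.lt_top⟩
  -- A times the Hölder constant from L² to L¹ on B. The mollification error at scale r is then at
  -- most r D, uniformly in n.
  set D : ℝ≥0∞ := A * (μ.restrict B) Set.univ ^ (1 / (1 : ℝ≥0∞).toReal - 1 / (2 : ℝ≥0∞).toReal)
    with hD
  have hDt : D ≠ ⊤ := by
    refine ENNReal.mul_ne_top hA (ENNReal.rpow_ne_top_of_nonneg (by norm_num) ?_)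
    exact measure_ne_top _ _
  rw [ENNReal.tendsto_nhds_zero]
  intro ε hε
  obtain ⟨r, hr, hrε⟩ : ∃ r : ℝ, 0 < r ∧ ENNReal.ofReal r * D ≤ ε / 2 := by
    have h1 : Tendsto (fun r : ℝ => ENNReal.ofReal r * D) (𝓝[>] 0) (𝓝 0) := by
      have h2 : Tendsto (fun r : ℝ => ENNReal.ofReal r * D) (𝓝 0) (𝓝 (ENNReal.ofReal 0 * D)) :=
        ENNReal.Tendsto.mul_const (ENNReal.continuous_ofReal.tendsto 0) (Or.inr hDt)
      rw [ENNReal.ofReal_zero, zero_mul] at h2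
      exact h2.mono_left nhdsWithin_le_nhds
    have h3 := (ENNReal.tendsto_nhds_zero.1 h1) (ε / 2) (ENNReal.half_pos hε.ne')
    obtain ⟨r, hr1, hr2⟩ := (h3.and self_mem_nhdsWithin).exists
    exact ⟨r, hr2, hr1⟩
  let ρ : ContDiffBump (0 : E) := ⟨r / 2, r, by positivity, by linarith⟩
  have hρ2 : MemLp (ρ.normed μ) 2 μ :=
    ρ.continuous_normed.memLp_of_hasCompactSupport ρ.hasCompactSupport_normed
  set m : ℕ → E → ℝ := fun n => convolution (d n) (ρ.normed μ) (ContinuousLinearMap.mul ℝ ℝ) μ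
    with hm
  have hmeq : ∀ n x, m n x = ∫ t, d n t * ρ.normed μ (x - t) ∂μ := fun n x => by
    simp [hm, convolution_def]
  have hρx : ∀ x, MeasurePreserving (fun t => x - t) μ μ := fun x =>
    Measure.measurePreserving_sub_left μ x
  have hρx2 : ∀ x, MemLp (fun t => ρ.normed μ (x - t)) 2 μ := fun x =>
    hρ2.comp_measurePreserving (hρx x)
  have hmc : ∀ n, Continuous (m n) := fun n =>
    ρ.hasCompactSupport_normed.continuous_convolution_right _
      ((hd n).locallyIntegrable (by norm_num)) ρ.continuous_normed
  -- At a fixed scale, m n x is the pairing of d n with one fixed L² function, so weak convergence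
  -- gives pointwise convergence. Cauchy–Schwarz supplies a constant majorant on B.
  have hm0 : Tendsto (fun n => eLpNorm (m n) 1 (μ.restrict B)) atTop (𝓝 0) := by
    simp only [eLpNorm_one_eq_lintegral_enorm]
    have hlim := tendsto_lintegral_of_dominated_convergence (μ := μ.restrict B)
      (F := fun n x => ‖m n x‖ₑ) (f := fun _ => 0)
      (fun _ => A * eLpNorm (ρ.normed μ) 2 μ)
      (fun n => (hmc n).measurable.enorm) (fun n => ae_of_all _ fun x => by
        have h1 := abs_integral_mul_le_eLpNorm (hd n) (hρx2 x)
        rw [← hmeq] at h1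
        have h2 := eLpNorm_comp_measurePreserving hρ2.1 (hρx x) (p := 2)
        rw [show (fun t => ρ.normed μ (x - t)) = ρ.normed μ ∘ fun t => x - t from rfl, h2] at h1
        have h3 := ENNReal.ofReal_le_ofReal h1
        rw [← Real.norm_eq_abs, ofReal_norm, ENNReal.ofReal_mul ENNReal.toReal_nonneg,
          ENNReal.ofReal_toReal (hd n).2.ne, ENNReal.ofReal_toReal hρ2.2.ne] at h3
        exact h3.trans (mul_le_mul' (hdA n) le_rfl))
      (by
        simp only [lintegral_const]
        exact ENNReal.mul_ne_top (ENNReal.mul_ne_top hA hρ2.2.ne) (measure_ne_top _ _))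
      (ae_of_all _ fun x => by
        have h1 := hw _ (hρx2 x)
        simp only [← hmeq] at h1
        have := h1.enorm
        simpa using this)
    simpa using hlim
  filter_upwards [(ENNReal.tendsto_nhds_zero.1 hm0) (ε / 2) (ENNReal.half_pos hε.ne')] with n hn
  have hsub : eLpNorm (fun x => d n x - m n x) 1 (μ.restrict B) ≤ ε / 2 := by
    refine (eLpNorm_sub_mollify_le (hd n) ρ (C := ENNReal.ofReal r * D) fun h hh => ?_).trans hrε
    have h1 := eLpNorm_le_eLpNorm_mul_rpow_measure_univ (μ := μ.restrict B) (p := 1) (q := 2)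
      (f := fun x => d n x - d n (x - h)) (by norm_num)
      (((hd n).sub ((hd n).comp_sub_right h)).1.restrict)
    refine h1.trans ?_
    have h2 : eLpNorm (fun x => d n x - d n (x - h)) 2 (μ.restrict B) ≤ ENNReal.ofReal r * A := by
      refine (eLpNorm_restrict_le _ _ _ _).trans ((hT n h).trans ?_)
      gcongr
      rw [← ofReal_norm]
      exact ENNReal.ofReal_le_ofReal hh
    rw [hD, ← mul_assoc]
    gcongr
  have e : d n = (fun x => d n x - m n x) + m n := by
    ext x
    simp
  rw [e]
  refine (eLpNorm_add_le ((hd n).1.restrict.sub (hmc n).aestronglyMeasurable)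
    (hmc n).aestronglyMeasurable le_rfl).trans ?_
  calc _ ≤ ε / 2 + ε / 2 := add_le_add hsub hn
    _ = ε := ENNReal.add_halves ε

end Mollify

/-! ### Rellich compactness for the Sobolev maps. -/

namespace NeoHookean

theorem eq_sum_smul_e (z : E3) : z = ∑ j, z j • e j := by
  ext i
  fin_cases i <;> simp [Fin.sum_univ_three, e]

theorem norm_e (j : Fin 3) : ‖e j‖ = 1 := by
  simp [e]

theorem abs_apply_le_norm (z : E3) (i : Fin 3) : |z i| ≤ ‖z‖ := by
  simpa using PiLp.norm_apply_le z i

theorem clm_apply_eq_sum {F : Type*} [NormedAddCommGroup F] [NormedSpace ℝ F] (L : E3 →L[ℝ] F)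
    (z : E3) : L z = ∑ j, z j • L (e j) := by
  conv_lhs => rw [eq_sum_smul_e z]
  simp

/-- Multiplication by a cutoff extends a function known only on S to the whole space by zero. It
transfers the whole-space translation estimates to Ω, with no regularity of the boundary required.
-/
theorem memLp_mul_of_bound_support {α : Type*} [MeasurableSpace α] {μ : Measure α}
    {ζ f : α → ℝ} {S : Set α} (hS : MeasurableSet S) (hζ : AEStronglyMeasurable ζ μ) {b : NNReal}
    (hb : ∀ x, ‖ζ x‖ ≤ b) (h0 : ∀ x ∉ S, ζ x = 0) {p : ℝ≥0∞} (hf : MemLp f p (μ.restrict S)) :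
    MemLp (fun x => ζ x * f x) p μ ∧
      eLpNorm (fun x => ζ x * f x) p μ ≤ b * eLpNorm f p (μ.restrict S) := by
  have hind : (fun x => ζ x * f x) = S.indicator (fun x => ζ x * f x) := by
    ext x
    by_cases hx : x ∈ S
    · simp [hx]
    · simp [hx, h0 x hx]
  have hle : eLpNorm (fun x => ζ x * f x) p (μ.restrict S) ≤ b * eLpNorm f p (μ.restrict S) := by
    have := eLpNorm_le_nnreal_smul_eLpNorm_of_ae_le_mul (f := fun x => ζ x * f x) (g := f) (c := b)
      (μ := μ.restrict S) (ae_of_all _ fun x => by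
        rw [nnnorm_mul]
        exact mul_le_mul_of_nonneg_right (by exact_mod_cast hb x) zero_le) p
    simpa [ENNReal.smul_def] using this
  constructor
  · rw [hind, memLp_indicator_iff_restrict hS]
    exact ⟨hζ.restrict.mul hf.1, hle.trans_lt (ENNReal.mul_lt_top ENNReal.coe_lt_top hf.2)⟩
  · rw [hind, eLpNorm_indicator_eq_eLpNorm_restrict hS]
    exact hle

variable {Ω : Opens E3}

theorem W12.memLp_val_apply (u : W12 Ω) (i : Fin 3) :
    MemLp (fun x => u.val x i) 2 (volume.restrict (Ω : Set E3)) := by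
  refine u.memLp_val.mono ?_ (ae_of_all _ fun x => ?_)
  · exact (by fun_prop : Continuous fun y : E3 => y i).comp_aestronglyMeasurable u.memLp_val.1
  · simpa using abs_apply_le_norm (u.val x) i

/-- A component of `u` multiplied by a cutoff function. -/
noncomputable def W12.cut (u : W12 Ω) (ζ : E3 → ℝ) (i : Fin 3) (x : E3) : ℝ := ζ x * u.val x i

/-- The weak derivative of `u.cut ζ i` in the direction `z`. -/
noncomputable def W12.cutDeriv (u : W12 Ω) (ζ : E3 → ℝ) (i : Fin 3) (z x : E3) : ℝ :=
  ∑ j, z j * (ζ x * u.grad x i j + fderiv ℝ ζ x (e j) * u.val x i)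

theorem exists_nnreal_bound {F : Type*} [NormedAddCommGroup F] {f : E3 → F} (hf : Continuous f)
    (hc : HasCompactSupport f) : ∃ b : NNReal, ∀ x, ‖f x‖ ≤ b := by
  obtain ⟨C, hC⟩ := hf.bounded_above_of_compact_support hc
  exact ⟨C.toNNReal, fun x => (hC x).trans (Real.le_coe_toNNReal C)⟩

theorem eq_zero_of_notMem_of_tsupport {ζ : E3 → ℝ} (hζΩ : tsupport ζ ⊆ Ω) {x : E3}
    (hx : x ∉ (Ω : Set E3)) : ζ x = 0 :=
  image_eq_zero_of_notMem_tsupport fun h => hx (hζΩ h)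

theorem fderiv_eq_zero_of_notMem_of_tsupport {ζ : E3 → ℝ} (hζΩ : tsupport ζ ⊆ Ω) {x : E3}
    (hx : x ∉ (Ω : Set E3)) : fderiv ℝ ζ x = 0 := by
  have : x ∉ tsupport (fderiv ℝ ζ) := fun h => hx (hζΩ (tsupport_fderiv_subset ℝ h))
  exact image_eq_zero_of_notMem_tsupport this

/-- Norm bounds for `u.cut ζ i` and its weak derivatives. -/
theorem W12.exists_cut_bound {ζ : E3 → ℝ} (hζ : ContDiff ℝ (⊤ : ℕ∞) ζ) (hζc : HasCompactSupport ζ)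
    (hζΩ : tsupport ζ ⊆ Ω) :
    ∃ b : NNReal, ∀ (u : W12 Ω) (i : Fin 3), MemLp (u.cut ζ i) 2 ∧
      eLpNorm (u.cut ζ i) 2 ≤ b * eLpNorm (fun x => u.val x i) 2 (volume.restrict (Ω : Set E3)) ∧
      ∀ z, MemLp (u.cutDeriv ζ i z) 2 ∧ eLpNorm (u.cutDeriv ζ i z) 2 ≤
        ‖z‖ₑ * (b * ∑ j, (eLpNorm (fun x => u.grad x i j) 2 (volume.restrict (Ω : Set E3)) +
          eLpNorm (fun x => u.val x i) 2 (volume.restrict (Ω : Set E3)))) := by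
  obtain ⟨b₁, hb₁⟩ := exists_nnreal_bound hζ.continuous hζc
  have hdc : Continuous (fderiv ℝ ζ) := hζ.continuous_fderiv (by simp)
  obtain ⟨b₂, hb₂⟩ := exists_nnreal_bound hdc (hζc.fderiv ℝ)
  have hΩm : MeasurableSet (Ω : Set E3) := Ω.isOpen.measurableSet
  set b := max b₁ b₂ with hb
  have hζb : ∀ x, ‖ζ x‖ ≤ b := fun x => (hb₁ x).trans (by exact_mod_cast le_max_left _ _)
  have hdb : ∀ j x, ‖fderiv ℝ ζ x (e j)‖ ≤ b := fun j x => by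
    refine ((fderiv ℝ ζ x).le_opNorm (e j)).trans ?_
    rw [norm_e, mul_one]
    exact (hb₂ x).trans (by exact_mod_cast le_max_right _ _)
  refine ⟨b, fun u i => ?_⟩
  have hv := memLp_mul_of_bound_support hΩm hζ.continuous.aestronglyMeasurable hζb
    (fun x hx => eq_zero_of_notMem_of_tsupport hζΩ hx) (u.memLp_val_apply i)
  have hg := fun j => memLp_mul_of_bound_support hΩm hζ.continuous.aestronglyMeasurable hζb
    (fun x hx => eq_zero_of_notMem_of_tsupport hζΩ hx) (u.memLp_grad i j)
  have hd := fun j => memLp_mul_of_bound_support (ζ := fun x => fderiv ℝ ζ x (e j)) hΩm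
    (by fun_prop : Continuous fun x => fderiv ℝ ζ x (e j)).aestronglyMeasurable (hdb j)
    (fun x hx => by simp [fderiv_eq_zero_of_notMem_of_tsupport hζΩ hx]) (u.memLp_val_apply i)
  refine ⟨hv.1, hv.2, fun z => ?_⟩
  have hj : ∀ j, MemLp (fun x => z j * (ζ x * u.grad x i j + fderiv ℝ ζ x (e j) * u.val x i)) 2 :=
    fun j => ((hg j).1.add (hd j).1).const_mul _
  have heq : u.cutDeriv ζ i z = ∑ j, fun x =>
      z j * (ζ x * u.grad x i j + fderiv ℝ ζ x (e j) * u.val x i) := by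
    ext x
    simp [W12.cutDeriv]
  rw [heq]
  refine ⟨memLp_finsetSum' _ fun j _ => hj j, ?_⟩
  refine (eLpNorm_sum_le (fun j _ => (hj j).1) (by norm_num)).trans ?_
  rw [Finset.mul_sum, Finset.mul_sum]
  refine Finset.sum_le_sum fun j _ => ?_
  have hsm : (fun x => z j * (ζ x * u.grad x i j + fderiv ℝ ζ x (e j) * u.val x i))
      = z j • ((fun x => ζ x * u.grad x i j) + fun x => fderiv ℝ ζ x (e j) * u.val x i) := by
    ext x
    simp
  rw [hsm, eLpNorm_const_smul]
  refine mul_le_mul' ?_ ?_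
  · rw [← ofReal_norm, ← ofReal_norm]
    exact ENNReal.ofReal_le_ofReal (abs_apply_le_norm z j)
  · refine (eLpNorm_add_le (hg j).1.1 (hd j).1.1 (by norm_num)).trans ?_
    rw [mul_add]
    exact add_le_add (hg j).2 (hd j).2

/-- `u.cutDeriv ζ i z` is the weak derivative of `u.cut ζ i` in the direction `z`. -/
theorem W12.integral_cut_mul_fderiv {ζ : E3 → ℝ} (hζ : ContDiff ℝ (⊤ : ℕ∞) ζ)
    (hζc : HasCompactSupport ζ) (hζΩ : tsupport ζ ⊆ Ω) (u : W12 Ω) (i : Fin 3) (z : E3)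
    (φ : E3 → ℝ) (hφ : ContDiff ℝ (⊤ : ℕ∞) φ) (hφc : HasCompactSupport φ) :
    ∫ x, u.cut ζ i x * fderiv ℝ φ x z = - ∫ x, u.cutDeriv ζ i z x * φ x := by
  have hΩm : MeasurableSet (Ω : Set E3) := Ω.isOpen.measurableSet
  have hφd : Continuous (fderiv ℝ φ) := hφ.continuous_fderiv (by simp)
  have hζd : Continuous (fderiv ℝ ζ) := hζ.continuous_fderiv (by simp)
  have hrestr : ∀ f : E3 → ℝ, (∀ x ∉ (Ω : Set E3), f x = 0) →
      ∫ x, f x = ∫ x in (Ω : Set E3), f x := fun f hf =>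
    (setIntegral_eq_integral_of_forall_compl_eq_zero hf).symm
  have h2 : ∀ {f : E3 → ℝ}, Continuous f → HasCompactSupport f →
      MemLp f 2 (volume.restrict (Ω : Set E3)) := fun hf hc =>
    (hf.memLp_of_hasCompactSupport hc).restrict _
  rw [hrestr _ (fun x hx => by simp [W12.cut, eq_zero_of_notMem_of_tsupport hζΩ hx]),
    hrestr _ (fun x hx => by simp [W12.cutDeriv, eq_zero_of_notMem_of_tsupport hζΩ hx,
      fderiv_eq_zero_of_notMem_of_tsupport hζΩ hx])]
  have hval := u.memLp_val_apply i
  have hcd : ∀ j, HasCompactSupport fun x => fderiv ℝ φ x (e j) := fun j =>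
    (hφc.fderiv ℝ).comp_left (g := fun L : E3 →L[ℝ] ℝ => L (e j)) (by simp)
  have i1 : ∀ j, Integrable (fun x => u.val x i * (ζ x * fderiv ℝ φ x (e j)))
      (volume.restrict (Ω : Set E3)) := fun j =>
    hval.integrable_fun_mul (h2 (by fun_prop) ((hcd j).mul_left))
  have i2 : ∀ j, Integrable (fun x => u.val x i * (fderiv ℝ ζ x (e j) * φ x))
      (volume.restrict (Ω : Set E3)) := fun j =>
    hval.integrable_fun_mul (h2 (by fun_prop) hφc.mul_left)
  have i3 : ∀ j, Integrable (fun x => u.grad x i j * (ζ x * φ x))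
      (volume.restrict (Ω : Set E3)) := fun j =>
    (u.memLp_grad i j).integrable_fun_mul (h2 (by fun_prop) hφc.mul_left)
  have key : ∀ j, ∫ x in (Ω : Set E3), u.val x i * (ζ x * fderiv ℝ φ x (e j))
      = - ∫ x in (Ω : Set E3),
        (ζ x * u.grad x i j + fderiv ℝ ζ x (e j) * u.val x i) * φ x := by
    intro j
    -- φ need not be supported in Ω, but ζφ is; the Leibniz rule then produces the extra term with
    -- the derivative of ζ.
    let ψ : 𝓓(Ω, ℝ) := ⟨fun x => ζ x * φ x, hζ.mul hφ, hζc.mul_right,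
      (tsupport_mul_subset_left).trans hζΩ⟩
    have h := u.weak_grad ψ i j
    have hψ : ∀ x, fderiv ℝ ψ x (e j) = ζ x * fderiv ℝ φ x (e j) + fderiv ℝ ζ x (e j) * φ x := by
      intro x
      have := fderiv_fun_mul (hζ.differentiable (by simp) x) (hφ.differentiable (by simp) x)
      change fderiv ℝ (fun x => ζ x * φ x) x (e j) = _
      rw [this]
      simp [mul_comm]
    simp only [hψ, mul_add] at h
    rw [integral_add (i1 j) (i2 j)] at h
    have e1 : ∫ x in (Ω : Set E3), (ζ x * u.grad x i j + fderiv ℝ ζ x (e j) * u.val x i) * φ x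
        = (∫ x in (Ω : Set E3), u.grad x i j * (ζ x * φ x))
          + ∫ x in (Ω : Set E3), u.val x i * (fderiv ℝ ζ x (e j) * φ x) := by
      rw [← integral_add (i3 j) (i2 j)]
      congr 1
      ext x
      ring
    have e2 : ∫ x in (Ω : Set E3), u.grad x i j * ψ x
        = ∫ x in (Ω : Set E3), u.grad x i j * (ζ x * φ x) := rfl
    rw [e1]
    rw [e2] at h
    linarith
  have i4 : ∀ j, Integrable
      (fun x => (ζ x * u.grad x i j + fderiv ℝ ζ x (e j) * u.val x i) * φ x)
      (volume.restrict (Ω : Set E3)) := fun j => by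
    refine ((i3 j).add (i2 j)).congr (ae_of_all _ fun x => ?_)
    simp only [Pi.add_apply]
    ring
  have l1 : ∀ x, u.cut ζ i x * fderiv ℝ φ x z
      = ∑ j, z j * (u.val x i * (ζ x * fderiv ℝ φ x (e j))) := by
    intro x
    rw [clm_apply_eq_sum, W12.cut, Finset.mul_sum]
    refine Finset.sum_congr rfl fun j _ => ?_
    simp only [smul_eq_mul]
    ring
  have l2 : ∀ x, u.cutDeriv ζ i z x * φ x
      = ∑ j, z j * ((ζ x * u.grad x i j + fderiv ℝ ζ x (e j) * u.val x i) * φ x) := by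
    intro x
    rw [W12.cutDeriv, Finset.sum_mul]
    exact Finset.sum_congr rfl fun j _ => by ring
  simp only [l1, l2]
  rw [integral_finsetSum _ fun j _ => (i1 j).const_mul _,
    integral_finsetSum _ fun j _ => (i4 j).const_mul _, ← Finset.sum_neg_distrib]
  refine Finset.sum_congr rfl fun j _ => ?_
  rw [integral_const_mul, integral_const_mul, key j]
  ring

/-- Local compactness: bounded weakly convergent sequences in `W^{1,2}` converge in `L¹` after
multiplication by a cutoff function. -/
theorem tendsto_eLpNorm_cut_sub {u : ℕ → W12 Ω} {u₀ : W12 Ω} {i : Fin 3}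
    (hw : WeakConv Ω 2 (fun n x => (u n).val x i) (fun x => u₀.val x i))
    {A : ℝ≥0∞} (hA : A ≠ ⊤)
    (hval : ∀ n, eLpNorm (fun x => (u n).val x i) 2 (volume.restrict (Ω : Set E3)) ≤ A)
    (hgrad : ∀ n j, eLpNorm (fun x => (u n).grad x i j) 2 (volume.restrict (Ω : Set E3)) ≤ A)
    (hΩ : volume (Ω : Set E3) ≠ ⊤)
    {ζ : E3 → ℝ} (hζ : ContDiff ℝ (⊤ : ℕ∞) ζ) (hζc : HasCompactSupport ζ)
    (hζΩ : tsupport ζ ⊆ Ω) :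
    Tendsto (fun n => eLpNorm (fun x => (u n).cut ζ i x - u₀.cut ζ i x) 1
      (volume.restrict (Ω : Set E3))) atTop (𝓝 0) := by
  obtain ⟨b, hb⟩ := W12.exists_cut_bound hζ hζc hζΩ
  -- translation bounds for one map
  have htr : ∀ (v : W12 Ω) (D : ℝ≥0∞),
      eLpNorm (fun x => v.val x i) 2 (volume.restrict (Ω : Set E3)) ≤ D →
      (∀ j, eLpNorm (fun x => v.grad x i j) 2 (volume.restrict (Ω : Set E3)) ≤ D) →
      ∀ h, eLpNorm (fun x => v.cut ζ i x - v.cut ζ i (x - h)) 2 volume ≤ ‖h‖ₑ * (18 * (b * D)) := by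
    intro v D h1 h2 h
    obtain ⟨hv, -, hv'⟩ := hb v i
    have hwd := v.integral_cut_mul_fderiv hζ hζc hζΩ i h
    have h3 := eLpNorm_sub_translate_le (w := v.cut ζ i) (d := v.cutDeriv ζ i h) (h := h)
      hv (hv' h).1 hwd
    refine h3.trans ?_
    -- 18 = 3 · 3 · 2: the translation estimate, the three partial derivatives, and the two terms of
    -- the Leibniz rule.
    calc 3 * eLpNorm (v.cutDeriv ζ i h) 2 volume
        ≤ 3 * (‖h‖ₑ * (b * ∑ j : Fin 3, (D + D))) := by
          refine mul_le_mul' le_rfl ((hv' h).2.trans ?_)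
          gcongr with j
          exact h2 j
      _ = ‖h‖ₑ * (18 * (b * D)) := by
          simp only [Finset.sum_const, Finset.card_univ, Fintype.card_fin, nsmul_eq_mul]
          push_cast
          ring
  set D₀ : ℝ≥0∞ := eLpNorm (fun x => u₀.val x i) 2 (volume.restrict (Ω : Set E3)) +
    ∑ j, eLpNorm (fun x => u₀.grad x i j) 2 (volume.restrict (Ω : Set E3)) with hD₀
  have hD₀t : D₀ ≠ ⊤ := by
    refine ENNReal.add_ne_top.2 ⟨(u₀.memLp_val_apply i).2.ne, ?_⟩
    exact ENNReal.sum_ne_top.2 fun j _ => (u₀.memLp_grad i j).2.ne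
  have hd : ∀ n, MemLp (fun x => (u n).cut ζ i x - u₀.cut ζ i x) 2 := fun n =>
    (hb (u n) i).1.sub (hb u₀ i).1
  -- A single constant must bound both norms and translation quotients of the difference; the
  -- wasteful 18 serves for the norms as well.
  refine tendsto_eLpNorm_one_of_weak_of_translate (A := 18 * (b * A) + 18 * (b * D₀)) hd ?_ ?_ ?_
    ?_ hΩ
  · finiteness
  · intro n
    refine (eLpNorm_sub_le (hb (u n) i).1.1 (hb u₀ i).1.1 (by norm_num)).trans ?_
    have h18 : (1 : ℝ≥0∞) ≤ 18 := by norm_num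
    refine add_le_add ?_ ?_
    · refine (hb (u n) i).2.1.trans (le_trans ?_ (mul_le_mul' h18 le_rfl))
      rw [one_mul]
      exact mul_le_mul' le_rfl (hval n)
    · refine (hb u₀ i).2.1.trans (le_trans ?_ (mul_le_mul' h18 le_rfl))
      rw [one_mul]
      exact mul_le_mul' le_rfl le_self_add
  · intro n h
    have e : (fun x => ((u n).cut ζ i x - u₀.cut ζ i x) -
          ((u n).cut ζ i (x - h) - u₀.cut ζ i (x - h)))
        = (fun x => (u n).cut ζ i x - (u n).cut ζ i (x - h)) -
          fun x => u₀.cut ζ i x - u₀.cut ζ i (x - h) := by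
      ext x
      simp only [Pi.sub_apply]
      ring
    rw [e]
    refine (eLpNorm_sub_le ((hb (u n) i).1.sub ((hb (u n) i).1.comp_sub_right h)).1
      ((hb u₀ i).1.sub ((hb u₀ i).1.comp_sub_right h)).1 (by norm_num)).trans ?_
    rw [mul_add]
    refine add_le_add (htr (u n) A (hval n) (hgrad n) h) (htr u₀ D₀ le_self_add (fun j => ?_) h)
    refine le_trans ?_ le_add_self
    exact Finset.single_le_sum (f := fun j => eLpNorm (fun x => u₀.grad x i j) 2
      (volume.restrict (Ω : Set E3))) (fun _ _ => zero_le) (Finset.mem_univ j)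
  · intro ψ hψ
    obtain ⟨b', hb'⟩ := exists_nnreal_bound hζ.continuous hζc
    have hζψ : MemLp (fun x => ζ x * ψ x) 2 (volume.restrict (Ω : Set E3)) :=
      (memLp_mul_of_bound_support (S := Set.univ) MeasurableSet.univ
        hζ.continuous.aestronglyMeasurable hb' (by simp)
        (by rwa [Measure.restrict_univ])).1.restrict _
    have h1 := (hw _ hζψ).sub_const (∫ x in (Ω : Set E3), u₀.val x i * (ζ x * ψ x))
    rw [sub_self] at h1
    refine h1.congr fun n => ?_
    rw [← integral_sub (((u n).memLp_val_apply i).integrable_fun_mul hζψ)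
      ((u₀.memLp_val_apply i).integrable_fun_mul hζψ),
      ← setIntegral_eq_integral_of_forall_compl_eq_zero (s := (Ω : Set E3)) (μ := volume)
        (f := fun x => ((u n).cut ζ i x - u₀.cut ζ i x) * ψ x)
        (fun x hx => by simp [W12.cut, eq_zero_of_notMem_of_tsupport hζΩ hx])]
    congr 1
    ext x
    simp only [W12.cut]
    ring

/-- Compactness: bounded weakly convergent sequences in `W^{1,2}` converge in `L¹`. -/
theorem tendsto_eLpNorm_one_sub {u : ℕ → W12 Ω} {u₀ : W12 Ω} {i : Fin 3}
    (hw : WeakConv Ω 2 (fun n x => (u n).val x i) (fun x => u₀.val x i))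
    {M : ℝ} (hM : ∀ n, ∀ᵐ x ∂(volume.restrict (Ω : Set E3)), |(u n).val x i| ≤ M)
    {A : ℝ≥0∞} (hA : A ≠ ⊤)
    (hgrad : ∀ n j, eLpNorm (fun x => (u n).grad x i j) 2 (volume.restrict (Ω : Set E3)) ≤ A)
    (hΩ : volume (Ω : Set E3) ≠ ⊤) :
    Tendsto (fun n => eLpNorm (fun x => (u n).val x i - u₀.val x i) 1
      (volume.restrict (Ω : Set E3))) atTop (𝓝 0) := by
  set μ := volume.restrict (Ω : Set E3) with hμ
  have : IsFiniteMeasure μ := ⟨by simpa [hμ] using hΩ.lt_top⟩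
  have hΩm : MeasurableSet (Ω : Set E3) := Ω.isOpen.measurableSet
  set A' : ℝ≥0∞ := A + μ Set.univ ^ (2 : ℝ≥0∞).toReal⁻¹ * ENNReal.ofReal M with hA'
  have hA't : A' ≠ ⊤ := by
    refine ENNReal.add_ne_top.2 ⟨hA, ENNReal.mul_ne_top ?_ ENNReal.ofReal_ne_top⟩
    exact ENNReal.rpow_ne_top_of_nonneg (by norm_num) (measure_ne_top _ _)
  have hval : ∀ n, eLpNorm (fun x => (u n).val x i) 2 μ ≤ A' := fun n =>
    (eLpNorm_le_of_ae_bound (hM n)).trans le_add_self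
  have h1 : MemLp (fun x => u₀.val x i) 1 μ := (u₀.memLp_val_apply i).mono_exponent (by norm_num)
  rw [ENNReal.tendsto_nhds_zero]
  intro ε hε
  -- a compact set carrying most of the mass
  set f : E3 → ℝ≥0∞ := fun x => ENNReal.ofReal M + ‖u₀.val x i‖ₑ with hf
  have hfm : AEMeasurable f μ := h1.1.enorm.const_add _
  have hfin : ∫⁻ x, f x ∂μ ≠ ⊤ := by
    simp only [hf]
    rw [lintegral_add_left measurable_const, lintegral_const]
    refine ENNReal.add_ne_top.2 ⟨ENNReal.mul_ne_top ENNReal.ofReal_ne_top (measure_ne_top _ _), ?_⟩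
    rw [← eLpNorm_one_eq_lintegral_enorm]
    exact h1.2.ne
  have : IsFiniteMeasure (μ.withDensity f) := isFiniteMeasure_withDensity hfin
  -- The density f dominates |u_n − u₀| for every n at once, thanks to the bound M, so the same K
  -- controls the boundary layer uniformly in n.
  obtain ⟨K, hKΩ, hK, hKε⟩ := hΩm.exists_isCompact_sdiff_lt (μ := μ.withDensity f)
    (measure_ne_top _ _) (ENNReal.half_pos hε.ne').ne'
  obtain ⟨ζ, hζ, hζc, hζΩ, hζ1, hζ01⟩ := exists_smooth_cutoff hK Ω.isOpen hKΩ
  have hcut := tendsto_eLpNorm_cut_sub hw hA't hval (fun n j => (hgrad n j).trans le_self_add)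
    hΩ hζ hζc hζΩ
  filter_upwards [(ENNReal.tendsto_nhds_zero.1 hcut) (ε / 2) (ENNReal.half_pos hε.ne')] with n hn
  have hvm := ((u n).memLp_val_apply i).1
  have hrest : eLpNorm (fun x => (1 - ζ x) * ((u n).val x i - u₀.val x i)) 1 μ ≤ ε / 2 := by
    rw [eLpNorm_one_eq_lintegral_enorm]
    have hmeas : MeasurableSet ((Ω : Set E3) \ K) := hΩm.diff hK.measurableSet
    rw [withDensity_apply _ hmeas, ← lintegral_indicator hmeas] at hKε
    refine le_trans (lintegral_mono_ae ?_) hKε.le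
    filter_upwards [hM n, ae_restrict_mem hΩm] with x hx hxΩ
    by_cases hxK : x ∈ K
    · simp [hζ1 x hxK]
    · rw [Set.indicator_of_mem (Set.mem_sdiff_of_mem hxΩ hxK), enorm_mul]
      have hz := hζ01 x
      have e1 : ‖1 - ζ x‖ₑ ≤ 1 := by
        rw [← ofReal_norm, Real.norm_eq_abs, abs_of_nonneg (by linarith [hz.2])]
        exact ENNReal.ofReal_le_one.2 (by linarith [hz.1])
      have e2 : ‖(u n).val x i - u₀.val x i‖ₑ ≤ f x := by
        refine enorm_sub_le.trans (add_le_add ?_ le_rfl)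
        rw [← ofReal_norm]
        exact ENNReal.ofReal_le_ofReal hx
      calc _ ≤ 1 * f x := mul_le_mul' e1 e2
        _ = f x := one_mul _
  have e : (fun x => (u n).val x i - u₀.val x i)
      = (fun x => (u n).cut ζ i x - u₀.cut ζ i x) +
        fun x => (1 - ζ x) * ((u n).val x i - u₀.val x i) := by
    ext x
    simp only [W12.cut, Pi.add_apply]
    ring
  rw [e]
  have hζm : AEStronglyMeasurable ζ μ := hζ.continuous.aestronglyMeasurable
  refine (eLpNorm_add_le ((hζm.mul hvm).sub (hζm.mul h1.1))
    ((aestronglyMeasurable_const.sub hζm).mul (hvm.sub h1.1)) le_rfl).trans ?_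
  calc _ ≤ ε / 2 + ε / 2 := add_le_add hn hrest
    _ = ε := ENNReal.add_halves ε

/-- If all components converge in some `L^p`, a subsequence converges almost everywhere. -/
theorem exists_subseq_tendsto_ae_of_components {α : Type*} [MeasurableSpace α] {μ : Measure α}
    {p : ℝ≥0∞} (hp : 1 ≤ p) {v : ℕ → α → E3} {v₀ : α → E3}
    (hv : ∀ n i, AEStronglyMeasurable (fun x => v n x i - v₀ x i) μ)
    (h : ∀ i, Tendsto (fun n => eLpNorm (fun x => v n x i - v₀ x i) p μ) atTop (𝓝 0)) :
    ∃ φ : ℕ → ℕ, StrictMono φ ∧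
      ∀ᵐ x ∂μ, Tendsto (fun n => v (φ n) x) atTop (𝓝 (v₀ x)) := by
  have hp0 : p ≠ 0 := (lt_of_lt_of_le zero_lt_one hp).ne'
  -- The components are summed into one scalar sequence, so that a single extraction serves all of
  -- them.
  have hsum : Tendsto (fun n => eLpNorm ((∑ i, fun x => ‖v n x i - v₀ x i‖) - 0) p μ)
      atTop (𝓝 0) := by
    have h0 : Tendsto (fun n => ∑ i, eLpNorm (fun x => v n x i - v₀ x i) p μ) atTop (𝓝 0) := by
      simpa using tendsto_finsetSum Finset.univ fun i _ => h i
    refine tendsto_of_tendsto_of_tendsto_of_le_of_le tendsto_const_nhds h0 (fun _ => zero_le)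
      fun n => ?_
    simp only [sub_zero]
    refine (eLpNorm_sum_le (fun i _ => (hv n i).norm) hp).trans ?_
    exact Finset.sum_le_sum fun i _ => (eLpNorm_norm _).le
  obtain ⟨φ, hφ, hae⟩ := (tendstoInMeasure_of_tendsto_eLpNorm hp0
    (fun n => Finset.aestronglyMeasurable_sum _ fun i _ => (hv n i).norm)
    aestronglyMeasurable_zero hsum).exists_seq_tendsto_ae
  refine ⟨φ, hφ, ?_⟩
  filter_upwards [hae] with x hx
  have hi : ∀ i, Tendsto (fun n => v (φ n) x i) atTop (𝓝 (v₀ x i)) := by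
    intro i
    rw [tendsto_iff_norm_sub_tendsto_zero]
    refine tendsto_of_tendsto_of_tendsto_of_le_of_le tendsto_const_nhds hx
      (fun _ => norm_nonneg _) fun n => ?_
    rw [Finset.sum_apply]
    exact Finset.single_le_sum (f := fun i => ‖v (φ n) x i - v₀ x i‖) (fun _ _ => norm_nonneg _)
      (Finset.mem_univ i)
  have h2 := ((PiLp.continuous_toLp 2 (fun _ : Fin 3 => ℝ)).tendsto _).comp (tendsto_pi_nhds.2 hi)
  exact h2

/-! ### Smooth test fields concentrated near a measurable graph. -/

/-- The mollification along the graph of `w`, with kernel `k` and weight `η`. -/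
noncomputable def graphMollify (η : E3 → ℝ) (w : E3 → E3) (k : E3 × E3 → E3) (p : E3 × E3) : E3 :=
  ∫ a, η a • k (p - (a, w a))

theorem exists_bound_of_hasCompactSupport {V F : Type*} [NormedAddCommGroup V]
    [NormedAddCommGroup F] {f : V → F} (hf : Continuous f) (hc : HasCompactSupport f) :
    ∃ C : ℝ, 0 ≤ C ∧ ∀ x, ‖f x‖ ≤ C := by
  obtain ⟨C, hC⟩ := hf.bounded_above_of_compact_support hc
  exact ⟨C, (norm_nonneg _).trans (hC 0), hC⟩

section Graph

variable {η : E3 → ℝ} {w : E3 → E3} {k : E3 × E3 → E3}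

/-- The field is k convolved with a finite signed measure, the push-forward of η dx to the graph.
All the smoothness comes from k, so w only has to be measurable. -/
theorem contDiff_graphMollify (hη : Continuous η) (hηc : HasCompactSupport η) (hw : Measurable w)
    (hk : ContDiff ℝ (⊤ : ℕ∞) k) (hkc : HasCompactSupport k) :
    ContDiff ℝ (⊤ : ℕ∞) (graphMollify η w k) := by
  have hΨ : Measurable fun a : E3 => (a, w a) := measurable_id.prodMk hw
  have hint : Integrable η := hη.integrable_of_hasCompactSupport hηc
  have hloc : LocallyIntegrable (fun p : E3 × E3 => η p.1)
      (Measure.map (fun a : E3 => (a, w a)) volume) := by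
    refine Integrable.locallyIntegrable ?_
    rw [integrable_map_measure (by fun_prop) hΨ.aemeasurable]
    exact hint
  have h := hkc.contDiff_convolution_right (n := ⊤) (ContinuousLinearMap.lsmul ℝ ℝ) hloc hk
  convert h using 1
  ext1 p
  rw [convolution_def, integral_map hΨ.aemeasurable]
  · simp [graphMollify]
  · have h1 : Continuous fun t : E3 × E3 => (ContinuousLinearMap.lsmul ℝ ℝ (E := E3)) (η t.1)
        (k (p - t)) := by
      simp only [ContinuousLinearMap.lsmul_apply]
      exact (hη.comp continuous_fst).smul (hk.continuous.comp (continuous_const.sub continuous_id))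
    exact h1.aestronglyMeasurable

theorem hasFDerivAt_graphMollify (hη : Continuous η) (hηc : HasCompactSupport η)
    (hw : Measurable w) (hk : ContDiff ℝ (⊤ : ℕ∞) k) (hkc : HasCompactSupport k) (p : E3 × E3) :
    HasFDerivAt (graphMollify η w k) (∫ a, η a • fderiv ℝ k (p - (a, w a))) p := by
  have hint : Integrable η := hη.integrable_of_hasCompactSupport hηc
  have hdc : Continuous (fderiv ℝ k) := hk.continuous_fderiv (by simp)
  obtain ⟨C, hC0, hC⟩ := exists_bound_of_hasCompactSupport hdc (hkc.fderiv ℝ)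
  obtain ⟨C', hC0', hC'⟩ := exists_bound_of_hasCompactSupport hk.continuous hkc
  have hm : ∀ q : E3 × E3, Measurable fun a : E3 => q - (a, w a) := fun q =>
    measurable_const.sub (measurable_id.prodMk hw)
  refine hasFDerivAt_integral_of_dominated_of_fderiv_le (bound := fun a => |η a| * C)
    (F' := fun q a => η a • fderiv ℝ k (q - (a, w a))) univ_mem
    (Eventually.of_forall fun q => ?_) ?_ ?_ ?_ (hint.abs.mul_const C) ?_
  · exact hη.aestronglyMeasurable.smul
      (hk.continuous.comp_aestronglyMeasurable (hm q).aestronglyMeasurable)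
  · refine Integrable.mono' (hint.abs.mul_const C') (hη.aestronglyMeasurable.smul
      (hk.continuous.comp_aestronglyMeasurable (hm p).aestronglyMeasurable))
      (ae_of_all _ fun a => ?_)
    rw [norm_smul]
    exact mul_le_mul_of_nonneg_left (hC' _) (abs_nonneg _)
  · exact hη.aestronglyMeasurable.smul
      (hdc.comp_aestronglyMeasurable (hm p).aestronglyMeasurable)
  · refine ae_of_all _ fun a q _ => ?_
    rw [norm_smul]
    exact mul_le_mul_of_nonneg_left (hC _) (abs_nonneg _)
  · refine ae_of_all _ fun a q _ => ?_
    have h1 : HasFDerivAt k (fderiv ℝ k (q - (a, w a))) (q - (a, w a)) :=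
      (hk.differentiable (by simp) _).hasFDerivAt
    have h2 := h1.comp q ((hasFDerivAt_id q).sub_const (a, w a))
    exact h2.const_smul (η a)

/-- A nonzero integrand needs p within δ of a graph point over the support of η. This is what places
the field in the test space on Ω × ℝ³ for small δ. -/
theorem graphMollify_eq_zero_of_notMem {p : E3 × E3} {δ B : ℝ} (hwB : ∀ a, ‖w a‖ ≤ B)
    (hkδ : ∀ q, k q ≠ 0 → ‖q‖ ≤ δ)
    (hp : p ∉ Metric.cthickening δ (tsupport η) ×ˢ Metric.closedBall (0 : E3) (B + δ)) :
    graphMollify η w k p = 0 := by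
  rw [graphMollify]
  refine integral_eq_zero_of_ae (ae_of_all _ fun a => ?_)
  by_contra h
  have h1 : η a ≠ 0 := fun h0 => h (by simp [h0])
  have h2 : k (p - (a, w a)) ≠ 0 := fun h0 => h (by simp [h0])
  have h3 := hkδ _ h2
  rw [Prod.norm_def, max_le_iff] at h3
  refine hp ⟨?_, ?_⟩
  · refine Metric.mem_cthickening_of_dist_le p.1 a δ _ (subset_tsupport _ h1) ?_
    rw [dist_eq_norm]
    exact h3.1
  · rw [mem_closedBall_zero_iff]
    have h4 : p.2 = w a + (p.2 - w a) := by abel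
    rw [h4]
    refine (norm_add_le _ _).trans (add_le_add (hwB a) ?_)
    exact h3.2

end Graph

/-- The rescaled kernel. -/
noncomputable def scaleKernel (r : ℝ) (k : E3 × E3 → E3) (p : E3 × E3) : E3 :=
  (r⁻¹ * r⁻¹) • k (r⁻¹ • p)

section Scale

variable {r : ℝ} {k : E3 × E3 → E3}

theorem contDiff_scaleKernel (hk : ContDiff ℝ (⊤ : ℕ∞) k) :
    ContDiff ℝ (⊤ : ℕ∞) (scaleKernel r k) :=
  (hk.comp (contDiff_id.const_smul r⁻¹)).const_smul (r⁻¹ * r⁻¹)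

theorem hasCompactSupport_scaleKernel (hr : 0 < r) (hkc : HasCompactSupport k) :
    HasCompactSupport (scaleKernel r k) := by
  have h : HasCompactSupport fun p : E3 × E3 => k (r⁻¹ • p) :=
    hkc.comp_homeomorph (Homeomorph.smulOfNeZero r⁻¹ (inv_ne_zero hr.ne'))
  exact h.smul_left (f := fun _ => r⁻¹ * r⁻¹)

theorem fderiv_scaleKernel (hk : ContDiff ℝ (⊤ : ℕ∞) k) (p : E3 × E3) :
    fderiv ℝ (scaleKernel r k) p = (r⁻¹ * r⁻¹ * r⁻¹) • fderiv ℝ k (r⁻¹ • p) := by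
  have h1 : HasFDerivAt k (fderiv ℝ k (r⁻¹ • p)) (r⁻¹ • p) :=
    (hk.differentiable (by simp) _).hasFDerivAt
  have h2 := (h1.comp p ((hasFDerivAt_id p).const_smul r⁻¹)).const_smul (r⁻¹ * r⁻¹)
  have h3 : HasFDerivAt (scaleKernel r k) _ p := h2
  rw [h3.fderiv]
  refine ContinuousLinearMap.ext fun v => ?_
  simp [smul_smul]

theorem integral_eq_smul_integral_comp_sub_smul {F : Type*} [NormedAddCommGroup F]
    [NormedSpace ℝ F] (hr : 0 < r) (x : E3) (G : E3 → F) :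
    ∫ a, G a = r ^ 3 • ∫ z, G (x - r • z) := by
  have h1 := Measure.integral_comp_smul (volume : Measure E3) (fun y => G (x - y)) r
  rw [h1, integral_sub_left_eq_self (fun y => G y) volume x, smul_smul]
  have : Module.finrank ℝ E3 = 3 := by simp
  rw [this, abs_of_pos (by positivity), mul_inv_cancel₀ (by positivity), one_smul]

/-- Substituting a = x − r z costs r³ against the prefactor r⁻²: one power of r remains, so the
field is small in the supremum norm. -/
theorem graphMollify_scaleKernel {η : E3 → ℝ} {w : E3 → E3} (hr : 0 < r) (x y : E3) :
    graphMollify η w (scaleKernel r k) (x, y)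
      = r • ∫ z, η (x - r • z) • k (z, r⁻¹ • (y - w (x - r • z))) := by
  rw [graphMollify, integral_eq_smul_integral_comp_sub_smul hr x]
  simp only [scaleKernel, Prod.mk_sub_mk, Prod.smul_mk, sub_sub_cancel, smul_smul,
    inv_mul_cancel₀ hr.ne', one_smul]
  have : ∀ z, (η (x - r • z) * (r⁻¹ * r⁻¹)) • k (z, r⁻¹ • (y - w (x - r • z)))
      = (r⁻¹ * r⁻¹) • (η (x - r • z) • k (z, r⁻¹ • (y - w (x - r • z)))) := fun z => by
    rw [smul_smul, mul_comm]
  simp only [this]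
  rw [integral_smul, smul_smul]
  congr 1
  field_simp

/-- Differentiation costs one more power of r⁻¹, which balances r³ exactly. On the graph, y = w x,
the second argument of k is a difference quotient of w. -/
theorem fderiv_graphMollify_scaleKernel {η : E3 → ℝ} {w : E3 → E3} (hη : Continuous η)
    (hηc : HasCompactSupport η) (hw : Measurable w) (hk : ContDiff ℝ (⊤ : ℕ∞) k)
    (hkc : HasCompactSupport k) (hr : 0 < r) (x y : E3) :
    fderiv ℝ (graphMollify η w (scaleKernel r k)) (x, y)
      = ∫ z, η (x - r • z) • fderiv ℝ k (z, r⁻¹ • (y - w (x - r • z))) := by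
  rw [(hasFDerivAt_graphMollify hη hηc hw (contDiff_scaleKernel hk)
    (hasCompactSupport_scaleKernel hr hkc) (x, y)).fderiv,
    integral_eq_smul_integral_comp_sub_smul hr x]
  simp only [fderiv_scaleKernel hk, Prod.mk_sub_mk, Prod.smul_mk, sub_sub_cancel, smul_smul,
    inv_mul_cancel₀ hr.ne', one_smul]
  have : ∀ z, (η (x - r • z) * (r⁻¹ * r⁻¹ * r⁻¹)) • fderiv ℝ k (z, r⁻¹ • (y - w (x - r • z)))
      = (r⁻¹ * r⁻¹ * r⁻¹) • (η (x - r • z) • fderiv ℝ k (z, r⁻¹ • (y - w (x - r • z)))) :=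
    fun z => by rw [smul_smul, mul_comm]
  simp only [this]
  rw [integral_smul, smul_smul]
  have h1 : r ^ 3 * (r⁻¹ * r⁻¹ * r⁻¹) = 1 := by field_simp
  rw [h1, one_smul]

/-- The rescaled graph mollification is of order `r`. -/
theorem exists_norm_graphMollify_scaleKernel_le {η : E3 → ℝ} {w : E3 → E3} (hη : Continuous η)
    (hηc : HasCompactSupport η) (hk : Continuous k) (hkc : HasCompactSupport k) :
    ∃ C : ℝ, 0 ≤ C ∧ ∀ r : ℝ, 0 < r → ∀ p,
      ‖graphMollify η w (scaleKernel r k) p‖ ≤ C * r := by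
  obtain ⟨A, hA0, hA⟩ := exists_bound_of_hasCompactSupport hη hηc
  obtain ⟨B, hB0, hB⟩ := exists_bound_of_hasCompactSupport hk hkc
  obtain ⟨R, hR⟩ := hkc.isCompact.isBounded.subset_closedBall 0
  set V : ℝ := volume.real (Metric.closedBall (0 : E3) R) with hV
  refine ⟨A * B * V, by positivity, fun r hr p => ?_⟩
  obtain ⟨x, y⟩ := p
  rw [graphMollify_scaleKernel hr, norm_smul, Real.norm_of_nonneg hr.le, mul_comm]
  refine mul_le_mul_of_nonneg_right ?_ hr.le
  have h1 : ∫ z, η (x - r • z) • k (z, r⁻¹ • (y - w (x - r • z)))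
      = ∫ z in Metric.closedBall (0 : E3) R,
        η (x - r • z) • k (z, r⁻¹ • (y - w (x - r • z))) := by
    refine (setIntegral_eq_integral_of_forall_compl_eq_zero fun z hz => ?_).symm
    have : k (z, r⁻¹ • (y - w (x - r • z))) = 0 := by
      refine image_eq_zero_of_notMem_tsupport fun h => hz ?_
      have := hR h
      rw [mem_closedBall_zero_iff] at this ⊢
      exact (norm_fst_le _).trans this
    rw [this, smul_zero]
  rw [h1]
  refine norm_setIntegral_le_of_norm_le_const measure_closedBall_lt_top fun z _ => ?_
  rw [norm_smul]
  exact mul_le_mul (hA _) (hB _) (norm_nonneg _) hA0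

end Scale

/-! ### The pairing and its value along linear graphs. -/

/-- The integrand of the surface energy, as a linear functional of the differential of the test
field. -/
noncomputable def pairing (c : Matrix (Fin 3) (Fin 3) ℝ) (t : ℝ) :
    ((E3 × E3) →L[ℝ] E3) →L[ℝ] ℝ :=
  (∑ i, ∑ j, c i j • ((EuclideanSpace.proj i : E3 →L[ℝ] ℝ).comp
    (ContinuousLinearMap.apply ℝ E3 ((e j, 0) : E3 × E3)))) +
  t • ∑ i, (EuclideanSpace.proj i : E3 →L[ℝ] ℝ).comp
    (ContinuousLinearMap.apply ℝ E3 ((0, e i) : E3 × E3))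

theorem pairing_apply (c : Matrix (Fin 3) (Fin 3) ℝ) (t : ℝ) (L : (E3 × E3) →L[ℝ] E3) :
    pairing c t L = (∑ i, ∑ j, c i j * (L (e j, 0)) i) + t * ∑ i, (L (0, e i)) i := by
  simp [pairing]

theorem abs_pairing_le (c : Matrix (Fin 3) (Fin 3) ℝ) (t : ℝ) (L : (E3 × E3) →L[ℝ] E3) :
    |pairing c t L| ≤ ((∑ i, ∑ j, |c i j|) + 3 * |t|) * ‖L‖ := by
  have h1 : ∀ i j, |(L (e j, 0)) i| ≤ ‖L‖ := fun i j => by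
    refine (abs_apply_le_norm _ i).trans ((L.le_opNorm _).trans ?_)
    simp [Prod.norm_def, norm_e]
  have h2 : ∀ i, |(L (0, e i)) i| ≤ ‖L‖ := fun i => by
    refine (abs_apply_le_norm _ i).trans ((L.le_opNorm _).trans ?_)
    simp [Prod.norm_def, norm_e]
  rw [pairing_apply, add_mul]
  refine (abs_add_le _ _).trans (add_le_add ?_ ?_)
  · rw [Finset.sum_mul]
    refine (Finset.abs_sum_le_sum_abs _ _).trans (Finset.sum_le_sum fun i _ => ?_)
    rw [Finset.sum_mul]
    refine (Finset.abs_sum_le_sum_abs _ _).trans (Finset.sum_le_sum fun j _ => ?_)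
    rw [abs_mul]
    exact mul_le_mul_of_nonneg_left (h1 i j) (abs_nonneg _)
  · rw [abs_mul, mul_comm 3, mul_assoc]
    refine mul_le_mul_of_nonneg_left ?_ (abs_nonneg _)
    refine (Finset.abs_sum_le_sum_abs _ _).trans ((Finset.sum_le_sum fun i _ => h2 i).trans ?_)
    simp

theorem aestronglyMeasurable_pairing {α : Type*} [MeasurableSpace α] {μ : Measure α}
    {c : α → Matrix (Fin 3) (Fin 3) ℝ} {t : α → ℝ} {L : α → (E3 × E3) →L[ℝ] E3}
    (hc : ∀ i j, AEStronglyMeasurable (fun x => c x i j) μ) (ht : AEStronglyMeasurable t μ)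
    (hL : AEStronglyMeasurable L μ) :
    AEStronglyMeasurable (fun x => pairing (c x) (t x) (L x)) μ := by
  have h1 : ∀ (v : E3 × E3) (i : Fin 3), AEStronglyMeasurable (fun x => (L x v) i) μ := fun v i =>
    (by fun_prop : Continuous fun T : (E3 × E3) →L[ℝ] E3 => (T v) i).comp_aestronglyMeasurable hL
  simp only [pairing_apply]
  refine AEStronglyMeasurable.add ?_ (ht.mul ?_)
  · exact Finset.aestronglyMeasurable_fun_sum _ fun i _ =>
      Finset.aestronglyMeasurable_fun_sum _ fun j _ => (hc i j).mul (h1 _ _)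
  · exact Finset.aestronglyMeasurable_fun_sum _ fun i _ => h1 _ _

theorem cof_apply (A : Matrix (Fin 3) (Fin 3) ℝ) (i j : Fin 3) :
    cof A i j = A (i + 1) (j + 1) * A (i + 2) (j + 2) - A (i + 1) (j + 2) * A (i + 2) (j + 1) := by
  rw [cof, Matrix.transpose_apply, Matrix.adjugate_fin_three]
  fin_cases i <;> fin_cases j <;> simp <;> ring

theorem sum_cof_mul (A : Matrix (Fin 3) (Fin 3) ℝ) (i l : Fin 3) :
    ∑ j, cof A i j * A l j = if i = l then A.det else 0 := by
  have h := congrFun (congrFun (Matrix.mul_adjugate A) l) i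
  rw [Matrix.mul_apply] at h
  simp only [Matrix.smul_apply, Matrix.one_apply, smul_eq_mul, mul_ite, mul_one, mul_zero] at h
  simp only [cof, Matrix.transpose_apply, mul_comm (A.adjugate _ _), h, eq_comm]

/-- The action of a matrix on a vector of `ℝ³`. -/
noncomputable def matVec (A : Matrix (Fin 3) (Fin 3) ℝ) (z : E3) : E3 :=
  WithLp.toLp 2 fun i => ∑ j, z j * A i j

theorem matVec_apply (A : Matrix (Fin 3) (Fin 3) ℝ) (z : E3) (i : Fin 3) :
    matVec A z i = ∑ j, z j * A i j := rfl

theorem matVec_e (A : Matrix (Fin 3) (Fin 3) ℝ) (j : Fin 3) :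
    matVec A (e j) = ∑ l, A l j • e l := by
  ext i
  fin_cases i <;> fin_cases j <;> simp [matVec_apply, e, Fin.sum_univ_three]

/-- `matVec A` as a continuous linear map. -/
noncomputable def matCLM (A : Matrix (Fin 3) (Fin 3) ℝ) : E3 →L[ℝ] E3 :=
  LinearMap.toContinuousLinearMap
    { toFun := matVec A
      map_add' := fun x y => by
        ext i
        simp [matVec_apply, add_mul, Finset.sum_add_distrib]
      map_smul' := fun c x => by
        ext i
        simp [matVec_apply, Finset.mul_sum, mul_assoc] }

theorem matCLM_apply (A : Matrix (Fin 3) (Fin 3) ℝ) (z : E3) : matCLM A z = matVec A z := rfl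

/-- The cofactor identity for linear maps: integrating the pairing along a linear graph. -/
theorem integral_pairing_linear {k : E3 × E3 → E3} (hk : ContDiff ℝ (⊤ : ℕ∞) k)
    (hkc : HasCompactSupport k) (A : Matrix (Fin 3) (Fin 3) ℝ) (t : ℝ) :
    ∫ z, pairing (cof A) t (fderiv ℝ k (z, matVec A z))
      = (t - A.det) * ∫ z, ∑ i, (fderiv ℝ k (z, matVec A z) (0, e i)) i := by
  set γ : E3 → E3 × E3 := fun z => (z, matCLM A z) with hγ
  have hγc : Continuous γ := continuous_id.prodMk (matCLM A).continuous
  have hdc : Continuous (fderiv ℝ k) := hk.continuous_fderiv (by simp)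
  -- The first coordinate of the graph map γ is z itself, so restriction to the graph keeps compact
  -- support.
  have hγp : ∀ {F : Type} [NormedAddCommGroup F] {f : E3 × E3 → F}, HasCompactSupport f →
      HasCompactSupport fun z => f (γ z) := by
    intro F _ f hf
    refine HasCompactSupport.intro (hf.isCompact.image continuous_fst) fun z hz => ?_
    exact image_eq_zero_of_notMem_tsupport fun h => hz ⟨γ z, h, rfl⟩
  have hdγ : ∀ z, HasFDerivAt (fun z => k (γ z))
      ((fderiv ℝ k (γ z)).comp ((ContinuousLinearMap.id ℝ E3).prod (matCLM A))) z := by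
    intro z
    have h1 : HasFDerivAt k (fderiv ℝ k (γ z)) (γ z) :=
      (hk.differentiable (by simp) _).hasFDerivAt
    exact h1.comp z ((hasFDerivAt_id z).prodMk (matCLM A).hasFDerivAt)
  -- integrals of derivatives vanish
  have hint : ∀ (v : E3 × E3) (i : Fin 3), Integrable fun z => (fderiv ℝ k (γ z) v) i := by
    intro v i
    refine Continuous.integrable_of_hasCompactSupport (by fun_prop) ?_
    exact (hγp (hkc.fderiv ℝ)).comp_left (g := fun L : (E3 × E3) →L[ℝ] E3 => (L v) i) (by simp)
  have hzero : ∀ i j, ∫ z, ((fderiv ℝ k (γ z) (e j, 0)) i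
      + ∑ l, A l j * (fderiv ℝ k (γ z) (0, e l)) i) = 0 := by
    intro i j
    set f : E3 → ℝ := fun z => (k (γ z)) i with hf
    have hfd : ∀ z, HasFDerivAt f ((EuclideanSpace.proj i : E3 →L[ℝ] ℝ).comp
        ((fderiv ℝ k (γ z)).comp ((ContinuousLinearMap.id ℝ E3).prod (matCLM A)))) z := fun z =>
      (EuclideanSpace.proj i : E3 →L[ℝ] ℝ).hasFDerivAt.comp z (hdγ z)
    have hval : ∀ z, fderiv ℝ f z (e j) = (fderiv ℝ k (γ z) (e j, 0)) i
        + ∑ l, A l j * (fderiv ℝ k (γ z) (0, e l)) i := by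
      intro z
      rw [(hfd z).fderiv]
      simp only [ContinuousLinearMap.comp_apply, ContinuousLinearMap.prod_apply,
        ContinuousLinearMap.id_apply, matCLM_apply, matVec_e]
      have : ((e j, ∑ l, A l j • e l) : E3 × E3) = (e j, 0) + ∑ l, A l j • ((0, e l) : E3 × E3) := by
        ext1
        · simp [Prod.fst_sum]
        · simp [Prod.snd_sum]
      rw [this, map_add, map_sum]
      simp only [map_smul]
      simp
    have hfc : HasCompactSupport f :=
      (hγp hkc).comp_left (g := fun y : E3 => y i) (by simp)
    have hfcont : Continuous f := by
      have := hk.continuous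
      fun_prop
    have hfi : Integrable f := hfcont.integrable_of_hasCompactSupport hfc
    have hfdi : Integrable fun z => fderiv ℝ f z (e j) := by
      simp only [hval]
      exact (hint _ i).add (integrable_finsetSum _ fun l _ => (hint _ i).const_mul _)
    have h := integral_mul_fderiv_eq_neg_fderiv_mul_of_integrable (μ := (volume : Measure E3))
      (f := fun _ : E3 => (1 : ℝ)) (g := f) (v := e j) (by simp) (by simpa using hfdi)
      (by simpa using hfi) (fun _ _ => differentiableAt_const _)
      (fun z _ => (hfd z).differentiableAt)
    simp only [one_mul, fderiv_fun_const, Pi.zero_apply, zero_apply, zero_mul,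
      integral_zero, neg_zero, hval] at h
    exact h
  have hzi : ∀ i j, Integrable fun z => (fderiv ℝ k (γ z) (e j, 0)) i
      + ∑ l, A l j * (fderiv ℝ k (γ z) (0, e l)) i := fun i j =>
    (hint _ i).add (integrable_finsetSum _ fun l _ => (hint _ i).const_mul _)
  -- The cofactor identity converts D_x into total derivatives of z ↦ k(z, Az), whose integrals
  -- vanish, at the price of det A times div_y k. What survives is the factor t − det A.
  have hsplit : ∀ z, pairing (cof A) t (fderiv ℝ k (z, matVec A z))
      = (∑ i, ∑ j, cof A i j * ((fderiv ℝ k (γ z) (e j, 0)) i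
        + ∑ l, A l j * (fderiv ℝ k (γ z) (0, e l)) i))
        + (t - A.det) * ∑ i, (fderiv ℝ k (γ z) (0, e i)) i := by
    intro z
    have h1 : ∀ i, ∑ j, cof A i j * ∑ l, A l j * (fderiv ℝ k (γ z) (0, e l)) i
        = A.det * (fderiv ℝ k (γ z) (0, e i)) i := by
      intro i
      simp only [Finset.mul_sum]
      rw [Finset.sum_comm]
      have : ∀ l, ∑ j, cof A i j * (A l j * (fderiv ℝ k (γ z) (0, e l)) i)
          = (if i = l then A.det else 0) * (fderiv ℝ k (γ z) (0, e l)) i := by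
        intro l
        rw [← sum_cof_mul, Finset.sum_mul]
        exact Finset.sum_congr rfl fun j _ => by ring
      simp [this]
    rw [pairing_apply]
    simp only [mul_add, Finset.sum_add_distrib, h1]
    rw [← Finset.mul_sum]
    change _ + _ * ∑ i, (fderiv ℝ k (γ z) (0, e i)) i = _
    have : ∀ i j, (fderiv ℝ k (z, matVec A z) (e j, 0)) i = (fderiv ℝ k (γ z) (e j, 0)) i :=
      fun i j => rfl
    simp only [this]
    ring
  have hI1 : ∀ i, Integrable fun z => ∑ j, cof A i j * ((fderiv ℝ k (γ z) (e j, 0)) i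
        + ∑ l, A l j * (fderiv ℝ k (γ z) (0, e l)) i) := fun i =>
    integrable_finsetSum _ fun j _ => (hzi i j).const_mul _
  have hI2 : Integrable fun z => ∑ i, ∑ j, cof A i j * ((fderiv ℝ k (γ z) (e j, 0)) i
        + ∑ l, A l j * (fderiv ℝ k (γ z) (0, e l)) i) :=
    integrable_finsetSum _ fun i _ => hI1 i
  have hI3 : Integrable fun z => (t - A.det) * ∑ i, (fderiv ℝ k (γ z) (0, e i)) i :=
    (integrable_finsetSum _ fun i _ => hint _ i).const_mul _
  rw [integral_congr_ae (ae_of_all _ hsplit), integral_add hI2 hI3,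
    integral_finsetSum _ fun i _ => hI1 i]
  have h0 : ∀ i, ∫ z, ∑ j, cof A i j * ((fderiv ℝ k (γ z) (e j, 0)) i
        + ∑ l, A l j * (fderiv ℝ k (γ z) (0, e l)) i) = 0 := by
    intro i
    rw [integral_finsetSum _ fun j _ => (hzi i j).const_mul _]
    simp only [integral_const_mul, hzero, mul_zero, Finset.sum_const_zero]
  simp only [h0, Finset.sum_const_zero, zero_add, integral_const_mul]
  rfl

theorem W12.integrable_cof (u : W12 Ω) (i j : Fin 3) :
    Integrable (fun x => cof (u.grad x) i j) (volume.restrict (Ω : Set E3)) := by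
  have h := ((u.memLp_grad (i + 1) (j + 1)).integrable_fun_mul (u.memLp_grad (i + 2) (j + 2))).sub
    ((u.memLp_grad (i + 1) (j + 2)).integrable_fun_mul (u.memLp_grad (i + 2) (j + 1)))
  exact h.congr (ae_of_all _ fun x => (cof_apply _ i j).symm)

/-- The majorant is a product of an integrable coefficient in x and a bounded function supported in
a ball in z; this justifies Fubini in the blow-up. -/
theorem integrable_pairing_prod {μ : Measure E3} [SFinite μ]
    {c : E3 → Matrix (Fin 3) (Fin 3) ℝ} {t : E3 → ℝ}
    (hc : ∀ i j, Integrable (fun x => c x i j) μ) (ht : Integrable t μ)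
    {L : E3 × E3 → (E3 × E3) →L[ℝ] E3} (hL : AEStronglyMeasurable L (μ.prod volume))
    {B R : ℝ} (hLB : ∀ p, ‖L p‖ ≤ (Metric.closedBall (0 : E3) R).indicator (fun _ => B) p.2) :
    Integrable (fun p : E3 × E3 => pairing (c p.1) (t p.1) (L p)) (μ.prod volume) := by
  have hg : Integrable (fun x => (∑ i, ∑ j, |c x i j|) + 3 * |t x|) μ :=
    (integrable_finsetSum _ fun i _ => integrable_finsetSum _ fun j _ => (hc i j).abs).add
      (ht.abs.const_mul 3)
  have hh : Integrable ((Metric.closedBall (0 : E3) R).indicator fun _ => B) :=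
    (integrable_indicator_iff Metric.isClosed_closedBall.measurableSet).2
      (integrableOn_const measure_closedBall_lt_top.ne)
  refine (hg.mul_prod hh).mono' (aestronglyMeasurable_pairing
    (fun i j => (hc i j).1.comp_fst) ht.1.comp_fst hL) (ae_of_all _ fun p => ?_)
  refine (abs_pairing_le _ _ _).trans (mul_le_mul_of_nonneg_left (hLB p) ?_)
  positivity

theorem norm_fderiv_le_indicator {k : E3 × E3 → E3} {B R : ℝ}
    (hB : ∀ q, ‖fderiv ℝ k q‖ ≤ B) (hR : ∀ q ∈ tsupport k, ‖q‖ ≤ R) (z y : E3) :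
    ‖fderiv ℝ k (z, y)‖ ≤ (Metric.closedBall (0 : E3) R).indicator (fun _ => B) z := by
  by_cases hz : z ∈ Metric.closedBall (0 : E3) R
  · rw [Set.indicator_of_mem hz]
    exact hB _
  · rw [Set.indicator_of_notMem hz]
    have : fderiv ℝ k (z, y) = 0 := by
      refine image_eq_zero_of_notMem_tsupport (f := fderiv ℝ k) fun h => hz ?_
      rw [mem_closedBall_zero_iff]
      exact (norm_fst_le ((z, y) : E3 × E3)).trans (hR _ (tsupport_fderiv_subset ℝ h))
    rw [this, norm_zero]

/-! ### Blow-up and identification of the determinant. -/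

/-- Testing the surface energy with the graph mollification. -/
theorem exists_testFunction_graphMollify {v w : E3 → E3} {η : E3 → ℝ} {k : E3 × E3 → E3}
    {δ B R r : ℝ} (hη : Continuous η) (hηc : HasCompactSupport η)
    (hδΩ : Metric.cthickening δ (tsupport η) ⊆ Ω)
    (hw : Measurable w) (hwB : ∀ a, ‖w a‖ ≤ B)
    (hwv : ∀ᵐ x ∂(volume.restrict (Ω : Set E3)),
      x ∈ Metric.cthickening δ (tsupport η) → w x = v x)
    (hk : ContDiff ℝ (⊤ : ℕ∞) k) (hkc : HasCompactSupport k) (hR : ∀ q ∈ tsupport k, ‖q‖ ≤ R)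
    (hr : 0 < r) (hrR : r * R ≤ δ) :
    ∃ f : 𝓓(cyl Ω, E3), (∀ p, f p = graphMollify η w (scaleKernel r k) p) ∧
      ∀ (c : E3 → Matrix (Fin 3) (Fin 3) ℝ) (t : E3 → ℝ),
        ∫ x in (Ω : Set E3), pairing (c x) (t x) (fderiv ℝ f (x, v x))
          = ∫ x in (Ω : Set E3), ∫ z, η (x - r • z) *
            pairing (c x) (t x) (fderiv ℝ k (z, r⁻¹ • (w x - w (x - r • z)))) := by
  have hkδ : ∀ q, scaleKernel r k q ≠ 0 → ‖q‖ ≤ δ := by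
    intro q hq
    have h1 : k (r⁻¹ • q) ≠ 0 := fun h => hq (by simp [scaleKernel, h])
    have h2 := hR _ (subset_tsupport _ h1)
    rw [norm_smul, norm_inv, Real.norm_of_nonneg hr.le, inv_mul_le_iff₀ hr] at h2
    exact h2.trans hrR
  set S := Metric.cthickening δ (tsupport η) ×ˢ Metric.closedBall (0 : E3) (B + δ) with hS
  have hSc : IsCompact S := hηc.isCompact.cthickening.prod (isCompact_closedBall _ _)
  have hsupp : Function.support (graphMollify η w (scaleKernel r k)) ⊆ S := fun p hp => by
    by_contra h
    exact hp (graphMollify_eq_zero_of_notMem hwB hkδ h)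
  let f : 𝓓(cyl Ω, E3) := ⟨graphMollify η w (scaleKernel r k),
    contDiff_graphMollify hη hηc hw (contDiff_scaleKernel hk) (hasCompactSupport_scaleKernel hr hkc),
    HasCompactSupport.of_support_subset_isCompact hSc hsupp,
    (closure_minimal hsupp hSc.isClosed).trans fun p hp => ⟨hδΩ hp.1, Set.mem_univ _⟩⟩
  refine ⟨f, fun p => rfl, fun c t => integral_congr_ae ?_⟩
  have hdc : Continuous (fderiv ℝ k) := hk.continuous_fderiv (by simp)
  obtain ⟨D, hD0, hD⟩ := exists_bound_of_hasCompactSupport hdc (hkc.fderiv ℝ)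
  obtain ⟨N, hN0, hN⟩ := exists_bound_of_hasCompactSupport hη hηc
  filter_upwards [hwv] with x hx
  change pairing (c x) (t x) (fderiv ℝ (graphMollify η w (scaleKernel r k)) (x, v x)) = _
  rw [fderiv_graphMollify_scaleKernel hη hηc hw hk hkc hr]
  have hsm0 : ∀ T T' : (E3 × E3) →L[ℝ] E3, (0 : ℝ) • T = (0 : ℝ) • T' := fun T T' => by
    ext <;> simp
  -- If the integrand is nonzero, then ‖z‖ ≤ R and x lies within r R ≤ δ of the support of η, where
  -- the cut-off map w coincides with v.
  have heq : ∀ z, η (x - r • z) • fderiv ℝ k (z, r⁻¹ • (v x - w (x - r • z)))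
      = η (x - r • z) • fderiv ℝ k (z, r⁻¹ • (w x - w (x - r • z))) := by
    intro z
    by_cases hz : ‖z‖ ≤ R
    · by_cases hη0 : η (x - r • z) = 0
      · rw [hη0]
        exact hsm0 _ _
      · have hmem : x ∈ Metric.cthickening δ (tsupport η) := by
          refine Metric.mem_cthickening_of_dist_le x (x - r • z) δ _ (subset_tsupport _ hη0) ?_
          rw [dist_eq_norm, sub_sub_cancel, norm_smul, Real.norm_of_nonneg hr.le]
          exact (mul_le_mul_of_nonneg_left hz hr.le).trans hrR
        rw [hx hmem]
    · have hz' : z ∉ Metric.closedBall (0 : E3) R := by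
        rwa [mem_closedBall_zero_iff]
      have h0 : ∀ y, fderiv ℝ k (z, y) = 0 := fun y => by
        have := norm_fderiv_le_indicator hD hR z y
        rw [Set.indicator_of_notMem hz'] at this
        exact norm_le_zero_iff.1 this
      rw [h0, h0]
  simp only [heq]
  have hint : Integrable fun z => η (x - r • z) •
      fderiv ℝ k (z, r⁻¹ • (w x - w (x - r • z))) := by
    have hh : Integrable ((Metric.closedBall (0 : E3) R).indicator fun _ => D) :=
      (integrable_indicator_iff Metric.isClosed_closedBall.measurableSet).2
        (integrableOn_const measure_closedBall_lt_top.ne)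
    refine (hh.const_mul N).mono' ?_ (ae_of_all _ fun z => ?_)
    · have hm : Measurable fun z : E3 => (z, r⁻¹ • (w x - w (x - r • z))) := by fun_prop
      exact (by fun_prop : Continuous fun z => η (x - r • z)).aestronglyMeasurable.smul
        (hdc.comp_aestronglyMeasurable hm.aestronglyMeasurable)
    · rw [norm_smul]
      exact mul_le_mul (hN _) (norm_fderiv_le_indicator hD hR _ _) (norm_nonneg _) hN0
  rw [← ContinuousLinearMap.integral_comp_comm _ hint]
  simp only [map_smul, smul_eq_mul]

/-- The limit of the rescaled pairings. -/
theorem tendsto_integral_pairing_difference_quotient {w : E3 → E3} {G : E3 → E3 → E3}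
    {η : E3 → ℝ} {k : E3 × E3 → E3} {R : ℝ} (hη : Continuous η) (hηc : HasCompactSupport η)
    (hw : Measurable w) (hk : ContDiff ℝ (⊤ : ℕ∞) k) (hkc : HasCompactSupport k)
    (hR : ∀ q ∈ tsupport k, ‖q‖ ≤ R) {c : E3 → Matrix (Fin 3) (Fin 3) ℝ} {t : E3 → ℝ}
    (hc : ∀ i j, Integrable (fun x => c x i j) (volume.restrict (Ω : Set E3)))
    (ht : Integrable t (volume.restrict (Ω : Set E3)))
    (hG : AEStronglyMeasurable (fun p : E3 × E3 => G p.1 p.2)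
      ((volume.restrict (Ω : Set E3)).prod volume))
    {r : ℕ → ℝ} (hr0 : Tendsto r atTop (𝓝 0))
    (hconv : ∀ z, ∀ ns : ℕ → ℕ, Tendsto ns atTop atTop → ∃ ms : ℕ → ℕ, Tendsto ms atTop atTop ∧
      ∀ᵐ x ∂(volume.restrict (Ω : Set E3)), ∃ y,
        Tendsto (fun n => (r (ns (ms n)))⁻¹ • (w x - w (x - r (ns (ms n)) • z))) atTop (𝓝 y) ∧
        (η x ≠ 0 → y = G x z)) :
    Tendsto (fun n => ∫ x in (Ω : Set E3), ∫ z, η (x - r n • z) *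
        pairing (c x) (t x) (fderiv ℝ k (z, (r n)⁻¹ • (w x - w (x - r n • z))))) atTop
      (𝓝 (∫ x in (Ω : Set E3), ∫ z, η x * pairing (c x) (t x) (fderiv ℝ k (z, G x z)))) := by
  set μ := volume.restrict (Ω : Set E3) with hμ
  have hdc : Continuous (fderiv ℝ k) := hk.continuous_fderiv (by simp)
  obtain ⟨D, hD0, hD⟩ := exists_bound_of_hasCompactSupport hdc (hkc.fderiv ℝ)
  obtain ⟨N, hN0, hN⟩ := exists_bound_of_hasCompactSupport hη hηc
  set χ : E3 → ℝ := (Metric.closedBall (0 : E3) R).indicator fun _ => N * D with hχ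
  have hχi : Integrable χ :=
    (integrable_indicator_iff Metric.isClosed_closedBall.measurableSet).2
      (integrableOn_const measure_closedBall_lt_top.ne)
  set g : E3 → ℝ := fun x => (∑ i, ∑ j, |c x i j|) + 3 * |t x| with hg
  have hg0 : ∀ x, 0 ≤ g x := fun x => by positivity
  have hgi : Integrable g μ :=
    (integrable_finsetSum _ fun i _ => integrable_finsetSum _ fun j _ => (hc i j).abs).add
      (ht.abs.const_mul 3)
  have hLB : ∀ (a : ℝ) (z y : E3), |a| ≤ N → ‖a • fderiv ℝ k (z, y)‖ ≤ χ z := by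
    intro a z y ha
    rw [norm_smul]
    have h1 := mul_le_mul ha (norm_fderiv_le_indicator hD hR z y) (norm_nonneg _) hN0
    refine h1.trans_eq ?_
    by_cases hz : z ∈ Metric.closedBall (0 : E3) R
    · simp only [hχ, Set.indicator_of_mem hz]
    · simp only [hχ, Set.indicator_of_notMem hz, mul_zero]
  have hb : ∀ (a : ℝ) (x z y : E3), |a| ≤ N →
      ‖a * pairing (c x) (t x) (fderiv ℝ k (z, y))‖ ≤ g x * χ z := by
    intro a x z y ha
    rw [← smul_eq_mul, ← map_smul]
    exact (abs_pairing_le _ _ _).trans (mul_le_mul_of_nonneg_left (hLB a z y ha) (hg0 x))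
  have hmn : ∀ n, AEStronglyMeasurable (fun p : E3 × E3 => η (p.1 - r n • p.2) •
      fderiv ℝ k (p.2, (r n)⁻¹ • (w p.1 - w (p.1 - r n • p.2)))) (μ.prod volume) := by
    intro n
    have hm : Measurable fun p : E3 × E3 => (p.2, (r n)⁻¹ • (w p.1 - w (p.1 - r n • p.2))) := by
      fun_prop
    exact (by fun_prop : Continuous fun p : E3 × E3 =>
      η (p.1 - r n • p.2)).aestronglyMeasurable.smul
        (hdc.comp_aestronglyMeasurable hm.aestronglyMeasurable)
  have hm0 : AEStronglyMeasurable (fun p : E3 × E3 => η p.1 • fderiv ℝ k (p.2, G p.1 p.2))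
      (μ.prod volume) :=
    (by fun_prop : Continuous fun p : E3 × E3 => η p.1).aestronglyMeasurable.smul
      (hdc.comp_aestronglyMeasurable (continuous_snd.aestronglyMeasurable.prodMk hG))
  have hJn : ∀ n, Integrable (Function.uncurry fun x z => η (x - r n • z) *
      pairing (c x) (t x) (fderiv ℝ k (z, (r n)⁻¹ • (w x - w (x - r n • z)))))
      (μ.prod volume) := by
    intro n
    have h := integrable_pairing_prod hc ht (hmn n) (B := N * D) (R := R)
      (fun p => hLB _ _ _ (hN _))
    refine h.congr (ae_of_all _ fun p => ?_)
    simp [Function.uncurry_def]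
  have hJ0 : Integrable (Function.uncurry fun x z => η x *
      pairing (c x) (t x) (fderiv ℝ k (z, G x z))) (μ.prod volume) := by
    have h := integrable_pairing_prod hc ht hm0 (B := N * D) (R := R)
      (fun p => hLB _ _ _ (hN _))
    refine h.congr (ae_of_all _ fun p => ?_)
    simp [Function.uncurry_def]
  -- With z as the outer variable, difference quotients need to converge only for one direction z at
  -- a time, and only along subsequences that may depend on z.
  rw [integral_integral_swap hJ0]
  simp only [fun n => integral_integral_swap (hJn n)]
  refine tendsto_integral_of_dominated_convergence (fun z => (∫ x, g x ∂μ) * χ z) (fun n => ?_)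
    (hχi.const_mul _) (fun n => ae_of_all _ fun z => ?_) ?_
  · exact (hJn n).swap.integral_prod_left.aestronglyMeasurable
  · rw [← integral_mul_const]
    exact norm_integral_le_of_norm_le (hgi.mul_const _) (ae_of_all _ fun x => hb _ _ _ _ (hN _))
  have hsec : ∀ᵐ z : E3, ∀ n, AEStronglyMeasurable (fun x => η (x - r n • z) *
      pairing (c x) (t x) (fderiv ℝ k (z, (r n)⁻¹ • (w x - w (x - r n • z))))) μ :=
    ae_all_iff.2 fun n => by
      filter_upwards [(hJn n).swap.prod_right_ae] with z hz
      exact hz.aestronglyMeasurable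
  filter_upwards [hsec] with z hz
  refine tendsto_of_subseq_tendsto fun ns hns => ?_
  obtain ⟨ms, hms, hae⟩ := hconv z ns hns
  refine ⟨ms, tendsto_integral_of_dominated_convergence (fun x => g x * χ z) (fun n => hz _)
    (hgi.mul_const _) (fun n => ae_of_all _ fun x => hb _ _ _ _ (hN _)) ?_⟩
  filter_upwards [hae] with x hx
  obtain ⟨y, hy, hyG⟩ := hx
  have hηlim : Tendsto (fun n => η (x - r (ns (ms n)) • z)) atTop (𝓝 (η x)) := by
    have h1 : Tendsto (fun n => r (ns (ms n))) atTop (𝓝 0) := hr0.comp (hns.comp hms)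
    have h2 : Tendsto (fun s : ℝ => η (x - s • z)) (𝓝 0) (𝓝 (η (x - (0 : ℝ) • z))) :=
      (by fun_prop : Continuous fun s : ℝ => η (x - s • z)).tendsto 0
    rw [zero_smul, sub_zero] at h2
    exact h2.comp h1
  have hplim : Tendsto (fun n => pairing (c x) (t x)
      (fderiv ℝ k (z, (r (ns (ms n)))⁻¹ • (w x - w (x - r (ns (ms n)) • z))))) atTop
      (𝓝 (pairing (c x) (t x) (fderiv ℝ k (z, y)))) :=
    ((by fun_prop : Continuous fun y' => pairing (c x) (t x) (fderiv ℝ k (z, y'))).tendsto y).comp hy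
  have h3 := hηlim.mul hplim
  by_cases hη0 : η x = 0
  · simpa [hη0] using h3
  · rwa [← hyG hη0]

/-- A bounded measurable map that coincides almost everywhere with the truncation of `u` by a
cutoff function. -/
theorem W12.exists_measurable_cut {u : W12 Ω} {M : ℝ}
    (hM : ∀ᵐ x ∂(volume.restrict (Ω : Set E3)), ‖u.val x‖ ≤ M) {ζ : E3 → ℝ}
    (hζ : ContDiff ℝ (⊤ : ℕ∞) ζ) (hζc : HasCompactSupport ζ) (hζΩ : tsupport ζ ⊆ Ω)
    (hζ01 : ∀ x, ζ x ∈ Set.Icc (0 : ℝ) 1) :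
    ∃ w : E3 → E3, Measurable w ∧ (∀ a, ‖w a‖ ≤ |M|) ∧
      ∀ᵐ x, ∀ i, w x i = u.cut ζ i x := by
  obtain ⟨b, hb⟩ := W12.exists_cut_bound hζ hζc hζΩ
  have hm : ∀ i, AEStronglyMeasurable (u.cut ζ i) volume := fun i => (hb u i).1.1
  let w₀ : E3 → E3 := fun x => WithLp.toLp 2 fun i => (hm i).mk _ x
  have hw₀ : Measurable w₀ := (PiLp.continuous_toLp 2 (fun _ : Fin 3 => ℝ)).measurable.comp
    (measurable_pi_lambda _ fun i => (hm i).stronglyMeasurable_mk.measurable)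
  have hw₀eq : ∀ᵐ x, ∀ i, w₀ x i = u.cut ζ i x := by
    refine ae_all_iff.2 fun i => ?_
    filter_upwards [(hm i).ae_eq_mk] with x hx
    exact hx.symm
  -- The test field needs a bound at every point. Truncating at |M| provides it and changes w₀ only
  -- on a null set.
  let w : E3 → E3 := fun x => if ‖w₀ x‖ ≤ |M| then w₀ x else 0
  refine ⟨w, Measurable.ite (measurableSet_le hw₀.norm measurable_const) hw₀ measurable_const,
    fun a => ?_, ?_⟩
  · simp only [w]
    split_ifs with h
    · exact h
    · simp
  · rw [ae_restrict_iff' Ω.isOpen.measurableSet] at hM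
    filter_upwards [hw₀eq, hM] with x hx hMx i
    have hvec : w₀ x = ζ x • u.val x := by
      ext i
      rw [hx i]
      rfl
    have hle : ‖w₀ x‖ ≤ |M| := by
      rw [hvec, norm_smul]
      by_cases hxΩ : x ∈ (Ω : Set E3)
      · rw [Real.norm_of_nonneg (hζ01 x).1]
        exact (mul_le_of_le_one_left (norm_nonneg _) (hζ01 x).2).trans
          ((hMx hxΩ).trans (le_abs_self M))
      · simp [eq_zero_of_notMem_of_tsupport hζΩ hxΩ]
    simp only [w, if_pos hle]
    exact hx i

theorem W12.aestronglyMeasurable_matVec_grad (u : W12 Ω) :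
    AEStronglyMeasurable (fun p : E3 × E3 => matVec (u.grad p.1) p.2)
      ((volume.restrict (Ω : Set E3)).prod volume) := by
  refine (PiLp.continuous_toLp 2 (fun _ : Fin 3 => ℝ)).comp_aestronglyMeasurable ?_
  refine (aemeasurable_pi_lambda _ fun i => ?_).aestronglyMeasurable
  refine Finset.aemeasurable_fun_sum _ fun j _ => ?_
  exact (by fun_prop : Continuous fun p : E3 × E3 => p.2 j).aemeasurable.mul
    (u.memLp_grad i j).1.comp_fst.aemeasurable

/-- Blow-up of a functional that is bounded in the supremum norm. -/
theorem integral_integral_pairing_eq_zero (u : W12 Ω) {M : ℝ}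
    (hM : ∀ᵐ x ∂(volume.restrict (Ω : Set E3)), ‖u.val x‖ ≤ M) {θ : E3 → ℝ}
    (hθ : Integrable θ (volume.restrict (Ω : Set E3))) {C : ℝ}
    (hΛ : ∀ f : 𝓓(cyl Ω, E3), ∀ B : ℝ, 0 < B → (∀ p, ‖f p‖ ≤ B) →
      |∫ x in (Ω : Set E3), pairing (cof (u.grad x)) (θ x) (fderiv ℝ f (x, u.val x))| ≤ C * B)
    {k : E3 × E3 → E3} (hk : ContDiff ℝ (⊤ : ℕ∞) k) (hkc : HasCompactSupport k)
    {η : E3 → ℝ} (hη : Continuous η) (hηc : HasCompactSupport η) (hηΩ : tsupport η ⊆ Ω) :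
    ∫ x in (Ω : Set E3), ∫ z, η x *
      pairing (cof (u.grad x)) (θ x) (fderiv ℝ k (z, matVec (u.grad x) z)) = 0 := by
  have hΩm : MeasurableSet (Ω : Set E3) := Ω.isOpen.measurableSet
  obtain ⟨δ, hδ, hδΩ⟩ := hηc.isCompact.exists_cthickening_subset_open Ω.isOpen hηΩ
  obtain ⟨ζ, hζ, hζc, hζΩ, hζ1, hζ01⟩ :=
    exists_smooth_cutoff (hηc.isCompact.cthickening (r := δ)) Ω.isOpen hδΩ
  obtain ⟨w, hw, hwM, hwcut⟩ := u.exists_measurable_cut hM hζ hζc hζΩ hζ01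
  obtain ⟨b, hb⟩ := W12.exists_cut_bound hζ hζc hζΩ
  have hwv : ∀ᵐ x ∂(volume.restrict (Ω : Set E3)),
      x ∈ Metric.cthickening δ (tsupport η) → w x = u.val x := by
    filter_upwards [ae_restrict_of_ae hwcut] with x hx hmem
    ext i
    rw [hx i, W12.cut, hζ1 x hmem, one_mul]
  obtain ⟨R', hR'⟩ := hkc.isCompact.isBounded.subset_closedBall 0
  set R : ℝ := max R' 1 with hRdef
  have hRpos : 0 < R := lt_of_lt_of_le zero_lt_one (le_max_right _ _)
  have hR : ∀ q ∈ tsupport k, ‖q‖ ≤ R := fun q hq => by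
    have := hR' hq
    rw [mem_closedBall_zero_iff] at this
    exact this.trans (le_max_left _ _)
  -- Scales tending to zero with r n * R ≤ δ for every n, so all the test fields are supported over
  -- Ω.
  set r : ℕ → ℝ := fun n => δ / R * (1 / ((n : ℝ) + 1)) with hr
  have hrpos : ∀ n, 0 < r n := fun n => by positivity
  have hrR : ∀ n, r n * R ≤ δ := fun n => by
    have h1 : r n * R = δ * (1 / ((n : ℝ) + 1)) := by
      simp only [hr]
      field_simp
    rw [h1]
    refine mul_le_of_le_one_right hδ.le ?_
    rw [div_le_one (by positivity)]
    have : (0 : ℝ) ≤ n := Nat.cast_nonneg n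
    linarith
  have hr0 : Tendsto r atTop (𝓝 0) := by
    have := (tendsto_one_div_add_atTop_nhds_zero_nat (𝕜 := ℝ)).const_mul (δ / R)
    rwa [mul_zero] at this
  have hrne : Tendsto r atTop (𝓝[≠] 0) :=
    tendsto_nhdsWithin_iff.2 ⟨hr0, Eventually.of_forall fun n => (hrpos n).ne'⟩
  -- components of `w`
  have hwi : ∀ i, (fun x => w x i) =ᵐ[volume] u.cut ζ i := fun i => by
    filter_upwards [hwcut] with x hx
    exact hx i
  have hw2 : ∀ i, MemLp (fun x => w x i) 2 := fun i => (hb u i).1.ae_eq (hwi i).symm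
  have hquot : ∀ z i, Tendsto (fun n => eLpNorm (fun x =>
      ((r n)⁻¹ • (w x - w (x - r n • z))) i - u.cutDeriv ζ i z x) 2 volume) atTop (𝓝 0) := by
    intro z i
    have hwd : ∀ φ : E3 → ℝ, ContDiff ℝ (⊤ : ℕ∞) φ → HasCompactSupport φ →
        ∫ x, w x i * fderiv ℝ φ x z = - ∫ x, u.cutDeriv ζ i z x * φ x := by
      intro φ hφ hφc
      rw [← u.integral_cut_mul_fderiv hζ hζc hζΩ i z φ hφ hφc]
      refine integral_congr_ae ?_
      filter_upwards [hwi i] with x hx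
      rw [hx]
    exact (tendsto_eLpNorm_difference_quotient (hw2 i) ((hb u i).2.2 z).1 hwd).comp hrne
  have hlim := tendsto_integral_pairing_difference_quotient (Ω := Ω)
    (G := fun x z => matVec (u.grad x) z) hη hηc hw hk hkc hR
    u.integrable_cof hθ u.aestronglyMeasurable_matVec_grad hr0 (fun z ns hns => by
      obtain ⟨ms, hms, hae⟩ := exists_subseq_tendsto_ae_of_components (p := 2) (by norm_num)
        (v := fun n x => (r (ns n))⁻¹ • (w x - w (x - r (ns n) • z)))
        (v₀ := fun x => WithLp.toLp 2 fun i => u.cutDeriv ζ i z x) (μ := volume)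
        (fun n i => by
          have h1 : Measurable fun x => ((r (ns n))⁻¹ • (w x - w (x - r (ns n) • z))) i := by
            fun_prop
          exact h1.aestronglyMeasurable.sub ((hb u i).2.2 z).1.1)
        (fun i => (hquot z i).comp hns)
      refine ⟨ms, hms.tendsto_atTop, ?_⟩
      filter_upwards [ae_restrict_of_ae hae] with x hx
      refine ⟨_, hx, fun hη0 => ?_⟩
      have hxs : x ∈ tsupport η := subset_tsupport _ hη0
      -- ζ equals 1 in a whole neighbourhood of x, so its derivative vanishes there and the weak
      -- derivative of the cut-off map is Du(x) z.
      have hnhds : Metric.cthickening δ (tsupport η) ∈ 𝓝 x :=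
        Filter.mem_of_superset (Metric.isOpen_thickening.mem_nhds
          (Metric.self_subset_thickening hδ _ hxs)) (Metric.thickening_subset_cthickening _ _)
      have hζ1' : ζ =ᶠ[𝓝 x] fun _ => 1 := by
        filter_upwards [hnhds] with y hy
        exact hζ1 y hy
      have hfd : fderiv ℝ ζ x = 0 := by
        rw [hζ1'.fderiv_eq]
        simp
      ext i
      simp [W12.cutDeriv, hfd, hζ1'.eq_of_nhds, matVec_apply])
  obtain ⟨K, hK0, hK⟩ := exists_norm_graphMollify_scaleKernel_le (w := w) hη hηc hk.continuous hkc
  -- The sup bound is O(r n), so boundedness of the functional forces the limit to be zero. K + 1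
  -- replaces K because the bound has to be strictly positive.
  have hsmall : Tendsto (fun n => C * ((K + 1) * r n)) atTop (𝓝 0) := by
    have := (hr0.const_mul (K + 1)).const_mul C
    simpa using this
  refine tendsto_nhds_unique hlim ?_
  refine squeeze_zero_norm (fun n => ?_) hsmall
  obtain ⟨f, hf, hfΛ⟩ := exists_testFunction_graphMollify (Ω := Ω) hη hηc hδΩ hw hwM hwv hk hkc hR
    (hrpos n) (hrR n)
  rw [← hfΛ]
  refine hΛ f _ (mul_pos (by positivity) (hrpos n)) fun p => ?_
  rw [hf]
  refine (hK _ (hrpos n) p).trans (mul_le_mul_of_nonneg_right (by linarith) (hrpos n).le)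

/-- A kernel which is linear in the second variable near the origin. -/
noncomputable def linearKernel (φ : E3 → ℝ) (χ : E3 → ℝ) (p : E3 × E3) : E3 :=
  (φ p.1 * χ p.2) • p.2

/-- Near y the kernel is φ(z) times the identity in the second variable: either φ z = 0, or the
cutoff χ is locally 1. Its y-divergence is therefore 3 φ z. -/
theorem fderiv_linearKernel_snd {φ χ : E3 → ℝ} (hφ : ContDiff ℝ (⊤ : ℕ∞) φ)
    (hχ : ContDiff ℝ (⊤ : ℕ∞) χ) {z y : E3} (h : φ z = 0 ∨ χ =ᶠ[𝓝 y] fun _ => 1) (v : E3) :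
    fderiv ℝ (linearKernel φ χ) (z, y) (0, v) = φ z • v := by
  have hk : ContDiff ℝ (⊤ : ℕ∞) (linearKernel φ χ) :=
    ((hφ.comp contDiff_fst).mul (hχ.comp contDiff_snd)).smul contDiff_snd
  have h1 : HasFDerivAt (linearKernel φ χ) (fderiv ℝ (linearKernel φ χ) (z, y)) (z, y) :=
    (hk.differentiable (by simp) _).hasFDerivAt
  have h2 : HasFDerivAt (fun y' => linearKernel φ χ (z, y'))
      ((fderiv ℝ (linearKernel φ χ) (z, y)).comp
        ((0 : E3 →L[ℝ] E3).prod (ContinuousLinearMap.id ℝ E3))) y :=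
    h1.comp y ((hasFDerivAt_const z y).prodMk (hasFDerivAt_id y))
  have h3 : HasFDerivAt (fun y' => linearKernel φ χ (z, y'))
      (φ z • ContinuousLinearMap.id ℝ E3) y := by
    have h4 : (fun y' => linearKernel φ χ (z, y')) =ᶠ[𝓝 y] fun y' => φ z • y' := by
      rcases h with h | h
      · exact Eventually.of_forall fun y' => by simp [linearKernel, h]
      · filter_upwards [h] with y' hy'
        simp [linearKernel, hy']
    exact ((hasFDerivAt_id y).const_smul (φ z)).congr_of_eventuallyEq h4
  have h5 := DFunLike.congr_fun (h2.unique h3) v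
  simpa using h5

/-- Identification of the determinant: if the functional with `θ` in place of the determinant is
bounded in the supremum norm, then `θ` is the determinant. -/
theorem ae_eq_det_of_bounded_pairing (u : W12 Ω) {M : ℝ}
    (hM : ∀ᵐ x ∂(volume.restrict (Ω : Set E3)), ‖u.val x‖ ≤ M) {θ : E3 → ℝ}
    (hθ : Integrable θ (volume.restrict (Ω : Set E3))) {C : ℝ}
    (hΛ : ∀ f : 𝓓(cyl Ω, E3), ∀ B : ℝ, 0 < B → (∀ p, ‖f p‖ ≤ B) →
      |∫ x in (Ω : Set E3), pairing (cof (u.grad x)) (θ x) (fderiv ℝ f (x, u.val x))| ≤ C * B) :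
    ∀ᵐ x ∂(volume.restrict (Ω : Set E3)), θ x = (u.grad x).det := by
  have hΩm : MeasurableSet (Ω : Set E3) := Ω.isOpen.measurableSet
  -- Countably many kernels suffice, so the exceptional null sets can be united before a kernel is
  -- selected at each point x according to the size of Du(x).
  let χ : ContDiffBump (0 : E3) := ⟨1, 2, one_pos, one_lt_two⟩
  let φ : ℕ → ContDiffBump (0 : E3) := fun m =>
    ⟨1 / (m + 1) / 2, 1 / (m + 1), by positivity, half_lt_self (by positivity)⟩
  let k : ℕ → E3 × E3 → E3 := fun m => linearKernel (φ m) χ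
  have hk : ∀ m, ContDiff ℝ (⊤ : ℕ∞) (k m) := fun m =>
    (((φ m).contDiff.comp contDiff_fst).mul (χ.contDiff.comp contDiff_snd)).smul contDiff_snd
  have hkc : ∀ m, HasCompactSupport (k m) := fun m => by
    refine HasCompactSupport.intro (K := Metric.closedBall (0 : E3) (φ m).rOut ×ˢ
      Metric.closedBall (0 : E3) χ.rOut)
      ((isCompact_closedBall _ _).prod (isCompact_closedBall _ _)) fun p hp => ?_
    have h0 : φ m p.1 = 0 ∨ χ p.2 = 0 := by
      by_contra h
      rw [not_or] at h
      refine hp ⟨?_, ?_⟩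
      · rw [← (φ m).tsupport_eq]
        exact subset_tsupport _ h.1
      · rw [← χ.tsupport_eq]
        exact subset_tsupport _ h.2
    rcases h0 with h0 | h0 <;> simp [k, linearKernel, h0]
  have hzero : ∀ m, ∀ᵐ x, x ∈ (Ω : Set E3) → (∫ z, pairing (cof (u.grad x)) (θ x)
      (fderiv ℝ (k m) (z, matVec (u.grad x) z))) = 0 := by
    intro m
    refine Ω.isOpen.ae_eq_zero_of_integral_contDiff_smul_eq_zero ?_ fun η hη hηc hηΩ => ?_
    · refine IntegrableOn.locallyIntegrableOn ?_
      have hdc : Continuous (fderiv ℝ (k m)) := (hk m).continuous_fderiv (by simp)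
      obtain ⟨D, -, hD⟩ := exists_bound_of_hasCompactSupport hdc ((hkc m).fderiv ℝ)
      obtain ⟨R, hR⟩ := (hkc m).isCompact.isBounded.subset_closedBall 0
      exact (integrable_pairing_prod u.integrable_cof hθ
        (hdc.comp_aestronglyMeasurable (continuous_snd.aestronglyMeasurable.prodMk
          u.aestronglyMeasurable_matVec_grad))
        (fun p => norm_fderiv_le_indicator hD
          (fun q hq => mem_closedBall_zero_iff.1 (hR hq)) p.2 _)).integral_prod_left
    · have h := integral_integral_pairing_eq_zero u hM hθ hΛ (hk m) (hkc m) hη.continuous hηc hηΩ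
      rw [← setIntegral_eq_integral_of_forall_compl_eq_zero (s := (Ω : Set E3))
        (fun x hx => by simp [eq_zero_of_notMem_of_tsupport hηΩ hx])]
      simp only [integral_const_mul] at h
      simpa only [smul_eq_mul] using h
  rw [ae_restrict_iff' hΩm]
  filter_upwards [ae_all_iff.2 hzero] with x hx hxΩ
  set A := u.grad x with hA
  -- On the support of φ m, ‖Az‖ ≤ m/(m + 1) < 1, so Az stays in the ball where χ = 1.
  obtain ⟨m, hm⟩ := exists_nat_gt ‖matCLM A‖
  have h := hx m hxΩ
  rw [integral_pairing_linear (hk m) (hkc m)] at h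
  have hval : ∀ z, ∑ i, (fderiv ℝ (k m) (z, matVec A z) (0, e i)) i = 3 * φ m z := by
    intro z
    have hor : φ m z = 0 ∨ χ =ᶠ[𝓝 (matVec A z)] fun _ => 1 := by
      by_cases hz : φ m z = 0
      · exact Or.inl hz
      · right
        have hz' : z ∈ Metric.ball (0 : E3) (φ m).rOut := by
          rw [← (φ m).support_eq]
          exact hz
        rw [mem_ball_zero_iff] at hz'
        refine χ.eventuallyEq_one_of_mem_ball ?_
        rw [mem_ball_zero_iff, ← matCLM_apply]
        refine lt_of_le_of_lt ((matCLM A).le_opNorm z) ?_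
        have h1 : ‖z‖ < 1 / ((m : ℝ) + 1) := hz'
        have hm1 : (0 : ℝ) < m + 1 := by positivity
        have h2 : ‖matCLM A‖ * ‖z‖ ≤ m * (1 / ((m : ℝ) + 1)) :=
          mul_le_mul hm.le h1.le (norm_nonneg _) (Nat.cast_nonneg m)
        refine lt_of_le_of_lt h2 ?_
        rw [mul_one_div, div_lt_one hm1]
        linarith
    have h6 : ∀ i, (fderiv ℝ (k m) (z, matVec A z) (0, e i)) i = φ m z := fun i => by
      rw [fderiv_linearKernel_snd (φ m).contDiff χ.contDiff hor]
      simp [e]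
    simp [h6]
  simp only [hval, integral_const_mul] at h
  have hpos : 0 < ∫ z, φ m z := (φ m).integral_pos
  rcases mul_eq_zero.1 h with h | h
  · linarith
  · exfalso
    linarith

/-! ### Consequences of bounded energy and bounded surface energy. -/

/-- Positivity of the determinant puts it where H ≥ 0, so the volumetric term can be dropped from
the energy. -/
theorem W12.eLpNorm_grad_le {H : ℝ → ℝ} (hH : ∀ t, 0 < t → 0 ≤ H t) {w : W12 Ω}
    (hw : ∀ᵐ x ∂(volume.restrict (Ω : Set E3)), 0 < (w.grad x).det) (i j : Fin 3) :
    eLpNorm (fun x => w.grad x i j) 2 (volume.restrict (Ω : Set E3))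
      ≤ energy H w ^ (1 / (2 : ℝ)) := by
  rw [eLpNorm_eq_lintegral_rpow_enorm_toReal (by simp) (by simp)]
  simp only [ENNReal.toReal_ofNat]
  refine ENNReal.rpow_le_rpow (lintegral_mono_ae ?_) (by norm_num)
  filter_upwards [hw] with x hx
  have h1 : (w.grad x i j) ^ 2 ≤ ∑ i, ∑ j, (w.grad x i j) ^ 2 :=
    (Finset.single_le_sum (f := fun j => (w.grad x i j) ^ 2) (fun j _ => sq_nonneg _)
      (Finset.mem_univ j)).trans
      (Finset.single_le_sum (f := fun i => ∑ j, (w.grad x i j) ^ 2)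
        (fun i _ => Finset.sum_nonneg fun j _ => sq_nonneg _) (Finset.mem_univ i))
  rw [ENNReal.rpow_ofNat, Real.enorm_eq_ofReal_abs, ← ENNReal.ofReal_pow (abs_nonneg _), sq_abs]
  exact ENNReal.ofReal_le_ofReal (h1.trans (le_add_of_nonneg_right (hH _ hx)))

theorem W12.aestronglyMeasurable_det (w : W12 Ω) :
    AEStronglyMeasurable (fun x => (w.grad x).det) (volume.restrict (Ω : Set E3)) := by
  have h : ∀ i j, AEMeasurable (fun x => w.grad x i j) (volume.restrict (Ω : Set E3)) :=
    fun i j => (w.memLp_grad i j).1.aemeasurable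
  simp only [Matrix.det_fin_three]
  exact AEMeasurable.aestronglyMeasurable (by fun_prop)

/-- Superlinear growth of the volumetric energy controls the determinant where it is large. -/
theorem W12.integrable_det_and_integral_tail_le [IsFiniteMeasure (volume.restrict (Ω : Set E3))]
    {H : ℝ → ℝ} (hH : ∀ t, 0 < t → 0 ≤ H t) {w : W12 Ω}
    (hw : ∀ᵐ x ∂(volume.restrict (Ω : Set E3)), 0 < (w.grad x).det) {B : ℝ} (hB : 0 ≤ B)
    (hE : energy H w ≤ ENNReal.ofReal B) {K T : ℝ} (hK : 0 < K) (hT : 0 ≤ T)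
    (hKT : ∀ t, T ≤ t → K * t ≤ H t) :
    Integrable (fun x => (w.grad x).det) (volume.restrict (Ω : Set E3)) ∧
      ∫ x in (Ω : Set E3), ((w.grad x).det - min (w.grad x).det T) ≤ B / K := by
  have hm := w.aestronglyMeasurable_det
  have hm' : AEStronglyMeasurable (fun x => (w.grad x).det - min (w.grad x).det T)
      (volume.restrict (Ω : Set E3)) :=
    hm.sub (hm.inf aestronglyMeasurable_const)
  have hnn : ∀ x, 0 ≤ (w.grad x).det - min (w.grad x).det T := fun x =>
    sub_nonneg.2 (min_le_left _ _)
  have hlin : ∫⁻ x in (Ω : Set E3), ENNReal.ofReal ((w.grad x).det - min (w.grad x).det T)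
      ≤ ENNReal.ofReal (B / K) := by
    have h1 : ∫⁻ x in (Ω : Set E3), ENNReal.ofReal ((w.grad x).det - min (w.grad x).det T)
        ≤ ∫⁻ x in (Ω : Set E3), ENNReal.ofReal K⁻¹ *
          ENNReal.ofReal ((∑ i, ∑ j, (w.grad x i j) ^ 2) + H (w.grad x).det) := by
      refine lintegral_mono_ae ?_
      filter_upwards [hw] with x hx
      rw [← ENNReal.ofReal_mul (inv_nonneg.2 hK.le)]
      refine ENNReal.ofReal_le_ofReal ?_
      have h2 : 0 ≤ ∑ i, ∑ j, (w.grad x i j) ^ 2 :=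
        Finset.sum_nonneg fun i _ => Finset.sum_nonneg fun j _ => sq_nonneg _
      -- Below T the excess over T vanishes; above T it is at most the determinant itself, where K t
      -- ≤ H t applies.
      have h3 : K * ((w.grad x).det - min (w.grad x).det T) ≤ H (w.grad x).det := by
        rcases le_total T (w.grad x).det with h | h
        · refine le_trans ?_ (hKT _ h)
          rw [min_eq_right h]
          exact mul_le_mul_of_nonneg_left (by linarith) hK.le
        · rw [min_eq_left h, sub_self, mul_zero]
          exact hH _ hx
      rw [inv_mul_eq_div, le_div_iff₀ hK, mul_comm]
      linarith
    refine h1.trans ?_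
    rw [lintegral_const_mul' _ _ ENNReal.ofReal_ne_top, div_eq_inv_mul,
      ENNReal.ofReal_mul (inv_nonneg.2 hK.le)]
    gcongr
    exact hE
  have hint : Integrable (fun x => (w.grad x).det - min (w.grad x).det T)
      (volume.restrict (Ω : Set E3)) := by
    refine ⟨hm', ?_⟩
    rw [hasFiniteIntegral_iff_ofReal (Eventually.of_forall hnn)]
    exact hlin.trans_lt ENNReal.ofReal_lt_top
  have hmin : Integrable (fun x => min (w.grad x).det T) (volume.restrict (Ω : Set E3)) := by
    refine (integrable_const T).mono' (hm.inf aestronglyMeasurable_const) ?_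
    filter_upwards [hw] with x hx
    rw [Real.norm_of_nonneg (le_min hx.le hT)]
    exact min_le_right _ _
  refine ⟨?_, ?_⟩
  · have : Integrable (fun x => ((w.grad x).det - min (w.grad x).det T)
        + min (w.grad x).det T) (volume.restrict (Ω : Set E3)) := hint.add hmin
    simpa only [sub_add_cancel] using this
  · rw [integral_eq_lintegral_of_nonneg_ae (Eventually.of_forall hnn) hm']
    exact ENNReal.toReal_le_of_le_ofReal (by positivity) hlin

theorem IsVolumetricEnergy.exists_mul_le {H : ℝ → ℝ} (hH : IsVolumetricEnergy H) (K : ℝ) :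
    ∃ T : ℕ, ∀ t, (T : ℝ) ≤ t → K * t ≤ H t := by
  obtain ⟨a, ha⟩ := eventually_atTop.1 (hH.superlinear.eventually_ge_atTop K)
  obtain ⟨T, hT⟩ := exists_nat_ge (max a 1)
  refine ⟨T, fun t ht => ?_⟩
  have h1 : max a 1 ≤ t := hT.trans ht
  have h2 : 0 < t := lt_of_lt_of_le one_pos ((le_max_right _ _).trans h1)
  exact (le_div_iff₀ h2).1 (ha t ((le_max_left _ _).trans h1))

/-- The pairing is linear in f: scaling by ±1/B brings f into the unit ball, and the two signs turn
the one-sided supremum into a bound on the absolute value. -/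
theorem abs_surfacePairing_le {w : W12 Ω} {C : ℝ} (hC : 0 ≤ C)
    (hw : surfaceEnergy w ≤ ENNReal.ofReal C) (f : 𝓓(cyl Ω, E3)) {B : ℝ} (hB : 0 < B)
    (hf : ∀ p, ‖f p‖ ≤ B) : |surfacePairing w f| ≤ C * B := by
  have hone : ∀ h : 𝓓(cyl Ω, E3), (∀ p, ‖h p‖ ≤ 1) → surfacePairing w h ≤ C := fun h hh => by
    have h1 : ENNReal.ofReal (surfacePairing w h) ≤ surfaceEnergy w :=
      le_iSup₂ (f := fun (f : 𝓓(cyl Ω, E3)) (_ : ∀ z, ‖f z‖ ≤ 1) =>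
        ENNReal.ofReal (surfacePairing w f)) h hh
    exact (ENNReal.ofReal_le_ofReal_iff hC).1 (h1.trans hw)
  have hsmul : ∀ c : ℝ, surfacePairing w (c • f) = c * surfacePairing w f := fun c => by
    rw [surfacePairing, surfacePairing, ← integral_const_mul]
    refine integral_congr_ae (Eventually.of_forall fun x => ?_)
    have hd : fderiv ℝ (⇑(c • f)) (x, w.val x) = c • fderiv ℝ f (x, w.val x) := by
      rw [FunLike.coe_smul]
      exact fderiv_const_smul (f.contDiff.differentiable (by simp) _) c
    simp only [hd, smul_apply, PiLp.smul_apply, smul_eq_mul, mul_add,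
      Finset.mul_sum]
    congr 1
    · exact Finset.sum_congr rfl fun i _ => Finset.sum_congr rfl fun j _ => by ring
    · exact Finset.sum_congr rfl fun i _ => by ring
  have hle : ∀ c : ℝ, |c| = B⁻¹ → c * surfacePairing w f ≤ C := fun c hc => by
    rw [← hsmul]
    refine hone _ fun p => ?_
    rw [FunLike.coe_smul, Pi.smul_apply, norm_smul, Real.norm_eq_abs, hc, inv_mul_le_one₀ hB]
    exact hf p
  have hB' : |B⁻¹| = B⁻¹ := abs_of_pos (inv_pos.2 hB)
  have h1 := hle B⁻¹ hB'
  have h2 := hle (-B⁻¹) (by rw [abs_neg, hB'])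
  rw [inv_mul_le_iff₀ hB] at h1
  rw [neg_mul, ← mul_neg, inv_mul_le_iff₀ hB] at h2
  rw [abs_le]
  constructor <;> linarith

/-- Weak `L¹` convergence of coefficients is compatible with a.e. convergence of the maps in
integrals along graphs. -/
theorem tendsto_integral_sum_mul_comp_graph {ι : Type*} [Fintype ι]
    [IsFiniteMeasure (volume.restrict (Ω : Set E3))]
    {f : ℕ → E3 → ι → ℝ} {f₀ : E3 → ι → ℝ}
    (hf : ∀ n a, Integrable (fun x => f n x a) (volume.restrict (Ω : Set E3)))
    (hf₀ : ∀ a, Integrable (fun x => f₀ x a) (volume.restrict (Ω : Set E3)))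
    (hw : ∀ a, WeakConv Ω ⊤ (fun n x => f n x a) fun x => f₀ x a)
    {v : ℕ → E3 → E3} {v₀ : E3 → E3}
    (hv : ∀ n, AEStronglyMeasurable (v n) (volume.restrict (Ω : Set E3)))
    (hv₀ : AEStronglyMeasurable v₀ (volume.restrict (Ω : Set E3)))
    (hconv : ∀ᵐ x ∂(volume.restrict (Ω : Set E3)), Tendsto (fun n => v n x) atTop (𝓝 (v₀ x)))
    {b : ι → E3 × E3 → ℝ} (hb : ∀ a, Continuous (b a)) (hbc : ∀ a, HasCompactSupport (b a)) :
    Tendsto (fun n => ∫ x in (Ω : Set E3), ∑ a, f n x a * b a (x, v n x)) atTop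
      (𝓝 (∫ x in (Ω : Set E3), ∑ a, f₀ x a * b a (x, v₀ x))) := by
  have hbm : ∀ {y : E3 → E3}, AEStronglyMeasurable y (volume.restrict (Ω : Set E3)) → ∀ a,
      AEStronglyMeasurable (fun x => b a (x, y x)) (volume.restrict (Ω : Set E3)) :=
    fun hy a => (hb a).comp_aestronglyMeasurable
      (continuous_id.aestronglyMeasurable.prodMk hy)
  choose B hB0 hB using fun a => exists_bound_of_hasCompactSupport (hb a) (hbc a)
  have hint : ∀ {y : E3 → E3}, AEStronglyMeasurable y (volume.restrict (Ω : Set E3)) →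
      ∀ {h : E3 → ℝ}, Integrable h (volume.restrict (Ω : Set E3)) → ∀ a,
      Integrable (fun x => h x * b a (x, y x)) (volume.restrict (Ω : Set E3)) :=
    fun hy _ hh a => hh.mul_bdd (hbm hy a) (Eventually.of_forall fun x => hB a _)
  simp only [fun n => integral_finsetSum (μ := volume.restrict (Ω : Set E3)) Finset.univ
      fun a _ => hint (hv n) (hf n a) a,
    integral_finsetSum (μ := volume.restrict (Ω : Set E3)) Finset.univ
      fun a _ => hint hv₀ (hf₀ a) a]
  refine tendsto_finsetSum _ fun a _ => ?_
  refine tendsto_integral_mul_of_weakL1 (fun n => hf n a) (hf₀ a) (hw a)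
    (fun n => hbm (hv n) a) (B := B a) (fun n => Eventually.of_forall fun x => hB a _) ?_
  filter_upwards [hconv] with x hx
  exact ((hb a).tendsto _).comp (tendsto_const_nhds.prodMk_nhds hx)

end NeoHookean

/-! ### Calculus of alternating 3-forms on explicit triples. -/

section AlternatingThree

variable {V : Type*} [NormedAddCommGroup V] [NormedSpace ℝ V] (ω : V [⋀^Fin 3]→L[ℝ] ℝ)

namespace ContinuousAlternatingMap

theorem vec3_update {W : Type*} (x y z t : W) :
    Function.update ![x, y, z] 0 t = ![t, y, z] ∧ Function.update ![x, y, z] 1 t = ![x, t, z] ∧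
      Function.update ![x, y, z] 2 t = ![x, y, t] := by
  refine ⟨?_, ?_, ?_⟩ <;> funext k <;> fin_cases k <;> rfl

theorem vec3_add_zero (x x' y z : V) : ω ![x + x', y, z] = ω ![x, y, z] + ω ![x', y, z] := by
  have h := ω.map_update_add ![x, y, z] 0 x x'
  simpa only [(vec3_update x y z _).1] using h

theorem vec3_add_one (x y y' z : V) : ω ![x, y + y', z] = ω ![x, y, z] + ω ![x, y', z] := by
  have h := ω.map_update_add ![x, y, z] 1 y y'
  simpa only [(vec3_update x y z _).2.1] using h

theorem vec3_add_two (x y z z' : V) : ω ![x, y, z + z'] = ω ![x, y, z] + ω ![x, y, z'] := by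
  have h := ω.map_update_add ![x, y, z] 2 z z'
  simpa only [(vec3_update x y z _).2.2] using h

theorem vec3_smul_zero (c : ℝ) (x y z : V) : ω ![c • x, y, z] = c * ω ![x, y, z] := by
  have h := ω.map_update_smul ![x, y, z] 0 c x
  simpa only [(vec3_update x y z _).1, smul_eq_mul] using h

theorem vec3_smul_one (c : ℝ) (x y z : V) : ω ![x, c • y, z] = c * ω ![x, y, z] := by
  have h := ω.map_update_smul ![x, y, z] 1 c y
  simpa only [(vec3_update x y z _).2.1, smul_eq_mul] using h

theorem vec3_smul_two (c : ℝ) (x y z : V) : ω ![x, y, c • z] = c * ω ![x, y, z] := by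
  have h := ω.map_update_smul ![x, y, z] 2 c z
  simpa only [(vec3_update x y z _).2.2, smul_eq_mul] using h

theorem vec3_self_zero_one (x z : V) : ω ![x, x, z] = 0 :=
  ω.map_eq_zero_of_eq ![x, x, z] (i := 0) (j := 1) rfl (by decide)

theorem vec3_self_one_two (x y : V) : ω ![x, y, y] = 0 :=
  ω.map_eq_zero_of_eq ![x, y, y] (i := 1) (j := 2) rfl (by decide)

theorem vec3_self_zero_two (x y : V) : ω ![x, y, x] = 0 :=
  ω.map_eq_zero_of_eq ![x, y, x] (i := 0) (j := 2) rfl (by decide)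

theorem vec3_swap_zero_one (x y z : V) : ω ![y, x, z] = -ω ![x, y, z] := by
  have h := vec3_self_zero_one ω (x + y) z
  rw [vec3_add_zero, vec3_add_one, vec3_add_one, vec3_self_zero_one, vec3_self_zero_one] at h
  linarith

theorem vec3_swap_one_two (x y z : V) : ω ![x, z, y] = -ω ![x, y, z] := by
  have h := vec3_self_one_two ω x (y + z)
  rw [vec3_add_one, vec3_add_two, vec3_add_two, vec3_self_one_two, vec3_self_one_two] at h
  linarith

theorem vec3_swap_zero_two (x y z : V) : ω ![z, y, x] = -ω ![x, y, z] := by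
  have h := vec3_self_zero_two ω (x + z) y
  rw [vec3_add_zero, vec3_add_two, vec3_add_two, vec3_self_zero_two, vec3_self_zero_two] at h
  linarith

theorem vec3_rotate (x y z : V) : ω ![y, z, x] = ω ![x, y, z] := by
  rw [vec3_swap_one_two, vec3_swap_zero_one, neg_neg]

end ContinuousAlternatingMap

end AlternatingThree

/-! ### Minors, and convergence of pairings and currents. -/

namespace NeoHookean

open ContinuousAlternatingMap

/-- Labels of the minors of a `3 × 3` matrix. -/
abbrev MinorIndex : Type := Unit ⊕ (Fin 3 × Fin 3) ⊕ (Fin 3 × Fin 3) ⊕ Unit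

/-- The minors of `A`, with the determinant replaced by `t`. -/
noncomputable def minors (A : Matrix (Fin 3) (Fin 3) ℝ) (t : ℝ) : MinorIndex → ℝ :=
  Sum.elim (fun _ => 1) (Sum.elim (fun p => A p.1 p.2)
    (Sum.elim (fun p => cof A p.1 p.2) fun _ => t))

/-- The triples of basis vectors of `ℝ³ × ℝ³` that are dual to the minors. -/
noncomputable def minorFrame : MinorIndex → Fin 3 → E3 × E3 :=
  Sum.elim (fun _ k => (e k, 0))
    (Sum.elim (fun p => Function.update (fun k => (e k, 0)) p.2 (0, e p.1))
      (Sum.elim (fun p => Function.update (fun k => (0, e (p.1 + (k - p.2)))) p.2 (e p.2, 0))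
        fun _ k => (0, e k)))

/-- Multilinear expansion of the columns (e_k, 0) + (0, Du e_k). Terms with a repeated vertical
vector vanish, and the others group into minors. In `minorFrame`, slot p.2 of a cofactor triple
stays horizontal and the other slots run cyclically from p.1 modulo 3; this order absorbs the
cofactor signs. -/
theorem form_apply_graph (ω : (E3 × E3) [⋀^Fin 3]→L[ℝ] ℝ) (A : Matrix (Fin 3) (Fin 3) ℝ) :
    ω (fun k => (e k, WithLp.toLp 2 (fun i => A i k)))
      = ∑ a, minors A A.det a * ω (minorFrame a) := by
  set a : Fin 3 → E3 × E3 := fun k => (e k, 0) with ha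
  set b : Fin 3 → E3 × E3 := fun k => (0, e k) with hb
  have hv : (fun k => (e k, WithLp.toLp 2 (fun i => A i k)) : Fin 3 → E3 × E3)
      = fun k => a k + (A 0 k • b 0 + A 1 k • b 1 + A 2 k • b 2) := by
    funext k
    refine Prod.ext (by simp [ha, hb]) ?_
    ext i
    fin_cases i <;> simp [ha, hb, e]
  have hvec : ∀ v : Fin 3 → E3 × E3, v = ![v 0, v 1, v 2] := fun v => by
    funext k
    fin_cases k <;> rfl
  have hf1 : minorFrame (Sum.inl ()) = ![a 0, a 1, a 2] := hvec _
  have hf4 : minorFrame (Sum.inr (Sum.inr (Sum.inr ()))) = ![b 0, b 1, b 2] := hvec _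
  have hf20 : ∀ i, minorFrame (Sum.inr (Sum.inl (i, 0))) = ![b i, a 1, a 2] := fun i => hvec _
  have hf21 : ∀ i, minorFrame (Sum.inr (Sum.inl (i, 1))) = ![a 0, b i, a 2] := fun i => hvec _
  have hf22 : ∀ i, minorFrame (Sum.inr (Sum.inl (i, 2))) = ![a 0, a 1, b i] := fun i => hvec _
  have hf30 : ∀ i, minorFrame (Sum.inr (Sum.inr (Sum.inl (i, 0)))) = ![a 0, b (i + 1), b (i + 2)] :=
    fun i => hvec _
  have hf31 : ∀ i, minorFrame (Sum.inr (Sum.inr (Sum.inl (i, 1)))) = ![b (i + 2), a 1, b (i + 1)] :=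
    fun i => hvec _
  have hf32 : ∀ i, minorFrame (Sum.inr (Sum.inr (Sum.inl (i, 2)))) = ![b (i + 1), b (i + 2), a 2] :=
    fun i => hvec _
  rw [hv, hvec fun k => a k + (A 0 k • b 0 + A 1 k • b 1 + A 2 k • b 2)]
  simp only [Fintype.sum_sum_type, Fintype.sum_prod_type, Fin.sum_univ_three,
    Finset.univ_unique, Finset.sum_singleton, PUnit.default_eq_unit, hf1, hf4, hf20, hf21, hf22,
    hf30, hf31, hf32, minors, Sum.elim_inl, Sum.elim_inr, cof_apply, Matrix.det_fin_three]
  have e01 : (0 : Fin 3) + 1 = 1 := rfl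
  have e02 : (0 : Fin 3) + 2 = 2 := rfl
  have e11 : (1 : Fin 3) + 1 = 2 := rfl
  have e12 : (1 : Fin 3) + 2 = 0 := rfl
  have e21 : (2 : Fin 3) + 1 = 0 := rfl
  have e22 : (2 : Fin 3) + 2 = 1 := rfl
  simp only [e01, e02, e11, e12, e21, e22]
  -- The swaps are instantiated at specific basis vectors so that each triple is rewritten towards
  -- its frame; an unrestricted swap rule would have no direction.
  simp only [vec3_add_zero, vec3_add_one, vec3_add_two, vec3_smul_zero, vec3_smul_one,
    vec3_smul_two, vec3_self_zero_one, vec3_self_one_two, vec3_self_zero_two,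
    vec3_swap_one_two ω (a 0) (b 1) (b 2), vec3_swap_one_two ω (a 0) (b 2) (b 0),
    vec3_swap_one_two ω (a 0) (b 0) (b 1), vec3_swap_zero_two ω (b 2) (a 1) (b 1),
    vec3_swap_zero_two ω (b 0) (a 1) (b 2), vec3_swap_zero_two ω (b 1) (a 1) (b 0),
    vec3_swap_zero_one ω (b 1) (b 2) (a 2), vec3_swap_zero_one ω (b 2) (b 0) (a 2),
    vec3_swap_zero_one ω (b 0) (b 1) (a 2), vec3_swap_zero_one ω (b 0) (b 1) (b 2),
    vec3_swap_one_two ω (b 0) (b 1) (b 2), vec3_swap_zero_two ω (b 0) (b 1) (b 2),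
    vec3_rotate ω (b 0) (b 1) (b 2), vec3_rotate ω (b 2) (b 0) (b 1)]
  ring

variable {Ω : Opens E3}

theorem W12.integrable_minors [IsFiniteMeasure (volume.restrict (Ω : Set E3))] (u : W12 Ω)
    {θ : E3 → ℝ} (hθ : Integrable θ (volume.restrict (Ω : Set E3))) (a : MinorIndex) :
    Integrable (fun x => minors (u.grad x) (θ x) a) (volume.restrict (Ω : Set E3)) := by
  rcases a with _ | p | p | _
  · exact integrable_const 1
  · exact (u.memLp_grad p.1 p.2).integrable one_le_two
  · exact u.integrable_cof p.1 p.2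
  · exact hθ

/-- On a set of finite measure bounded test functions lie in L², so weak L² convergence of gradients
is enough for the first-order minors. Leaving θ free allows its use before the determinant is
identified. -/
theorem weakConv_minors [IsFiniteMeasure (volume.restrict (Ω : Set E3))] {u : ℕ → W12 Ω}
    {u₀ : W12 Ω} (hweak : WeakConvW12 u u₀) (hcof : WeakConvCofL1 u u₀) {θ : E3 → ℝ}
    (hdet : WeakConv Ω ⊤ (fun n x => ((u n).grad x).det) θ) (a : MinorIndex) :
    WeakConv Ω ⊤ (fun n x => minors ((u n).grad x) ((u n).grad x).det a)
      fun x => minors (u₀.grad x) (θ x) a := by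
  rcases a with _ | p | p | _
  · exact fun ψ _ => tendsto_const_nhds
  · exact fun ψ hψ => hweak.2 p.1 p.2 ψ (hψ.mono_exponent le_top)
  · exact hcof p.1 p.2
  · exact hdet

/-- The surface pairing sees only cofactors and determinant, with zero coefficients elsewhere. In
this form it is covered by the same convergence result as the graph current. -/
theorem pairing_eq_sum_minors (A : Matrix (Fin 3) (Fin 3) ℝ) (t : ℝ)
    (L : (E3 × E3) →L[ℝ] E3) :
    pairing (cof A) t L = ∑ a, minors A t a * Sum.elim (fun _ => 0) (Sum.elim (fun _ => 0)
      (Sum.elim (fun p : Fin 3 × Fin 3 => (L (e p.2, 0)) p.1)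
        fun _ => ∑ i, (L (0, e i)) i)) a := by
  simp [pairing_apply, Fintype.sum_sum_type, Fintype.sum_prod_type, minors]

/-- Convergence of the functional that defines the surface energy. -/
theorem tendsto_surfacePairing [IsFiniteMeasure (volume.restrict (Ω : Set E3))] {u : ℕ → W12 Ω}
    {u₀ : W12 Ω} (hweak : WeakConvW12 u u₀) (hcof : WeakConvCofL1 u u₀)
    (hint : ∀ n, Integrable (fun x => ((u n).grad x).det) (volume.restrict (Ω : Set E3)))
    {θ : E3 → ℝ} (hθ : Integrable θ (volume.restrict (Ω : Set E3)))
    (hdet : WeakConv Ω ⊤ (fun n x => ((u n).grad x).det) θ)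
    (hconv : ∀ᵐ x ∂(volume.restrict (Ω : Set E3)),
      Tendsto (fun n => (u n).val x) atTop (𝓝 (u₀.val x))) (f : 𝓓(cyl Ω, E3)) :
    Tendsto (fun n => surfacePairing (u n) f) atTop
      (𝓝 (∫ x in (Ω : Set E3), pairing (cof (u₀.grad x)) (θ x) (fderiv ℝ f (x, u₀.val x)))) := by
  have hd : Continuous (fderiv ℝ f) := f.contDiff.continuous_fderiv (by simp)
  have hdc : HasCompactSupport (fderiv ℝ f) := f.hasCompactSupport.fderiv ℝ
  have key := tendsto_integral_sum_mul_comp_graph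
    (f := fun n x => minors ((u n).grad x) ((u n).grad x).det)
    (f₀ := fun x => minors (u₀.grad x) (θ x))
    (fun n a => (u n).integrable_minors (hint n) a) (fun a => u₀.integrable_minors hθ a)
    (weakConv_minors hweak hcof hdet) (fun n => (u n).memLp_val.1) u₀.memLp_val.1 hconv
    (b := fun a p => Sum.elim (fun _ => 0) (Sum.elim (fun _ => 0)
      (Sum.elim (fun q : Fin 3 × Fin 3 => (fderiv ℝ f p (e q.2, 0)) q.1)
        fun _ => ∑ i, (fderiv ℝ f p (0, e i)) i)) a)
    (by
      rintro (_ | q | q | _)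
      · exact continuous_const
      · exact continuous_const
      · exact (by fun_prop : Continuous fun T : (E3 × E3) →L[ℝ] E3 =>
          (T (e q.2, 0)) q.1).comp hd
      · exact (by fun_prop : Continuous fun T : (E3 × E3) →L[ℝ] E3 =>
          ∑ i, (T (0, e i)) i).comp hd)
    (by
      rintro (_ | q | q | _)
      · exact HasCompactSupport.zero
      · exact HasCompactSupport.zero
      · exact hdc.comp_left (g := fun T : (E3 × E3) →L[ℝ] E3 => (T (e q.2, 0)) q.1) (by simp)
      · exact hdc.comp_left (g := fun T : (E3 × E3) →L[ℝ] E3 => ∑ i, (T (0, e i)) i) (by simp))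
  simp only [← pairing_eq_sum_minors] at key
  simpa only [surfacePairing, pairing_apply] using key

/-- Convergence of the graph currents. -/
theorem tendsto_graphCurrent [IsFiniteMeasure (volume.restrict (Ω : Set E3))] {u : ℕ → W12 Ω}
    {u₀ : W12 Ω} (hweak : WeakConvW12 u u₀) (hcof : WeakConvCofL1 u u₀)
    (hint : ∀ n, Integrable (fun x => ((u n).grad x).det) (volume.restrict (Ω : Set E3)))
    (hint₀ : Integrable (fun x => (u₀.grad x).det) (volume.restrict (Ω : Set E3)))
    (hdet : WeakConv Ω ⊤ (fun n x => ((u n).grad x).det) fun x => (u₀.grad x).det)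
    (hconv : ∀ᵐ x ∂(volume.restrict (Ω : Set E3)),
      Tendsto (fun n => (u n).val x) atTop (𝓝 (u₀.val x))) (ω : TestForm Ω) :
    Tendsto (fun n => graphCurrent (u n) ω) atTop (𝓝 (graphCurrent u₀ ω)) := by
  simp only [graphCurrent, form_apply_graph]
  exact tendsto_integral_sum_mul_comp_graph
    (f := fun n x => minors ((u n).grad x) ((u n).grad x).det)
    (f₀ := fun x => minors (u₀.grad x) (u₀.grad x).det)
    (fun n a => (u n).integrable_minors (hint n) a) (fun a => u₀.integrable_minors hint₀ a)
    (weakConv_minors hweak hcof hdet) (fun n => (u n).memLp_val.1) u₀.memLp_val.1 hconv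
    (b := fun a p => ω p (minorFrame a))
    (fun a => ω.contDiff.continuous.eval_const _)
    (fun a => ω.hasCompactSupport.comp_left
      (g := fun T : (E3 × E3) [⋀^Fin 3]→L[ℝ] ℝ => T (minorFrame a)) rfl)

/-- Compactness: along a subsequence the maps converge almost everywhere and the determinants
converge weakly to the determinant of the limit. -/
theorem exists_subseq_tendsto_det [IsFiniteMeasure (volume.restrict (Ω : Set E3))]
    {u : ℕ → W12 Ω} {u₀ : W12 Ω} (hweak : WeakConvW12 u u₀) (hcof : WeakConvCofL1 u u₀) {M : ℝ}
    (hM : ∀ n, ∀ᵐ x ∂(volume.restrict (Ω : Set E3)), ‖(u n).val x‖ ≤ M)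
    (hpos : ∀ n, ∀ᵐ x ∂(volume.restrict (Ω : Set E3)), 0 < ((u n).grad x).det)
    {A : ℝ≥0∞} (hA : A ≠ ⊤)
    (hgrad : ∀ n i j, eLpNorm (fun x => (u n).grad x i j) 2 (volume.restrict (Ω : Set E3)) ≤ A)
    (hint : ∀ n, Integrable (fun x => ((u n).grad x).det) (volume.restrict (Ω : Set E3)))
    (hui : ∀ ε : ℝ, 0 < ε → ∃ K : ℕ, ∀ n,
      ∫ x in (Ω : Set E3), (((u n).grad x).det - min ((u n).grad x).det K) ≤ ε)
    {C : ℝ} (hC : 0 ≤ C) (hsurf : ∀ n, surfaceEnergy (u n) ≤ ENNReal.ofReal C) :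
    Integrable (fun x => (u₀.grad x).det) (volume.restrict (Ω : Set E3)) ∧
      ∃ φ : ℕ → ℕ, StrictMono φ ∧
        WeakConv Ω ⊤ (fun n x => ((u (φ n)).grad x).det) (fun x => (u₀.grad x).det) ∧
        ∀ᵐ x ∂(volume.restrict (Ω : Set E3)),
          Tendsto (fun n => (u (φ n)).val x) atTop (𝓝 (u₀.val x)) := by
  have : Fact ((2 : ℝ≥0∞) ≠ ⊤) := ⟨by simp⟩
  have hΩ : volume (Ω : Set E3) ≠ ⊤ := by
    have := measure_ne_top (volume.restrict (Ω : Set E3)) Set.univ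
    rwa [Measure.restrict_apply_univ] at this
  obtain ⟨φ, hφ, θ, hθ, hθw⟩ := exists_subseq_weak_L1 hint
    (fun n => (hpos n).mono fun x hx => hx.le) hui
  obtain ⟨ψ, hψ, hae⟩ := exists_subseq_tendsto_ae_of_components (p := 1)
    (μ := volume.restrict (Ω : Set E3)) le_rfl (v := fun n => (u (φ n)).val) (v₀ := u₀.val)
    (fun n i => ((u (φ n)).memLp_val_apply i).1.sub (u₀.memLp_val_apply i).1)
    (fun i => (tendsto_eLpNorm_one_sub (hweak.1 i) (M := M)
      (fun n => (hM n).mono fun x hx => (abs_apply_le_norm _ i).trans hx) hA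
      (fun n j => hgrad n i j) hΩ).comp hφ.tendsto_atTop)
  have hφψ : Tendsto (φ ∘ ψ) atTop atTop := (hφ.comp hψ).tendsto_atTop
  have hw' : WeakConvW12 (fun n => u (φ (ψ n))) u₀ :=
    ⟨fun i f hf => (hweak.1 i f hf).comp hφψ, fun i j f hf => (hweak.2 i j f hf).comp hφψ⟩
  have hc' : WeakConvCofL1 (fun n => u (φ (ψ n))) u₀ :=
    fun i j f hf => (hcof i j f hf).comp hφψ
  have hd' : WeakConv Ω ⊤ (fun n x => ((u (φ (ψ n))).grad x).det) θ :=
    fun f hf => (hθw f hf).comp hψ.tendsto_atTop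
  have hM₀ : ∀ᵐ x ∂(volume.restrict (Ω : Set E3)), ‖u₀.val x‖ ≤ M := by
    filter_upwards [hae, ae_all_iff.2 hM] with x hx hMx
    exact le_of_tendsto hx.norm (Eventually.of_forall fun n => hMx _)
  -- The bound C ‖f‖_∞ is uniform in n and survives the limit, which is exactly what the blow-up
  -- needs to identify θ.
  have hθdet := ae_eq_det_of_bounded_pairing u₀ hM₀ hθ (C := C) fun f B hB hf =>
    le_of_tendsto (tendsto_surfacePairing hw' hc' (fun n => hint _) hθ hd' hae f).abs
      (Eventually.of_forall fun n => abs_surfacePairing_le hC (hsurf _) f hB hf)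
  refine ⟨hθ.congr hθdet, φ ∘ ψ, hφ.comp hψ, fun f hf => ?_, hae⟩
  have h1 : ∫ x in (Ω : Set E3), (u₀.grad x).det * f x = ∫ x in (Ω : Set E3), θ x * f x := by
    refine integral_congr_ae ?_
    filter_upwards [hθdet] with x hx
    rw [hx]
  rw [h1]
  exact hd' f hf

end NeoHookean

/-! ### The main theorem. -/

open NeoHookean in
theorem mainTheorem8 (Ω Ω' : Opens E3)
    (hΩ : IsSmoothBoundedDomain (Ω : Set E3)) (hΩ' : IsSmoothBoundedDomain (Ω' : Set E3))
    (g : E3 → E3) (hg : IsC1Diffeo g (closure (Ω : Set E3)) (closure (Ω' : Set E3)))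
    (M : ℝ) (hM : 0 < M) (H : ℝ → ℝ) (hH : IsVolumetricEnergy H)
    (u : ℕ → W12 Ω) (u₀ : W12 Ω)
    (hmin : IsMinimizingSeq (energy H) (admissibleNC Ω g M) u ∨
      (IsMinimizingSeq (energy H) (admissible Ω g M) u ∧
        ∃ C : ℝ, ∀ n, surfaceEnergy (u n) ≤ ENNReal.ofReal C))
    (hweak : WeakConvW12 u u₀)
    (hcof : WeakConvCofL1 u u₀) :
    u₀.HasGraphCurrent ∧ (∀ᶠ n in atTop, (u n).HasGraphCurrent) ∧
      ∀ ω : TestForm Ω,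
        Tendsto (fun n => graphCurrent (u n) ω) atTop (𝓝 (graphCurrent u₀ ω)) := by
  have : IsFiniteMeasure (volume.restrict (Ω : Set E3)) :=
    ⟨by rw [Measure.restrict_apply_univ]; exact hΩ.isBounded.measure_lt_top⟩
  -- Both kinds of minimizing sequence are reduced to a uniform surface bound; in the class without
  -- surface energy C = 0 serves.
  have hbd : ∃ C : ℝ, 0 ≤ C ∧ ∃ I : ℝ≥0∞, I < ⊤ ∧ Tendsto (fun n => energy H (u n)) atTop (𝓝 I) ∧
      ∀ n, u n ∈ admissible Ω g M ∧ surfaceEnergy (u n) ≤ ENNReal.ofReal C := by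
    rcases hmin with ⟨h1, h2, h3⟩ | ⟨⟨h1, h2, h3⟩, C, hC⟩
    · exact ⟨0, le_rfl, _, h2, h3, fun n => ⟨(h1 n).1, by rw [(h1 n).2]; exact zero_le⟩⟩
    · exact ⟨max C 0, le_max_right _ _, _, h2, h3, fun n =>
        ⟨h1 n, (hC n).trans (ENNReal.ofReal_le_ofReal (le_max_left _ _))⟩⟩
  obtain ⟨C, hC0, I, hI, hEI, hadm⟩ := hbd
  obtain ⟨B, hB0, hIB⟩ : ∃ B : ℝ, 0 ≤ B ∧ I < ENNReal.ofReal B := by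
    refine ⟨I.toReal + 1, by positivity, ?_⟩
    rw [ENNReal.lt_ofReal_iff_toReal_lt hI.ne]
    linarith
  -- Early terms may have infinite energy; only from N on is the energy below the infimum plus 1.
  obtain ⟨N, hN⟩ := eventually_atTop.1 (hEI.eventually (gt_mem_nhds hIB))
  have hpos : ∀ n, ∀ᵐ x ∂(volume.restrict (Ω : Set E3)), 0 < ((u n).grad x).det :=
    fun n => (hadm n).1.2.2.1
  have hint : ∀ n, N ≤ n →
      Integrable (fun x => ((u n).grad x).det) (volume.restrict (Ω : Set E3)) := fun n hn => by
    obtain ⟨T, hT⟩ := hH.exists_mul_le 1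
    exact ((u n).integrable_det_and_integral_tail_le hH.nonneg (hpos n) hB0 (hN n hn).le one_pos
      (Nat.cast_nonneg T) hT).1
  -- Every subsequence has a further one along which the currents converge to the same limit, which
  -- yields convergence of the full sequence. The shift by k below discards indices under N.
  have hsub : ∀ ns : ℕ → ℕ, Tendsto ns atTop atTop →
      u₀.HasGraphCurrent ∧ ∃ ms : ℕ → ℕ, ∀ ω : TestForm Ω,
        Tendsto (fun n => graphCurrent (u (ns (ms n))) ω) atTop (𝓝 (graphCurrent u₀ ω)) := by
    intro ns hns
    obtain ⟨k, hk⟩ := eventually_atTop.1 (hns.eventually_ge_atTop N)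
    have hge : ∀ n, N ≤ ns (n + k) := fun n => hk _ (Nat.le_add_left _ _)
    have hlim : Tendsto (fun n => ns (n + k)) atTop atTop := hns.comp (tendsto_add_atTop_nat k)
    have hw' : WeakConvW12 (fun n => u (ns (n + k))) u₀ :=
      ⟨fun i f hf => (hweak.1 i f hf).comp hlim, fun i j f hf => (hweak.2 i j f hf).comp hlim⟩
    have hc' : WeakConvCofL1 (fun n => u (ns (n + k))) u₀ :=
      fun i j f hf => (hcof i j f hf).comp hlim
    obtain ⟨hdet, φ, hφ, hφd, hφae⟩ := exists_subseq_tendsto_det hw' hc'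
      (fun n => (hadm _).1.2.1) (fun n => hpos _)
      (A := ENNReal.ofReal B ^ (1 / (2 : ℝ)))
      (ENNReal.rpow_ne_top_of_nonneg (by norm_num) ENNReal.ofReal_ne_top)
      (fun n i j => (W12.eLpNorm_grad_le hH.nonneg (hpos _) i j).trans
        (ENNReal.rpow_le_rpow (hN _ (hge n)).le (by norm_num)))
      (fun n => hint _ (hge n))
      (fun ε hε => by
        -- The tail bound B / K becomes B ε / (B + 1) ≤ ε, the uniform integrability required.
        have hK : 0 < (B + 1) / ε := by positivity
        obtain ⟨T, hT⟩ := hH.exists_mul_le ((B + 1) / ε)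
        refine ⟨T, fun n => ((u _).integrable_det_and_integral_tail_le hH.nonneg (hpos _) hB0
          (hN _ (hge n)).le hK (Nat.cast_nonneg T) hT).2.trans ?_⟩
        rw [div_div_eq_mul_div, div_le_iff₀ (by positivity)]
        nlinarith)
      hC0 (fun n => (hadm _).2)
    refine ⟨hdet, fun n => φ n + k, fun ω => ?_⟩
    have hφt := hφ.tendsto_atTop
    exact tendsto_graphCurrent
      ⟨fun i f hf => (hw'.1 i f hf).comp hφt, fun i j f hf => (hw'.2 i j f hf).comp hφt⟩
      (fun i j f hf => (hc' i j f hf).comp hφt) (fun n => hint _ (hge _)) hdet hφd hφae ω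
  refine ⟨(hsub id tendsto_id).1, eventually_atTop.2 ⟨N, hint⟩, fun ω => ?_⟩
  refine tendsto_of_subseq_tendsto fun ns hns => ?_
  obtain ⟨-, ms, hms⟩ := hsub ns hns
  exact ⟨ms, hms ω⟩
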